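/- **HKR over $\mathbb{Z}$.** Let $I$ be a finite set, with standard basis $(\vec e_i)_{i\in I}$ of $\mathbb{Z}^I$ and $\vec e_I=\sum_{i}\vec e_i$, and let $$\tilde{\mathbb{G}}=\bigl(\mathbb{Z}\oplus\mathbb{Z}^I\bigr)/\langle(2(1-|I|),\vec e_I)\rangle ,$$ with the homomorphisms $\mathbb{Z}\to\tilde{\mathbb{G}}$, $k\mapsto(k,0)$, and $\tilde{\mathbb{G}}\to\mathbb{Z}/2$, $(k,m)\mapsto k$. All signs are taken with respect to the latter (on $\tilde{\mathbb{G}}\oplus\mathbb{Z}$: to the parity of the first component). *The Hochschild side.* Let $A=\mathbb{Z}[\theta_i]_{i\in I}$ be the exterior algebra, $\tilde{\mathbb{G}}$-graded with $\theta_i$ in degree $(-1,\vec e_i)$, and put $|a|'=|a|-1$. Let $CC^*(A)=\bigoplus_{y\in\tilde{\mathbb{G}}}CC^y(A)$, where $CC^y(A)=\prod_{s\ge 0}\mathrm{Hom}^{\,y-s}(A^{\otimes s},A)$; write $\alpha^s$ for the component of length $s$ of $\alpha$. For homogeneous $\alpha,\beta$ define $$\alpha\{\beta\}(c_1,\dots,c_s)=\sum_{i,n}(-1)^{(|\beta|-1)(|c_1|'+\dots+|c_i|')}\,\alpha(c_1,\dots,c_i,\beta(c_{i+1},\dots,c_{i+n}),c_{i+n+1},\dots,c_s),$$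 $$[\alpha,\beta]=\alpha\{\beta\}-(-1)^{(|\alpha|-1)(|\beta|-1)}\beta\{\alpha\},$$ $$(\alpha\cup\beta)(c_1,\dots,c_s)=\sum_i(-1)^{|\beta|(|c_1|'+\dots+|c_i|')}\alpha(c_1,\dots,c_i)\,\beta(c_{i+1},\dots,c_s),$$ and $\delta\alpha=[\mu^2,\alpha]$, where $\mu^2(a,b)=(-1)^{|a|}ab$. Then $\delta$ preserves $CC^*(A)$ and $\delta^2=0$. Let $HH^*(A)$ be the cohomology of $(CC^*(A),\delta)$, and let $HH^{(y,s)}(A)\subset HH^*(A)$ consist of the classes of cocycles of degree $y\in\tilde{\mathbb{G}}$ concentrated in length $s$. The cup product, the bracket and the unit cochain (of length $0$, with value $1$) descend to $HH^*(A)$, and make it a $\tilde{\mathbb{G}}\oplus\mathbb{Z}$-graded Gerstenhaber algebra, with bracket of degree $((-1,0),-1)$; in particular $HH^*(A)=\bigoplus_{(y,s)}HH^{(y,s)}(A)$. *The polyvector side.* Let $\mathbb{Z}[z_i,\theta_i]_{i\in I}=\mathbb{Z}[z_i]\otimes\mathbb{Z}[\theta_i]$, with commuting variables $z_i$ of degree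 $((2,-\vec e_i),1)$ and anti-commuting variables $\theta_i$ of degree $((-1,\vec e_i),0)$. With the Schouten bracket $$[F,G]=\sum_{i\in I}\left(\frac{\partial F}{\partial z_i}\,\frac{\overrightarrow{\partial} G}{\partial\theta_i}-\frac{F\overleftarrow{\partial}}{\partial\theta_i}\,\frac{\partial G}{\partial z_i}\right)$$ (left and right derivatives in $\theta_i$; so $[z_i,\theta_j]=\delta_{ij}$) it is a $\tilde{\mathbb{G}}\oplus\mathbb{Z}$-graded Gerstenhaber algebra, with bracket of degree $((-1,0),-1)$. *The result.* Let $\mathbf{z}=\sum_{i\in I}z_i\theta_i$, and define the HKR map $$\Xi:CC^*(A)\to\mathbb{Z}[z_i,\theta_i]_{i\in I},\qquad \Xi(\alpha)=\sum_{s=0}^\infty\alpha^s(\mathbf{z},\dots,\mathbf{z}),$$ where $\alpha^s$ is extended $\mathbb{Z}[z_i]$-multilinearly; the sum has only finitely many non-zero terms for each $\alpha\in CC^*(A)$. Then $\Xi$ induces an isomorphism of abelian groups $$HH^*(A)\;\xrightarrow{\ \cong\ }\;\mathbb{Z}[z_i,\theta_i]_{i\in I}$$ that maps $HH^{(y,s)}(A)$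 onto the part of degree $(y,s)$ for every $(y,s)\in\tilde{\mathbb{G}}\oplus\mathbb{Z}$, and that respects units, products and brackets, i.e. an isomorphism of $\tilde{\mathbb{G}}\oplus\mathbb{Z}$-graded Gerstenhaber algebras. -/

import Mathlib

open scoped TensorProduct

noncomputable section

namespace HKR

/-! ### Hochschild cochains and their operations, for a `ℤ/2`-graded algebra -/

section Cochains

variable {R A : Type*} [CommRing R] [Ring A] [Algebra R A]

/-- The space `∏ₛ Hom(A^{⊗ s}, A)`; the component `α s` is the part of length `s`. -/
abbrev Cochain (R A : Type*) [CommRing R] [Ring A] [Algebra R A] : Type _ :=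
  (s : ℕ) → MultilinearMap R (fun _ : Fin s => A) A

/-- `ev α [a₁, …, aₛ] = α^s(a₁, …, aₛ)`. -/
def ev (α : Cochain R A) (l : List A) : A := α l.length l.get

/-- A function of finite lists that is linear in every entry. -/
def ListMultilinear (R : Type*) {A : Type*} [CommRing R] [Ring A] [Algebra R A]
    (f : List A → A) : Prop :=
  ∀ l r : List A, IsLinearMap R (fun a => f (l ++ a :: r))

theorem ofFn_update {A : Type*} {s : ℕ} [DecidableEq (Fin s)] (v : Fin s → A) (i : Fin s) (x : A) :
    List.ofFn (Function.update v i x)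
      = (List.ofFn v).take i ++ x :: (List.ofFn v).drop (i + 1) := by
  have h : List.ofFn (Function.update v i x) = (List.ofFn v).set i x := by
    apply List.ext_getElem
    · simp
    · intro n h1 h2
      rw [List.getElem_set]
      simp only [List.getElem_ofFn, Function.update_apply, Fin.ext_iff]
      by_cases hn : (i : ℕ) = n
      · simp [hn]
      · simp [hn, Ne.symm hn]
  rw [h, List.set_eq_take_append_cons_drop, if_pos (by simp)]

/-- The cochain with `α^s(a₁, …, aₛ) = f [a₁, …, aₛ]`. -/
def ofList (f : List A → A) (hf : ListMultilinear R f) : Cochain R A := fun _ =>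
  { toFun := fun v => f (List.ofFn v)
    map_update_add' := fun v i x y => by
      simp only [ofFn_update]; exact (hf _ _).map_add x y
    map_update_smul' := fun v i c x => by
      simp only [ofFn_update]; exact (hf _ _).map_smul c x }

theorem ev_ofList (f : List A → A) (hf : ListMultilinear R f) (l : List A) :
    ev (ofList f hf) l = f l := by
  simp [ev, ofList]

theorem apply_eq_ev (α : Cochain R A) {s : ℕ} (v : Fin s → A) :
    α s v = ev α (List.ofFn v) := by
  have key : ∀ (t : ℕ) (h : t = s) (w : Fin t → A), (∀ j, w j = v (Fin.cast h j)) →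
      α s v = α t w := by
    intro t h w hw
    subst h
    congr 1
    funext j
    exact (hw j).symm
  exact key _ (by simp) _ (fun j => by simp [Fin.cast])

theorem ev_listMultilinear (α : Cochain R A) : ListMultilinear R (ev α) := by
  intro l r
  have hs : l.length < (l.length + 1 + r.length) := by omega
  have key : ∀ a, ev α (l ++ a :: r) = α (l.length + 1 + r.length)
      (Function.update (fun j => (l ++ 0 :: r).get (j.cast (by simp; omega)))
        ⟨l.length, hs⟩ a) := by
    intro a
    rw [apply_eq_ev, ofFn_update]
    congr 1
    have e : List.ofFn (fun j : Fin (l.length + 1 + r.length) =>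
        (l ++ 0 :: r).get (j.cast (by simp; omega))) = l ++ 0 :: r := by
      apply List.ext_getElem
      · simp; omega
      · intro n h1 h2
        simp
    rw [e]
    simp
  constructor
  · intro x y
    simp only [key, MultilinearMap.map_update_add]
  · intro c x
    simp only [key, MultilinearMap.map_update_smul]

variable (𝒜 : ZMod 2 → Submodule R A) [GradedAlgebra 𝒜]

/-- `(-1)^p` for a parity `p`. -/
def sgn (p : ZMod 2) : ℤ := if p = 0 then 1 else -1

/-- The operator `a ↦ (-1)^|a| a`. -/
def parityInv : A →ₗ[R] A := GradedAlgebra.proj 𝒜 0 - GradedAlgebra.proj 𝒜 1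

/-- The operator `a ↦ (-1)^{p |a|'} a`, where `|a|' = |a| - 1` is the degree of `a` in `A[1]`. -/
def koszul (p : ZMod 2) : A →ₗ[R] A := if p = 0 then LinearMap.id else -parityInv 𝒜

/-- The component of Hochschild degree `p` modulo 2. A cochain `A^{⊗ s} → A` has Hochschild degree
`p` when it shifts the degree of `A` by `p - s`. -/
def parityPart (p : ZMod 2) (α : Cochain R A) : Cochain R A := fun s =>
  ∑ f : Fin s → ZMod 2,
    (GradedAlgebra.proj 𝒜 (p - s + ∑ i, f i)).compMultilinearMap
      ((α s).compLinearMap (fun i => GradedAlgebra.proj 𝒜 (f i)))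

theorem map_append_linear (g : A →ₗ[R] A) (α : Cochain R A) (l r : List A) :
    IsLinearMap R (fun a => ev α (l.map g ++ g a :: r)) :=
  ⟨fun x y => by simpa using (ev_listMultilinear α (l.map g) r).map_add (g x) (g y),
   fun c x => by simpa using (ev_listMultilinear α (l.map g) r).map_smul c (g x)⟩

/-- The term of the brace `α{β}` in which `β` takes the `n` arguments after the first `i`, each of
which is first acted on by `g`. -/
def insTerm (g : A →ₗ[R] A) (α β : Cochain R A) (i n : ℕ) (c : List A) : A :=
  ev α ((c.take i).map g ++ ev β ((c.drop i).take n) :: c.drop (i + n))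

theorem insTerm_linear (g : A →ₗ[R] A) (α β : Cochain R A) (i n : ℕ) :
    ListMultilinear R (insTerm g α β i n) := by
  intro l r
  by_cases h1 : l.length < i
  · obtain ⟨k, rfl⟩ : ∃ k, i = l.length + 1 + k := ⟨i - l.length - 1, by omega⟩
    have e : ∀ a, insTerm g α β (l.length + 1 + k) n (l ++ a :: r)
        = ev α (l.map g ++ g a ::
            ((r.take k).map g ++ ev β ((r.drop k).take n) :: r.drop (k + n))) := by
      intro a
      have t1 : l.length + 1 + k - l.length = k + 1 := by omega
      have t2 : l.length + 1 + k + n - l.length = k + n + 1 := by omega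
      have t3 : l.take (l.length + 1 + k) = l := List.take_of_length_le (by omega)
      have t4 : l.drop (l.length + 1 + k) = [] := List.drop_of_length_le (by omega)
      have t5 : l.drop (l.length + 1 + k + n) = [] := List.drop_of_length_le (by omega)
      simp [insTerm, List.take_append, List.drop_append, t1, t2, t3, t4, t5]
    simp only [e]
    exact map_append_linear g α l _
  · by_cases h2 : l.length < i + n
    · obtain ⟨k, hk⟩ : ∃ k, i + n = l.length + 1 + k := ⟨i + n - l.length - 1, by omega⟩
      have e : ∀ a, insTerm g α β i n (l ++ a :: r)
          = ev α ((l.take i).map g ++ ev β (l.drop i ++ a :: r.take k) :: r.drop k) := by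
        intro a
        have t1 : i - l.length = 0 := by omega
        have t2 : i + n - l.length = k + 1 := by omega
        have t3 : n - (l.length - i) = k + 1 := by omega
        have t4 : (l.drop i).take n = l.drop i :=
          List.take_of_length_le (by rw [List.length_drop]; omega)
        have t5 : l.drop (i + n) = [] := List.drop_of_length_le (by omega)
        simp [insTerm, List.take_append, List.drop_append, t1, t2, t3, t4, t5]
      simp only [e]
      constructor
      · intro x y
        rw [(ev_listMultilinear β _ _).map_add, (ev_listMultilinear α _ _).map_add]
      · intro c x
        rw [(ev_listMultilinear β _ _).map_smul, (ev_listMultilinear α _ _).map_smul]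
    · have e : ∀ a, insTerm g α β i n (l ++ a :: r)
          = ev α (((l.take i).map g ++ ev β ((l.drop i).take n) :: l.drop (i + n)) ++ a :: r) := by
        intro a
        have t1 : i - l.length = 0 := by omega
        have t2 : i + n - l.length = 0 := by omega
        have t3 : n - (l.length - i) = 0 := by omega
        simp [insTerm, List.take_append, List.drop_append, t1, t2, t3]
      simp only [e]
      exact ev_listMultilinear α _ _

/-- The term of the cup product in which `α` takes the first `i` arguments. -/
def cupTerm (g : A →ₗ[R] A) (α β : Cochain R A) (i : ℕ) (c : List A) : A :=
  ev α ((c.take i).map g) * ev β (c.drop i)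

theorem cupTerm_linear (g : A →ₗ[R] A) (α β : Cochain R A) (i : ℕ) :
    ListMultilinear R (cupTerm g α β i) := by
  intro l r
  by_cases h1 : l.length < i
  · obtain ⟨k, rfl⟩ : ∃ k, i = l.length + 1 + k := ⟨i - l.length - 1, by omega⟩
    have e : ∀ a, cupTerm g α β (l.length + 1 + k) (l ++ a :: r)
        = ev α (l.map g ++ g a :: (r.take k).map g) * ev β (r.drop k) := by
      intro a
      have t1 : l.length + 1 + k - l.length = k + 1 := by omega
      have t3 : l.take (l.length + 1 + k) = l := List.take_of_length_le (by omega)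
      have t4 : l.drop (l.length + 1 + k) = [] := List.drop_of_length_le (by omega)
      simp [cupTerm, List.take_append, List.drop_append, t1, t3, t4]
    simp only [e]
    have h := map_append_linear g α l ((r.take k).map g)
    exact ⟨fun x y => by rw [h.map_add, add_mul],
      fun c x => by rw [h.map_smul, smul_mul_assoc]⟩
  · have e : ∀ a, cupTerm g α β i (l ++ a :: r)
        = ev α ((l.take i).map g) * ev β (l.drop i ++ a :: r) := by
      intro a
      have t1 : i - l.length = 0 := by omega
      simp [cupTerm, List.take_append, List.drop_append, t1]
    simp only [e]
    have h := ev_listMultilinear β (l.drop i) r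
    exact ⟨fun x y => by rw [h.map_add, mul_add],
      fun c x => by rw [h.map_smul, mul_smul_comm]⟩

theorem sum_range_linear (N : ℕ → ℕ) (t : ℕ → List A → A)
    (ht : ∀ i, ListMultilinear R (t i)) :
    ListMultilinear R (fun c => ∑ i ∈ Finset.range (N c.length), t i c) := by
  intro l r
  constructor
  · intro x y
    simp only [List.length_append, List.length_cons, ← Finset.sum_add_distrib]
    exact Finset.sum_congr rfl fun i _ => (ht i l r).map_add x y
  · intro c x
    simp only [List.length_append, List.length_cons, Finset.smul_sum]
    exact Finset.sum_congr rfl fun i _ => (ht i l r).map_smul c x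

theorem sum_range_linear₂ (N : ℕ → ℕ) (M : ℕ → ℕ → ℕ) (t : ℕ → ℕ → List A → A)
    (ht : ∀ i n, ListMultilinear R (t i n)) :
    ListMultilinear R (fun c => ∑ i ∈ Finset.range (N c.length),
      ∑ n ∈ Finset.range (M c.length i), t i n c) :=
  sum_range_linear N (fun i c => ∑ n ∈ Finset.range (M c.length i), t i n c)
    (fun i => sum_range_linear (fun k => M k i) (t i) (ht i))

/-- The brace `α{β}`, for `β` of Hochschild degree `p` modulo 2:
`α{β}(c₁, …, cₛ) = ∑ (-1)^† α(c₁, …, cᵢ, β(cᵢ₊₁, …, cᵢ₊ₙ), cᵢ₊ₙ₊₁, …, cₛ)` with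
`† = (p - 1)(|c₁|' + ⋯ + |cᵢ|')`. -/
def braceHom (p : ZMod 2) (α β : Cochain R A) : Cochain R A :=
  ofList (fun c => ∑ i ∈ Finset.range (c.length + 1), ∑ n ∈ Finset.range (c.length - i + 1),
      insTerm (koszul 𝒜 (p - 1)) α β i n c)
    (sum_range_linear₂ (fun k => k + 1) (fun k i => k - i + 1) _
      (fun i n => insTerm_linear _ α β i n))

/-- The cup product, for `β` of Hochschild degree `p` modulo 2:
`(α ∪ β)(c₁, …, cₛ) = ∑ (-1)^{p (|c₁|' + ⋯ + |cᵢ|')} α(c₁, …, cᵢ) β(cᵢ₊₁, …, cₛ)`. -/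
def cupHom (p : ZMod 2) (α β : Cochain R A) : Cochain R A :=
  ofList (fun c => ∑ i ∈ Finset.range (c.length + 1), cupTerm (koszul 𝒜 p) α β i c)
    (sum_range_linear (fun k => k + 1) _ (fun i => cupTerm_linear _ α β i))

/-- The cup product of Hochschild cochains. -/
def cup (α β : Cochain R A) : Cochain R A :=
  ∑ p : ZMod 2, cupHom 𝒜 p α (parityPart 𝒜 p β)

/-- The Gerstenhaber bracket `[α, β] = α{β} - (-1)^{(|α| - 1)(|β| - 1)} β{α}`. -/
def gerstenhaberBracket (α β : Cochain R A) : Cochain R A :=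
  ∑ p : ZMod 2, ∑ q : ZMod 2,
    (braceHom 𝒜 q (parityPart 𝒜 p α) (parityPart 𝒜 q β)
      - sgn ((p - 1) * (q - 1)) • braceHom 𝒜 p (parityPart 𝒜 q β) (parityPart 𝒜 p α))

/-- The multiplication of `A` as the cochain `μ²(a, b) = (-1)^|a| a b` of length 2. -/
def mulCochain : Cochain R A :=
  Pi.single 2
    { toFun := fun v => parityInv 𝒜 (v 0) * v 1
      map_update_add' := fun v i x y => by
        fin_cases i <;> simp [add_mul, mul_add]
      map_update_smul' := fun v i c x => by
        fin_cases i <;> simp }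

/-- The cochain of length 0 with value `1`. -/
def unitCochain (R A : Type*) [CommRing R] [Ring A] [Algebra R A] : Cochain R A :=
  Pi.single 0 (MultilinearMap.constOfIsEmpty R _ 1)

/-- The Hochschild differential `δ α = [μ², α]`. -/
def hochschildDiff (α : Cochain R A) : Cochain R A :=
  gerstenhaberBracket 𝒜 (mulCochain 𝒜) α

theorem parityPart_add (p : ZMod 2) (α β : Cochain R A) :
    parityPart 𝒜 p (α + β) = parityPart 𝒜 p α + parityPart 𝒜 p β := by
  funext s
  ext v
  simp [parityPart, Finset.sum_add_distrib]

theorem parityPart_smul (p : ZMod 2) (c : R) (α : Cochain R A) :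
    parityPart 𝒜 p (c • α) = c • parityPart 𝒜 p α := by
  funext s
  ext v
  simp [parityPart, Finset.smul_sum]

theorem ev_add (α β : Cochain R A) (l : List A) : ev (α + β) l = ev α l + ev β l := rfl

theorem ev_smul (c : R) (α : Cochain R A) (l : List A) : ev (c • α) l = c • ev α l := rfl

theorem braceHom_add_left (p : ZMod 2) (α α' β : Cochain R A) :
    braceHom 𝒜 p (α + α') β = braceHom 𝒜 p α β + braceHom 𝒜 p α' β := by
  funext s
  ext v
  simp [braceHom, ofList, insTerm, ev_add, Finset.sum_add_distrib]

theorem braceHom_smul_left (p : ZMod 2) (c : R) (α β : Cochain R A) :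
    braceHom 𝒜 p (c • α) β = c • braceHom 𝒜 p α β := by
  funext s
  ext v
  simp [braceHom, ofList, insTerm, ev_smul, Finset.smul_sum]

theorem insTerm_add_right (g : A →ₗ[R] A) (α β β' : Cochain R A) (i n : ℕ) (c : List A) :
    insTerm g α (β + β') i n c = insTerm g α β i n c + insTerm g α β' i n c := by
  simp only [insTerm, ev_add]
  exact (ev_listMultilinear α _ _).map_add _ _

theorem insTerm_smul_right (g : A →ₗ[R] A) (k : R) (α β : Cochain R A) (i n : ℕ) (c : List A) :
    insTerm g α (k • β) i n c = k • insTerm g α β i n c := by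
  simp only [insTerm, ev_smul]
  exact (ev_listMultilinear α _ _).map_smul _ _

theorem braceHom_add_right (p : ZMod 2) (α β β' : Cochain R A) :
    braceHom 𝒜 p α (β + β') = braceHom 𝒜 p α β + braceHom 𝒜 p α β' := by
  funext s
  ext v
  simp [braceHom, ofList, insTerm_add_right, Finset.sum_add_distrib]

theorem braceHom_smul_right (p : ZMod 2) (k : R) (α β : Cochain R A) :
    braceHom 𝒜 p α (k • β) = k • braceHom 𝒜 p α β := by
  funext s
  ext v
  simp [braceHom, ofList, insTerm_smul_right, Finset.smul_sum]

/-- The Hochschild differential as a linear map. -/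
def hochschildDiffₗ : Cochain R A →ₗ[R] Cochain R A where
  toFun := hochschildDiff 𝒜
  map_add' α β := by
    simp only [hochschildDiff, gerstenhaberBracket, parityPart_add, braceHom_add_left,
      braceHom_add_right, ← Finset.sum_add_distrib]
    refine Finset.sum_congr rfl fun p _ => Finset.sum_congr rfl fun q _ => ?_
    rw [smul_add]; abel
  map_smul' c α := by
    simp only [hochschildDiff, gerstenhaberBracket, parityPart_smul, braceHom_smul_left,
      braceHom_smul_right, Finset.smul_sum, RingHom.id_apply]
    refine Finset.sum_congr rfl fun p _ => Finset.sum_congr rfl fun q _ => ?_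
    rw [smul_sub, smul_comm c]

end Cochains

/-! ### Graded Gerstenhaber algebras -/

open Classical in
/-- `H`, with the grading `gr` by an abelian group `D`, product `mul`, unit `one` and bracket `br`
of degree `b`, is a graded Gerstenhaber algebra; signs are taken through the parity
`par : D → ℤ/2`, for which the bracket is odd. -/
structure IsGradedGerstenhaber {D H : Type*} [AddCommGroup D] [AddCommGroup H]
    (par : D →+ ZMod 2) (b : D) (gr : D → Submodule ℤ H)
    (mul br : H →ₗ[ℤ] H →ₗ[ℤ] H) (one : H) : Prop where
  par_bracket : par b = 1
  isInternal : DirectSum.IsInternal gr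
  one_mem : one ∈ gr 0
  mul_mem : ∀ c d x y, x ∈ gr c → y ∈ gr d → mul x y ∈ gr (c + d)
  br_mem : ∀ c d x y, x ∈ gr c → y ∈ gr d → br x y ∈ gr (c + d + b)
  one_mul : ∀ x, mul one x = x
  mul_one : ∀ x, mul x one = x
  mul_assoc : ∀ x y z, mul (mul x y) z = mul x (mul y z)
  mul_comm : ∀ c d x y, x ∈ gr c → y ∈ gr d → mul x y = sgn (par c * par d) • mul y x
  br_antisymm : ∀ c d x y, x ∈ gr c → y ∈ gr d →
    br x y = -(sgn ((par c - 1) * (par d - 1)) • br y x)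
  jacobi : ∀ c d x y z, x ∈ gr c → y ∈ gr d →
    br x (br y z) = br (br x y) z + sgn ((par c - 1) * (par d - 1)) • br y (br x z)
  leibniz : ∀ c d x y z, x ∈ gr c → y ∈ gr d →
    br x (mul y z) = mul (br x y) z + sgn ((par c - 1) * par d) • mul y (br x z)

/-! ### The grading group and the two algebras -/

section Exterior

variable (I : Type*) [Fintype I]

/-- The group `ℤ ⊕ ℤ^I / ⟨(2(1 - |I|), e_I)⟩`. -/
abbrev GG : Type _ :=
  (ℤ × (I → ℤ)) ⧸ AddSubgroup.zmultiples ((2 * (1 - (Fintype.card I : ℤ)), fun _ => 1) : ℤ × (I → ℤ))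

/-- The class of `(k, m)`. -/
def GG.mk (k : ℤ) (m : I → ℤ) : GG I := QuotientAddGroup.mk (k, m)

/-- The homomorphism `ℤ → GG`, `k ↦ (k, 0)`. -/
def GG.ofInt (k : ℤ) : GG I := GG.mk I k 0

/-- The sign homomorphism `GG → ℤ/2`, `(k, m) ↦ k`. -/
def GG.parity : GG I →+ ZMod 2 :=
  QuotientAddGroup.lift _ ((Int.castAddHom (ZMod 2)).comp (AddMonoidHom.fst ℤ (I → ℤ))) (by
    rw [AddSubgroup.zmultiples_le]
    have h2 : (2 : ZMod 2) = 0 := rfl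
    simp [AddMonoidHom.mem_ker, h2])

/-- The exterior algebra `ℤ[θᵢ]`, on `ℤ^I`. -/
abbrev Ext : Type _ := ExteriorAlgebra ℤ (I → ℤ)

/-- The `ℤ/2`-grading of the exterior algebra in which all `θᵢ` are odd. -/
abbrev extParity : ZMod 2 → Submodule ℤ (Ext I) :=
  CliffordAlgebra.evenOdd (0 : QuadraticForm ℤ (I → ℤ))

/-- The algebra `ℤ[zᵢ, θᵢ] = ℤ[zᵢ] ⊗ ℤ[θᵢ]`. -/
abbrev PolyExt : Type _ := MvPolynomial I ℤ ⊗[ℤ] Ext I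

variable [DecidableEq I]

/-- The generator `θᵢ`. -/
def θ (i : I) : Ext I := ExteriorAlgebra.ι ℤ (Pi.single i 1)

/-- `θ_{i₁} ⋯ θ_{iₖ}` for a list `[i₁, …, iₖ]`. -/
def θprod (l : List I) : Ext I := (l.map (θ I)).prod

/-- The degree `(-1, eᵢ)` of `θᵢ`. -/
def θdeg (i : I) : GG I := GG.mk I (-1) (Pi.single i 1)

/-- The degree `(2, -eᵢ)` of `zᵢ` in the first factor of `GG ⊕ ℤ`. -/
def zdeg (i : I) : GG I := GG.mk I 2 (-Pi.single i 1)

/-- The part of degree `g` of the exterior algebra. -/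
def extGr (g : GG I) : Submodule ℤ (Ext I) :=
  Submodule.span ℤ {x | ∃ l : List I, (l.map (θdeg I)).sum = g ∧ x = θprod I l}

/-- The part of degree `d` of `ℤ[zᵢ, θᵢ]`, where `zᵢ` has degree `((2, -eᵢ), 1)` and `θᵢ` has degree
`((-1, eᵢ), 0)`. -/
def polyExtGr (d : GG I × ℤ) : Submodule ℤ (PolyExt I) :=
  Submodule.span ℤ {x | ∃ (m : I →₀ ℕ) (l : List I),
    (m.sum fun i k => k • ((zdeg I i, 1) : GG I × ℤ))
      + (l.map fun i => ((θdeg I i, 0) : GG I × ℤ)).sum = d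
    ∧ x = MvPolynomial.monomial m (1 : ℤ) ⊗ₜ[ℤ] θprod I l}

/-- The parity on `GG ⊕ ℤ`. -/
def bigParity : GG I × ℤ →+ ZMod 2 := (GG.parity I).comp (AddMonoidHom.fst _ _)

/-- The degree `((-1, 0), -1)` of the brackets. -/
def bracketDeg : GG I × ℤ := (GG.ofInt I (-1), -1)

/-! ### The Schouten bracket -/

/-- `∂/∂zᵢ`. -/
def dz (i : I) : PolyExt I →ₗ[ℤ] PolyExt I :=
  TensorProduct.map ((MvPolynomial.pderiv i).toLinearMap.restrictScalars ℤ) LinearMap.id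

/-- The left derivative `∂/∂θᵢ`: `θᵢ x ↦ x` for `x` free of `θᵢ`. -/
def dθleft (i : I) : PolyExt I →ₗ[ℤ] PolyExt I :=
  TensorProduct.map LinearMap.id (CliffordAlgebra.contractLeft (LinearMap.proj i))

/-- The right derivative `∂/∂θᵢ`: `x θᵢ ↦ x` for `x` free of `θᵢ`. -/
def dθright (i : I) : PolyExt I →ₗ[ℤ] PolyExt I :=
  TensorProduct.map LinearMap.id
    ((CliffordAlgebra.contractRight (Q := (0 : QuadraticForm ℤ (I → ℤ)))).flip (LinearMap.proj i))

/-- The Schouten bracket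
`[F, G] = ∑ᵢ (∂F/∂zᵢ) (∂ₗG/∂θᵢ) - (∂ᵣF/∂θᵢ) (∂G/∂zᵢ)`, in which `[zᵢ, θⱼ] = δᵢⱼ`. -/
def schouten : PolyExt I →ₗ[ℤ] PolyExt I →ₗ[ℤ] PolyExt I :=
  ∑ i, ((LinearMap.mul ℤ (PolyExt I)).compl₁₂ (dz I i) (dθleft I i)
    - (LinearMap.mul ℤ (PolyExt I)).compl₁₂ (dθright I i) (dz I i))

/-! ### The Hochschild complex and cohomology of the exterior algebra -/

/-- Multilinear maps `ℤ[θᵢ]^{⊗ s} → ℤ[θᵢ]` that shift degrees by `g`. -/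
def homGr (s : ℕ) (g : GG I) : Submodule ℤ (MultilinearMap ℤ (fun _ : Fin s => Ext I) (Ext I)) where
  carrier := {f | ∀ (d : Fin s → GG I) (a : Fin s → Ext I), (∀ i, a i ∈ extGr I (d i)) →
    f a ∈ extGr I (∑ i, d i + g)}
  add_mem' hf hg d a ha := add_mem (hf d a ha) (hg d a ha)
  zero_mem' _ _ _ := zero_mem _
  smul_mem' c _ hf d a ha := Submodule.smul_mem _ c (hf d a ha)

/-- Cochains of degree `y`: `CC^y = ∏ₛ Hom^{y - s}(ℤ[θᵢ]^{⊗ s}, ℤ[θᵢ])`. -/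
def CCdeg (y : GG I) : Submodule ℤ (Cochain ℤ (Ext I)) :=
  Submodule.pi Set.univ fun s => homGr I s (y - GG.ofInt I s)

/-- The graded Hochschild complex `CC^* = ⨁_y CC^y`. -/
def CC : Submodule ℤ (Cochain ℤ (Ext I)) := ⨆ y, CCdeg I y

/-- Cochains of degree `d.1` and of length `d.2`. -/
def CCbideg (d : GG I × ℤ) : Submodule ℤ (Cochain ℤ (Ext I)) :=
  CCdeg I d.1 ⊓ Submodule.pi {s : ℕ | (s : ℤ) ≠ d.2} fun _ => ⊥

/-- Hochschild cocycles. -/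
def cocycles : Submodule ℤ (Cochain ℤ (Ext I)) :=
  CC I ⊓ LinearMap.ker (hochschildDiffₗ (extParity I))

/-- Hochschild coboundaries. -/
def coboundaries : Submodule ℤ (Cochain ℤ (Ext I)) :=
  (CC I).map (hochschildDiffₗ (extParity I))

/-- Hochschild cohomology: cocycles modulo coboundaries. -/
abbrev HH : Type _ := cocycles I ⧸ (coboundaries I).comap (cocycles I).subtype

/-- The class of a cocycle. -/
def HH.mk : cocycles I →ₗ[ℤ] HH I := Submodule.mkQ _

/-- The classes of cocycles of degree `d.1` and of length `d.2`. -/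
def HHgr (d : GG I × ℤ) : Submodule ℤ (HH I) :=
  ((CCbideg I d).comap (cocycles I).subtype).map (HH.mk I)

/-! ### The HKR map -/

/-- `α^s(𝐳, …, 𝐳)` for `𝐳 = ∑ᵢ zᵢ θᵢ`, with `α^s` extended `ℤ[zᵢ]`-multilinearly: the sum of
`z_{i₁} ⋯ z_{iₛ} α^s(θ_{i₁}, …, θ_{iₛ})` over all `i₁, …, iₛ`. -/
def evalz (α : Cochain ℤ (Ext I)) (s : ℕ) : PolyExt I :=
  ∑ f : Fin s → I, (∏ k, MvPolynomial.X (f k)) ⊗ₜ[ℤ] α s (fun k => θ I (f k))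

/-- The HKR map `Ξ(α) = ∑ₛ α^s(𝐳, …, 𝐳)`. -/
def Xi (α : Cochain ℤ (Ext I)) : PolyExt I := ∑ᶠ s, evalz I α s

end Exterior

end HKR

end

open scoped TensorProduct

noncomputable section

namespace HKR

set_option linter.unusedSectionVars false

/-! ### Sums over deconcatenations of a list -/

section Split

variable {A A' M N : Type*} [AddCommGroup M] [AddCommGroup N]

/-! For a cochain of parity p, the Hochschild differential is, up to the sign (-1)^p, the bar
differential of the exterior algebra A with coefficients in the bimodule A whose left action is
twisted by the p-th power of the parity involution (`ev_hochschildDiff_eq`). Consecutive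
differentials therefore use bimodules that differ by one twist.

For coefficients in any bimodule M, substituting 𝐳 for every argument is a chain map from the bar
complex to a Koszul complex of power series in the zᵢ over M, with differential ∑ zᵢ(right minus
left action of θᵢ) (`symSum_dBar`): products θᵢθⱼ are antisymmetric while zᵢzⱼ is symmetric, so all
terms that multiply adjacent arguments cancel. When M is A with the twist matching the degree of the
cochain, graded commutativity makes the Koszul differential of the substituted cochain zero. Hence Ξ
kills coboundaries (`symSum_hochschildDiff`).

Injectivity on cohomology is `exists_dBar_eq`: a bar cocycle whose substitution is a Koszul boundary
is itself a bar boundary. It is proved by dimension shifting in the length. M embeds in the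
coinduced bimodule of additive maps A → M, where currying turns a cocycle into a boundary
(`dBar_curryL`) and where the Koszul complex is exact away from the constant term, contraction
against ∂/∂θᵢ being a homotopy (`exists_dK_eq`). The problem thus moves to the quotient bimodule and
to cochains one shorter (`exists_of_red` returns); in length 1 a derivation is compared with an
inner one on the generators. The bimodule argument ignores degrees, which are restored at the end by
projecting to a homogeneous part (`dBar_degL`).

Surjectivity is explicit: z_{i₁}⋯z_{iₖ}a is the image of the cocycle a ∪ ∂/∂θ_{i₁} ∪ ⋯ ∪ ∂/∂θ_{iₖ}
(`Xi_std`). Together these show that every cocycle is a standard one plus a coboundary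
(`sub_stdHom_mem`).

Since the differential is a derivation of the cup product and of the bracket (`hochschildDiff_cup`,
`hochschildDiff_bracket`), compatibility of Ξ with either operation needs checking only on standard
cocycles (`Xi_op`); for the bracket this is a Leibniz induction on the number of derivations
(`polySum_brace`). The Gerstenhaber axioms are proved for polyvectors and transported to cohomology.
The one exception in direction is the Jacobi identity for the Schouten bracket, which is read off
from the one for cochains; that in turn follows from the pre-Lie relation for braces. -/

/-- The sum of `G u v` over all decompositions `l = u ++ v`. -/
def splitSum (G : List A → List A → M) : List A → M
  | [] => G [] []
  | a :: l => G [] (a :: l) + splitSum (fun u v => G (a :: u) v) l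

/-- The recursive form is suited to induction on the list, the indexed form to exchanging sums and
to matching the `take`/`drop` formulas for cochains. -/
theorem splitSum_eq_sum_range (G : List A → List A → M) (l : List A) :
    splitSum G l = ∑ i ∈ Finset.range (l.length + 1), G (l.take i) (l.drop i) := by
  induction l generalizing G with
  | nil => simp [splitSum]
  | cons a l ih =>
    rw [splitSum, ih, List.length_cons, Finset.sum_range_succ' _ (l.length + 1), add_comm]
    rfl

theorem splitSum_congr {G G' : List A → List A → M} {l : List A}
    (h : ∀ u v, u ++ v = l → G u v = G' u v) : splitSum G l = splitSum G' l := by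
  rw [splitSum_eq_sum_range, splitSum_eq_sum_range]
  exact Finset.sum_congr rfl fun i _ => h _ _ (List.take_append_drop i l)

theorem splitSum_mem {S : Type*} [SetLike S M] [AddSubmonoidClass S M] (s : S)
    {G : List A → List A → M} {l : List A} (h : ∀ u v, u ++ v = l → G u v ∈ s) :
    splitSum G l ∈ s := by
  rw [splitSum_eq_sum_range]
  exact sum_mem fun i _ => h _ _ (List.take_append_drop i l)

theorem map_splitSum {F : Type*} [FunLike F M N] [AddMonoidHomClass F M N] (f : F)
    (G : List A → List A → M) (l : List A) :
    f (splitSum G l) = splitSum (fun u v => f (G u v)) l := by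
  rw [splitSum_eq_sum_range, splitSum_eq_sum_range, map_sum]

theorem splitSum_add (G G' : List A → List A → M) (l : List A) :
    splitSum (fun u v => G u v + G' u v) l = splitSum G l + splitSum G' l := by
  simp only [splitSum_eq_sum_range, Finset.sum_add_distrib]

theorem splitSum_zero (l : List A) : splitSum (fun _ _ => (0 : M)) l = 0 := by
  simp [splitSum_eq_sum_range]

theorem splitSum_zsmul (n : ℤ) (G : List A → List A → M) (l : List A) :
    splitSum (fun u v => n • G u v) l = n • splitSum G l := by
  simp only [splitSum_eq_sum_range, Finset.smul_sum]

theorem splitSum_map (g : A' → A) (G : List A → List A → M) (l : List A') :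
    splitSum G (l.map g) = splitSum (fun u v => G (u.map g) (v.map g)) l := by
  simp [splitSum_eq_sum_range, List.map_take, List.map_drop]

/-- A cut of `u ++ x :: r` is before or after `x`. -/
theorem splitSum_append_cons (G : List A → List A → M) (u : List A) (x : A) (r : List A) :
    splitSum G (u ++ x :: r) = splitSum (fun a b => G a (b ++ x :: r)) u
      + splitSum (fun a b => G (u ++ x :: a) b) r := by
  induction u generalizing G with
  | nil => simp [splitSum]
  | cons c u ih => simp [splitSum, ih, add_assoc]

theorem splitSum_comm (G : List A → List A → List A' → List A' → M) (l : List A) (l' : List A') :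
    splitSum (fun u v => splitSum (fun u' v' => G u v u' v') l') l
      = splitSum (fun u' v' => splitSum (fun u v => G u v u' v') l) l' := by
  simp only [splitSum_eq_sum_range]
  exact Finset.sum_comm

/-- Deconcatenation is coassociative. -/
theorem splitSum_assoc (G : List A → List A → List A → M) (l : List A) :
    splitSum (fun w r => splitSum (fun u v => G u v r) w) l
      = splitSum (fun u w => splitSum (fun v r => G u v r) w) l := by
  induction l generalizing G with
  | nil => simp [splitSum]
  | cons c l ih =>
    simp only [splitSum]
    rw [splitSum_add, ih]
    abel

theorem splitSum_left_nil (G : List A → List A → M) (l : List A)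
    (h : ∀ u v, u ≠ [] → G u v = 0) : splitSum G l = G [] l := by
  cases l with
  | nil => rfl
  | cons a l => simp [splitSum, h, splitSum_zero]

theorem splitSum_right_nil (G : List A → List A → M) (l : List A)
    (h : ∀ u v, v ≠ [] → G u v = 0) : splitSum G l = G l [] := by
  induction l generalizing G with
  | nil => rfl
  | cons a l ih => rw [splitSum, h _ _ (by simp), zero_add, ih _ (fun u v hv => h _ _ hv)]

/-- The brace `F{b}`, where the arguments before the insertion are acted on by `g`. -/
def brace (g : A → A) (F : List A → M) (b : List A → A) (l : List A) : M :=
  splitSum (fun u w => splitSum (fun v r => F (u.map g ++ b v :: r)) w) l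

theorem brace_cons (g : A → A) (F : List A → M) (b : List A → A) (a : A) (l : List A) :
    brace g F b (a :: l) = splitSum (fun v r => F (b v :: r)) (a :: l)
      + brace g (fun t => F (g a :: t)) b l := by
  simp [brace, splitSum]

theorem brace_nil (g : A → A) (F : List A → M) (b : List A → A) :
    brace g F b [] = F [b []] := by
  simp [brace, splitSum]

/-- The terms of an iterated brace in which two cochains are inserted side by side. -/
def braceTwo (g h : A → A) (F : List A → M) (b c : List A → A) (l : List A) : M :=
  splitSum (fun x w => splitSum (fun y w => splitSum (fun z w => splitSum (fun v r =>
    F (x.map (g ∘ h) ++ b (y.map h) :: z.map h ++ c v :: r)) w) w) w) l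

/-- The inserted block lies before x, contains x, or lies after x. Only in the last case does x
receive the sign operator g. -/
theorem brace_append_cons (g : A → A) (F : List A → M) (b : List A → A) (u : List A) (x : A)
    (r : List A) : brace g F b (u ++ x :: r)
      = splitSum (fun y w => splitSum (fun z t => F (y.map g ++ b z :: t ++ x :: r)) w) u
        + splitSum (fun y z => splitSum (fun z' t => F (y.map g ++ b (z ++ x :: z') :: t)) r) u
        + splitSum (fun y w => splitSum (fun z t =>
            F (u.map g ++ g x :: y.map g ++ b z :: t)) w) r := by
  rw [brace, splitSum_append_cons]
  simp only [splitSum_append_cons, splitSum_add, List.map_append, List.map_cons, List.append_assoc,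
    List.cons_append]

/-- The pre-Lie relation, with the terms that are symmetric in the two insertions made explicit. -/
theorem brace_brace [AddCommGroup A] (g h : A → A) (F : List A → M) (b c : List A → A) (e : ℤ)
    (hF : ∀ l r, ∃ f : A →+ M, ∀ a, F (l ++ a :: r) = f a)
    (hgh : ∀ a, g (h a) = h (g a)) (hc : ∀ l, g (c l) = e • c (l.map g)) (l : List A) :
    brace h (brace g F b) c l = brace (g ∘ h) F (brace h b c) l
      + (braceTwo g h F b c l + e • braceTwo h g F c b l) := by
  have hsum : ∀ (l r : List A) (G : List A → List A → A) (w : List A),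
      F (l ++ splitSum G w :: r) = splitSum (fun u v => F (l ++ G u v :: r)) w := by
    intro l r G w
    obtain ⟨f, hf⟩ := hF l r
    simp only [hf, map_splitSum]
  have hsm : ∀ (l r : List A) (a : A), F (l ++ (e • a) :: r) = e • F (l ++ a :: r) := by
    intro l r a
    obtain ⟨f, hf⟩ := hF l r
    simp only [hf, map_zsmul]
  have hcomp : h ∘ g = g ∘ h := funext fun a => (hgh a).symm
  rw [brace]
  simp only [brace_append_cons, splitSum_add, splitSum_map, List.map_map]
  rw [add_right_comm, add_comm]
  congr 1
  -- The block taken by b contains the value of c: these are the nested insertions.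
  · simp only [brace, hsum]
    refine (splitSum_congr fun u w _ => splitSum_comm _ _ _).trans ?_
    refine (splitSum_assoc (fun y z w => splitSum (fun v r => splitSum (fun z' t =>
      F (y.map (g ∘ h) ++ b (z.map h ++ c v :: z') :: t)) r) w) l).trans ?_
    refine splitSum_congr fun y x _ => Eq.symm ?_
    refine (splitSum_assoc (fun z w t => splitSum (fun v z' =>
      F (y.map (g ∘ h) ++ b (z.map h ++ c v :: z') :: t)) w) x).trans ?_
    exact splitSum_congr fun z s _ => splitSum_assoc _ _
  · congr 1
    -- The block taken by b lies entirely before the value of c.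
    · refine (splitSum_congr fun u w _ => splitSum_comm _ _ _).trans ?_
      refine (splitSum_assoc (fun x y w => splitSum (fun v r => splitSum (fun y z =>
        F (x.map (g ∘ h) ++ b (y.map h) :: z.map h ++ c v :: r)) y) w) l).trans ?_
      refine splitSum_congr fun x w _ => ?_
      refine (splitSum_congr fun u w _ => splitSum_comm _ _ _).trans ?_
      exact splitSum_assoc (fun y z w => splitSum (fun v r =>
        F (x.map (g ∘ h) ++ b (y.map h) :: z.map h ++ c v :: r)) w) w
    -- The block taken by b lies after the value of c, so g acts on that value; moving g inside c
    -- costs the sign e and exchanges the roles of b and c.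
    · rw [braceTwo, ← splitSum_zsmul]
      refine splitSum_congr fun x w _ => ?_
      simp only [← splitSum_zsmul]
      refine splitSum_congr fun y w _ => splitSum_congr fun z w _ => splitSum_congr fun v r _ => ?_
      rw [hc, hcomp]
      simp only [List.append_assoc, List.cons_append, hsm]

/-- Insertion into one of the two parts of a list is a derivation of deconcatenation. -/
theorem brace_splitSum [AddCommGroup A] (g h : A → A) (G : List A → List A → M) (b : List A → A)
    (e : ℤ) (hG : ∀ l r v, ∃ f : A →+ M, ∀ a, G (l ++ a :: r) v = f a)
    (hgh : ∀ a, g (h a) = h (g a)) (hb : ∀ l, g (b l) = e • b (l.map g)) (l : List A) :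
    brace h (splitSum (fun u v => G (u.map g) v)) b l
      = splitSum (fun u w => brace h (G (u.map (g ∘ h))) b w) l
        + e • splitSum (fun w r => brace h (fun t => G t r) b (w.map g)) l := by
  have hsm : ∀ (l r v : List A) (a : A), G (l ++ (e • a) :: r) v = e • G (l ++ a :: r) v := by
    intro l r v a
    obtain ⟨f, hf⟩ := hG l r v
    simp only [hf, map_zsmul]
  have hcomp : h ∘ g = g ∘ h := funext fun a => (hgh a).symm
  rw [brace]
  simp only [splitSum_append_cons, splitSum_add, splitSum_map, List.map_map, brace]
  congr 1
  · refine (splitSum_congr fun u w _ => splitSum_comm _ _ _).trans ?_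
    exact splitSum_assoc (fun x y w => splitSum (fun v r =>
      G (x.map (g ∘ h)) (y.map h ++ b v :: r)) w) l
  · rw [← splitSum_zsmul]
    refine Eq.trans ?_ (splitSum_assoc (fun u s c => e • splitSum (fun v a =>
      G (u.map (h ∘ g) ++ b (v.map g) :: a.map g) c) s) l).symm |>.trans ?_
    · refine splitSum_congr fun u w _ => ?_
      simp only [← splitSum_zsmul]
      refine Eq.trans (splitSum_congr fun v r _ => splitSum_congr fun a c _ => ?_)
        (splitSum_assoc (fun v a c =>
          e • G (u.map (h ∘ g) ++ b (v.map g) :: a.map g) c) w).symm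
      simp only [List.map_append, List.map_cons, List.map_map, hb, hcomp, hsm]
    · simp only [splitSum_zsmul]

/-- The cup product of functions of lists, where the arguments of the first factor are acted on
by `g`. -/
def cupL [Mul M] (g : A → A) (F G : List A → M) (l : List A) : M :=
  splitSum (fun u v => F (u.map g) * G v) l

end Split

/-! ### Cup products of list functions with values in a ring. -/

section SplitMul

variable {A B : Type*} [Ring B]

/-- Coassociativity of deconcatenation. The arguments of F stand to the left of both G and H, so
they collect both sign operators. -/
theorem cupL_assoc (g h : A → A) (F G H : List A → B) :
    cupL h (cupL g F G) H = cupL (g ∘ h) F (cupL h G H) := by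
  funext l
  simp only [cupL, splitSum_map, List.map_map]
  have h1 : ∀ (b : B) (K : List A → List A → B) l,
      splitSum K l * b = splitSum (fun u v => K u v * b) l :=
    fun b K l => map_splitSum (AddMonoidHom.mulRight b) K l
  have h2 : ∀ (b : B) (K : List A → List A → B) l,
      b * splitSum K l = splitSum (fun u v => b * K u v) l :=
    fun b K l => map_splitSum (AddMonoidHom.mulLeft b) K l
  simp only [h1, h2, ← mul_assoc]
  exact splitSum_assoc (fun u v r => F (u.map (g ∘ h)) * G (v.map h) * H r) l

theorem cupL_add_left (g : A → A) (F F' G : List A → B) :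
    cupL g (F + F') G = cupL g F G + cupL g F' G := by
  funext l
  simp [cupL, add_mul, splitSum_add]

theorem cupL_add_right (g : A → A) (F G G' : List A → B) :
    cupL g F (G + G') = cupL g F G + cupL g F G' := by
  funext l
  simp [cupL, mul_add, splitSum_add]

theorem cupL_zsmul_left (g : A → A) (n : ℤ) (F G : List A → B) :
    cupL g (n • F) G = n • cupL g F G := by
  funext l
  simp only [cupL, Pi.smul_apply, ← splitSum_zsmul, smul_mul_assoc]

theorem cupL_zsmul_right (g : A → A) (n : ℤ) (F G : List A → B) :
    cupL g F (n • G) = n • cupL g F G := by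
  funext l
  simp only [cupL, Pi.smul_apply, ← splitSum_zsmul, mul_smul_comm]

end SplitMul

/-! ### The exterior algebra -/

theorem sgn_zero : sgn 0 = 1 := rfl

theorem sgn_one : sgn 1 = -1 := rfl

theorem zmodTwo_cases (p : ZMod 2) : p = 0 ∨ p = 1 := by
  revert p; decide

theorem sgn_add (p q : ZMod 2) : sgn (p + q) = sgn p * sgn q := by
  revert p q; decide

theorem sgn_mul_self (p : ZMod 2) : sgn p * sgn p = 1 := by
  revert p; decide

section ExtBasics

variable (I : Type*)

/-- The grading automorphism `θᵢ ↦ -θᵢ`. -/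
abbrev inv : Ext I →ₐ[ℤ] Ext I := CliffordAlgebra.involute

theorem parityInv_extParity (x : Ext I) : parityInv (extParity I) x = inv I x := by
  classical
  rw [parityInv, LinearMap.sub_apply, GradedAlgebra.proj_apply, GradedAlgebra.proj_apply]
  conv_rhs => rw [← DirectSum.sum_support_decompose (extParity I) x, map_sum]
  have h : ∀ i : ZMod 2, inv I (DirectSum.decompose (extParity I) x i)
      = sgn i • (DirectSum.decompose (extParity I) x i : Ext I) := by
    intro i
    have hm := (DirectSum.decompose (extParity I) x i).2
    fin_cases i
    · exact (CliffordAlgebra.involute_eq_of_mem_even hm).trans (one_zsmul _).symm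
    · exact (CliffordAlgebra.involute_eq_of_mem_odd hm).trans (neg_one_zsmul _).symm
  rw [Finset.sum_congr rfl fun i _ => h i, Finset.sum_subset (Finset.subset_univ _)]
  · have : (Finset.univ : Finset (ZMod 2)) = {0, 1} := rfl
    rw [this, Finset.sum_pair (by decide), sgn_zero, sgn_one, one_zsmul, neg_one_zsmul,
      sub_eq_add_neg]
  · intro i _ hi
    rw [DFinsupp.notMem_support_iff.1 hi]
    simp

theorem koszul_zero (x : Ext I) : koszul (extParity I) 0 x = x := by
  simp [koszul]

theorem koszul_one (x : Ext I) : koszul (extParity I) 1 x = -inv I x := by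
  simp [koszul, parityInv_extParity]

theorem koszul_koszul (p q : ZMod 2) (x : Ext I) :
    koszul (extParity I) p (koszul (extParity I) q x) = koszul (extParity I) (p + q) x := by
  rcases zmodTwo_cases p with rfl | rfl <;> rcases zmodTwo_cases q with rfl | rfl <;>
    simp [koszul_zero, koszul_one, show (1 + 1 : ZMod 2) = 0 from rfl]

theorem koszul_comp (p q : ZMod 2) :
    (koszul (extParity I) p : Ext I → Ext I) ∘ koszul (extParity I) q
      = koszul (extParity I) (p + q) :=
  funext fun x => koszul_koszul I p q x

variable [DecidableEq I]

/-- The generators have even degree in A[1], so every Koszul sign disappears when cochains are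
evaluated on them. This is what makes the substitution of 𝐳 free of signs. -/
theorem koszul_θ (p : ZMod 2) (i : I) : koszul (extParity I) p (θ I i) = θ I i := by
  fin_cases p
  · exact koszul_zero I _
  · exact (koszul_one I _).trans (by simp [θ, ExteriorAlgebra.ι])

theorem inv_θ (i : I) : inv I (θ I i) = -θ I i := by
  simp [θ, ExteriorAlgebra.ι]

theorem θ_mul_θ (i j : I) : θ I i * θ I j = -(θ I j * θ I i) :=
  eq_neg_of_add_eq_zero_left (ExteriorAlgebra.ι_add_mul_swap _ _)

theorem θ_mul_self (i : I) : θ I i * θ I i = 0 := ExteriorAlgebra.ι_sq_zero _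

theorem θprod_nil : θprod I [] = 1 := by simp [θprod]

theorem θprod_cons (i : I) (l : List I) : θprod I (i :: l) = θ I i * θprod I l := by
  simp [θprod]

theorem θprod_append (l l' : List I) : θprod I (l ++ l') = θprod I l * θprod I l' := by
  simp [θprod]

variable [Fintype I]

theorem ι_eq_sum (v : I → ℤ) : ExteriorAlgebra.ι ℤ v = ∑ i, v i • θ I i := by
  conv_lhs => rw [← Finset.univ_sum_single v]
  rw [map_sum]
  refine Finset.sum_congr rfl fun i _ => ?_
  rw [θ, ← map_smul, ← Pi.single_smul, smul_eq_mul, mul_one]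

/-- The products of the `θᵢ` span the exterior algebra. -/
theorem span_θprod : Submodule.span ℤ (Set.range (θprod I)) = ⊤ := by
  rw [eq_top_iff]
  rintro x -
  induction x using CliffordAlgebra.left_induction with
  | algebraMap r =>
    rw [Algebra.algebraMap_eq_smul_one, ← θprod_nil]
    exact Submodule.smul_mem _ _ (Submodule.subset_span ⟨_, rfl⟩)
  | add x y hx hy => exact add_mem hx hy
  | ι_mul x v hx =>
    have hv : CliffordAlgebra.ι (0 : QuadraticForm ℤ (I → ℤ)) v = ∑ i, v i • θ I i := ι_eq_sum I v
    rw [hv, Finset.sum_mul]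
    refine sum_mem fun i _ => ?_
    rw [smul_mul_assoc]
    refine Submodule.smul_mem _ _ ?_
    induction hx using Submodule.span_induction with
    | mem x hx =>
      obtain ⟨l, rfl⟩ := hx
      rw [← θprod_cons]
      exact Submodule.subset_span ⟨_, rfl⟩
    | zero => simp
    | add x y _ _ hx hy => rw [mul_add]; exact add_mem hx hy
    | smul a x _ hx => rw [mul_smul_comm]; exact Submodule.smul_mem _ _ hx

theorem ext_linear {M : Type*} [AddCommGroup M] {f g : Ext I →ₗ[ℤ] M}
    (h : ∀ l, f (θprod I l) = g (θprod I l)) : f = g :=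
  LinearMap.ext_on_range (span_θprod I) h

/-- Each generator that θᵢ passes contributes one sign, and `inv` collects them. -/
theorem θ_mul (i : I) (x : Ext I) : θ I i * x = inv I x * θ I i := by
  have : LinearMap.mulLeft ℤ (θ I i) = (LinearMap.mulRight ℤ (θ I i)).comp (inv I).toLinearMap := by
    refine ext_linear I fun l => ?_
    induction l with
    | nil => simp [θprod_nil]
    | cons j l ih =>
      simp only [LinearMap.mulLeft_apply, LinearMap.comp_apply, AlgHom.toLinearMap_apply,
        LinearMap.mulRight_apply] at ih ⊢
      rw [θprod_cons, ← mul_assoc, θ_mul_θ, map_mul, inv_θ, neg_mul, neg_mul, neg_mul, mul_assoc,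
        mul_assoc, ih]
  exact LinearMap.congr_fun this x

/-! ### The grading -/

theorem extGr_zero_one : (1 : Ext I) ∈ extGr I 0 :=
  Submodule.subset_span ⟨[], by simp [θprod]⟩

theorem θprod_mem (l : List I) : θprod I l ∈ extGr I (l.map (θdeg I)).sum :=
  Submodule.subset_span ⟨l, rfl, rfl⟩

theorem θ_mem (i : I) : θ I i ∈ extGr I (θdeg I i) :=
  Submodule.subset_span ⟨[i], by simp [θprod]⟩

theorem extGr_mul {c d : GG I} {x y : Ext I} (hx : x ∈ extGr I c) (hy : y ∈ extGr I d) :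
    x * y ∈ extGr I (c + d) := by
  have h := Submodule.mul_mem_mul hx hy
  rw [extGr, extGr, Submodule.span_mul_span] at h
  refine Submodule.span_mono ?_ h
  rintro _ ⟨_, ⟨l, rfl, rfl⟩, _, ⟨l', rfl, rfl⟩, rfl⟩
  exact ⟨l ++ l', by simp, by simp [θprod]⟩

theorem parity_θdeg (i : I) : GG.parity I (θdeg I i) = 1 := by
  change ((-1 : ℤ) : ZMod 2) = 1
  decide

theorem parity_zdeg (i : I) : GG.parity I (zdeg I i) = 0 := by
  change ((2 : ℤ) : ZMod 2) = 0
  decide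

theorem parity_ofInt (k : ℤ) : GG.parity I (GG.ofInt I k) = k := rfl

theorem inv_of_mem {d : GG I} {x : Ext I} (hx : x ∈ extGr I d) :
    inv I x = sgn (GG.parity I d) • x := by
  induction hx using Submodule.span_induction with
  | mem x hx =>
    obtain ⟨l, rfl, rfl⟩ := hx
    induction l with
    | nil => simp [θprod, sgn_zero]
    | cons i l ih =>
      rw [θprod_cons, map_mul, ih, inv_θ, List.map_cons, List.sum_cons, map_add, parity_θdeg,
        sgn_add, sgn_one, mul_smul_comm, neg_mul, neg_mul, one_mul, smul_neg, neg_smul]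
  | zero => simp
  | add x y _ _ hx hy => rw [map_add, hx, hy, smul_add]
  | smul a x _ hx => rw [map_smul, hx, smul_comm]

theorem inv_mem {d : GG I} {x : Ext I} (hx : x ∈ extGr I d) : inv I x ∈ extGr I d := by
  rw [inv_of_mem I hx]
  exact Submodule.smul_of_tower_mem _ _ hx

theorem koszul_mem (p : ZMod 2) {d : GG I} {x : Ext I} (hx : x ∈ extGr I d) :
    koszul (extParity I) p x ∈ extGr I d := by
  fin_cases p
  · exact (koszul_zero I x).symm ▸ hx
  · exact (koszul_one I x).symm ▸ neg_mem (inv_mem I hx)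

theorem koszul_of_mem (p : ZMod 2) {d : GG I} {x : Ext I} (hx : x ∈ extGr I d) :
    koszul (extParity I) p x = sgn (p * (GG.parity I d - 1)) • x := by
  rcases zmodTwo_cases p with rfl | rfl
  · rw [koszul_zero, zero_mul, sgn_zero, one_smul]
  · rw [koszul_one, inv_of_mem I hx, ← neg_smul]
    congr 1
    generalize GG.parity I d = q
    revert q; decide

theorem extGr_le_extParity (d : GG I) : extGr I d ≤ extParity I (GG.parity I d) := by
  refine Submodule.span_le.2 ?_
  rintro _ ⟨l, rfl, rfl⟩
  induction l with
  | nil => exact SetLike.GradedOne.one_mem (A := extParity I)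
  | cons i l ih =>
    rw [θprod_cons, List.map_cons, List.sum_cons, map_add, parity_θdeg]
    exact SetLike.GradedMul.mul_mem (A := extParity I) (CliffordAlgebra.ι_mem_evenOdd_one _ _) ih

/-- Graded commutativity. -/
theorem extGr_mul_comm {c d : GG I} {x y : Ext I} (hx : x ∈ extGr I c) (hy : y ∈ extGr I d) :
    x * y = sgn (GG.parity I c * GG.parity I d) • (y * x) := by
  induction hx using Submodule.span_induction with
  | mem x hx =>
    obtain ⟨l, rfl, rfl⟩ := hx
    induction l with
    | nil => simp [θprod, sgn_zero]
    | cons i l ih =>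
      rw [θprod_cons, mul_assoc, ih, mul_smul_comm, ← mul_assoc, θ_mul, inv_of_mem I hy,
        List.map_cons, List.sum_cons, map_add, parity_θdeg, add_mul, one_mul, sgn_add, smul_mul_assoc,
        smul_mul_assoc, smul_smul, mul_assoc, mul_comm (sgn _)]
  | zero => simp
  | add x y _ _ hx hy => rw [add_mul, hx, hy, mul_add, smul_add]
  | smul a x _ hx => rw [smul_mul_assoc, hx, mul_smul_comm, smul_comm]

/-! ### Finitely many degrees, and the homogeneous projections. -/

open Classical in
/-- The degrees in which the exterior algebra does not vanish. -/
def extDegrees : Finset (GG I) :=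
  Finset.univ.powerset.image fun J : Finset I => ∑ i ∈ J, θdeg I i

theorem θprod_eq_zero_of_not_nodup {l : List I} (h : ¬ l.Nodup) : θprod I l = 0 := by
  induction l with
  | nil => simp at h
  | cons i l ih =>
    rw [θprod_cons]
    by_cases hl : l.Nodup
    · have hi : i ∈ l := by
        by_contra hi
        exact h (List.nodup_cons.2 ⟨hi, hl⟩)
      obtain ⟨s, t, rfl⟩ := List.append_of_mem hi
      rw [θprod_append, θprod_cons, ← mul_assoc, θ_mul, mul_assoc, ← mul_assoc (θ I i), θ_mul_self]
      simp
    · rw [ih hl, mul_zero]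

/-- A product with a repeated generator is zero, so only the degrees of sets of generators survive.
The resulting finiteness is used both to decompose arguments and to bound the lengths that
contribute to Ξ. -/
theorem mem_extDegrees {d : GG I} {x : Ext I} (hx : x ∈ extGr I d) (h0 : x ≠ 0) :
    d ∈ extDegrees I := by
  classical
  by_contra hd
  refine h0 ?_
  suffices h : extGr I d ≤ ⊥ from (Submodule.mem_bot _).1 (h hx)
  refine Submodule.span_le.2 ?_
  rintro _ ⟨l, rfl, rfl⟩
  refine θprod_eq_zero_of_not_nodup I fun hl => hd ?_
  refine Finset.mem_image.2 ⟨l.toFinset, by simp, ?_⟩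
  rw [List.sum_toFinset _ hl]

/-- The coaction `θᵢ ↦ [deg θᵢ] θᵢ` of the grading group. -/
def extCoaction : Ext I →ₐ[ℤ] AddMonoidAlgebra (Ext I) (GG I) :=
  ExteriorAlgebra.lift ℤ ⟨∑ i, (LinearMap.proj i : (I → ℤ) →ₗ[ℤ] ℤ).smulRight
      (AddMonoidAlgebra.single (θdeg I i) (θ I i)), by
    intro v
    have h : ∀ i j : I, (AddMonoidAlgebra.single (θdeg I i) (θ I i)
        * AddMonoidAlgebra.single (θdeg I j) (θ I j) : AddMonoidAlgebra (Ext I) (GG I))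
        = AddMonoidAlgebra.single (θdeg I i + θdeg I j) (θ I i * θ I j) := fun i j => by
      rw [AddMonoidAlgebra.single_mul_single]
    simp only [LinearMap.sum_apply, LinearMap.smulRight_apply, LinearMap.proj_apply,
      Finset.sum_mul_sum, smul_mul_smul_comm, h]
    rw [← Finset.sum_product']
    -- The terms (i, j) and (j, i) cancel: the θ's anticommute, and their degrees add commutatively.
    refine Finset.sum_involution (fun p _ => (p.2, p.1)) ?_ ?_ (by simp) (by simp)
    · rintro ⟨i, j⟩ -
      rw [θ_mul_θ, add_comm (θdeg I i), mul_comm (v i)]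
      simp
    · rintro ⟨i, j⟩ - hne heq
      obtain rfl : j = i := congrArg Prod.fst heq
      exact hne (by simp [θ_mul_self])⟩

theorem extCoaction_θ (i : I) :
    extCoaction I (θ I i) = AddMonoidAlgebra.single (θdeg I i) (θ I i) := by
  rw [extCoaction, θ, ExteriorAlgebra.lift_ι_apply, LinearMap.sum_apply, Finset.sum_eq_single i]
  · simp [θ]
  · intro j _ hj
    simp [hj]
  · simp

theorem extCoaction_of_mem {d : GG I} {x : Ext I} (hx : x ∈ extGr I d) :
    extCoaction I x = AddMonoidAlgebra.single d x := by
  induction hx using Submodule.span_induction with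
  | mem x hx =>
    obtain ⟨l, rfl, rfl⟩ := hx
    induction l with
    | nil => simp [θprod, AddMonoidAlgebra.one_def]
    | cons i l ih =>
      rw [θprod_cons, map_mul, ih, extCoaction_θ, AddMonoidAlgebra.single_mul_single, List.map_cons,
        List.sum_cons]
  | zero => simp
  | add x y _ _ hx hy => rw [map_add, hx, hy, AddMonoidAlgebra.single_add]
  | smul a x _ hx => rw [map_smul, hx, AddMonoidAlgebra.smul_single]

/-- The projection to the part of degree `d`. -/
def extProj (d : GG I) : Ext I →ₗ[ℤ] Ext I :=
  (Finsupp.lapply d).comp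
    ((AddMonoidAlgebra.coeffLinearEquiv ℤ).toLinearMap.comp (extCoaction I).toLinearMap)

open Classical in
theorem extProj_of_mem {d e : GG I} {x : Ext I} (hx : x ∈ extGr I d) :
    extProj I e x = if d = e then x else 0 := by
  have : extProj I e x = (extCoaction I x).coeff e := rfl
  rw [this, extCoaction_of_mem I hx, AddMonoidAlgebra.coeff_single, Finsupp.single_apply]

theorem extProj_mem (d : GG I) (x : Ext I) : extProj I d x ∈ extGr I d := by
  classical
  have hx : x ∈ Submodule.span ℤ (Set.range (θprod I)) := by rw [span_θprod]; trivial
  induction hx using Submodule.span_induction with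
  | mem x hx =>
    obtain ⟨l, rfl⟩ := hx
    rw [extProj_of_mem I (θprod_mem I l)]
    split_ifs with h
    · exact h ▸ θprod_mem I l
    · exact zero_mem _
  | zero => simp
  | add x y _ _ hx hy => rw [map_add]; exact add_mem hx hy
  | smul a x _ hx => rw [map_smul]; exact Submodule.smul_mem _ _ hx

theorem sum_extProj (x : Ext I) : ∑ d ∈ extDegrees I, extProj I d x = x := by
  classical
  have hx : x ∈ Submodule.span ℤ (Set.range (θprod I)) := by rw [span_θprod]; trivial
  induction hx using Submodule.span_induction with
  | mem x hx =>
    obtain ⟨l, rfl⟩ := hx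
    by_cases h0 : θprod I l = 0
    · simp [h0]
    · simp only [extProj_of_mem I (θprod_mem I l), Finset.sum_ite_eq,
        mem_extDegrees I (θprod_mem I l) h0, if_true]
  | zero => simp
  | add x y _ _ hx hy => simp only [map_add, Finset.sum_add_distrib, hx, hy]
  | smul a x _ hx => simp only [map_smul, ← Finset.smul_sum, hx]

/-! ### Contractions -/

/-- The left derivative `∂/∂θᵢ`. -/
def dleft (i : I) : Ext I →ₗ[ℤ] Ext I := CliffordAlgebra.contractLeft (LinearMap.proj i)

/-- The right derivative `∂/∂θᵢ`. -/
def dright (i : I) : Ext I →ₗ[ℤ] Ext I :=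
  (CliffordAlgebra.contractRight (Q := (0 : QuadraticForm ℤ (I → ℤ)))).flip (LinearMap.proj i)

theorem dleft_one (i : I) : dleft I i 1 = 0 := CliffordAlgebra.contractLeft_one _ _

theorem dleft_θ_mul (i j : I) (x : Ext I) :
    dleft I i (θ I j * x) = (if i = j then x else 0) - θ I j * dleft I i x := by
  refine (CliffordAlgebra.contractLeft_ι_mul _ _ _).trans ?_
  simp [Pi.single_apply, dleft, θ, ExteriorAlgebra.ι]

theorem dright_mul_θ (i j : I) (x : Ext I) :
    dright I i (x * θ I j) = (if i = j then x else 0) - dright I i x * θ I j := by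
  refine (CliffordAlgebra.contractRight_mul_ι _ _ _).trans ?_
  simp [Pi.single_apply, dright, θ, ExteriorAlgebra.ι]

theorem dleft_θ (i j : I) : dleft I i (θ I j) = if i = j then 1 else 0 := by
  simpa [dleft_one] using dleft_θ_mul I i j 1

/-- The left derivative is a graded derivation. -/
theorem dleft_mul (i : I) (x y : Ext I) :
    dleft I i (x * y) = dleft I i x * y + inv I x * dleft I i y := by
  have : (dleft I i).comp (LinearMap.mulRight ℤ y) = (LinearMap.mulRight ℤ y).comp (dleft I i)
      + (LinearMap.mulRight ℤ (dleft I i y)).comp (inv I).toLinearMap := by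
    refine ext_linear I fun l => ?_
    induction l with
    | nil => simp [θprod_nil, dleft_one]
    | cons j l ih =>
      simp only [LinearMap.comp_apply, LinearMap.mulRight_apply, LinearMap.add_apply,
        AlgHom.toLinearMap_apply] at ih ⊢
      rw [θprod_cons, mul_assoc, dleft_θ_mul, ih, dleft_θ_mul, map_mul, inv_θ]
      split_ifs <;> noncomm_ring
  exact LinearMap.congr_fun this x

theorem dleft_mem (i : I) {d : GG I} {x : Ext I} (hx : x ∈ extGr I d) :
    dleft I i x ∈ extGr I (d - θdeg I i) := by
  induction hx using Submodule.span_induction with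
  | mem x hx =>
    obtain ⟨l, rfl, rfl⟩ := hx
    induction l with
    | nil => simp [θprod_nil, dleft_one]
    | cons j l ih =>
      rw [θprod_cons, dleft_θ_mul, List.map_cons, List.sum_cons]
      refine sub_mem ?_ ?_
      · split_ifs with h
        · subst h
          rw [add_sub_cancel_left]
          exact θprod_mem I l
        · exact zero_mem _
      · rw [add_sub_assoc]
        exact extGr_mul I (θ_mem I j) ih
  | zero => simp
  | add x y _ _ hx hy => rw [map_add]; exact add_mem hx hy
  | smul a x _ hx => rw [map_smul]; exact Submodule.smul_mem _ _ hx

/-- Extracting θᵢ on the right instead of the left moves it past the remaining |x| - 1 odd factors.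
-/
theorem dright_of_mem (i : I) {d : GG I} {x : Ext I} (hx : x ∈ extGr I d) :
    dright I i x = sgn (GG.parity I d - 1) • dleft I i x := by
  induction hx using Submodule.span_induction with
  | mem x hx =>
    obtain ⟨l, rfl, rfl⟩ := hx
    induction l with
    | nil =>
      rw [θprod_nil, dleft_one, smul_zero]
      exact CliffordAlgebra.contractRight_one _ _
    | cons j l ih =>
      have hd := θprod_mem I l
      rw [θprod_cons, dleft_θ_mul, θ_mul, dright_mul_θ, inv_of_mem I hd, map_smul, ih,
        List.map_cons, List.sum_cons, map_add, parity_θdeg, add_sub_cancel_left, θ_mul,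
        inv_of_mem I (dleft_mem I i hd), map_sub, parity_θdeg]
      generalize GG.parity I _ = p
      have : sgn p * sgn (p - 1) = -1 := by revert p; decide
      split_ifs <;> simp only [smul_sub, smul_smul, smul_mul_assoc, this, smul_zero]
  | zero => simp
  | add x y _ _ hx hy => rw [map_add, hx, hy, map_add, smul_add]
  | smul a x _ hx => rw [map_smul, hx, map_smul, smul_comm]

end ExtBasics

/-! ### Multilinear functions of lists -/

section MultiLin

variable {A M N : Type*} [AddCommGroup A] [AddCommGroup M] [AddCommGroup N]

/-- A function of finite lists that is additive in every entry. -/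
def MultiLin (F : List A → M) : Prop :=
  ∀ l r : List A, ∃ f : A →+ M, ∀ a, F (l ++ a :: r) = f a

theorem MultiLin.of_add {F : List A → M}
    (h : ∀ l r a b, F (l ++ (a + b) :: r) = F (l ++ a :: r) + F (l ++ b :: r)) : MultiLin F :=
  fun l r => ⟨AddMonoidHom.mk' (fun a => F (l ++ a :: r)) (h l r), fun _ => rfl⟩

theorem MultiLin.map_add {F : List A → M} (hF : MultiLin F) (l r : List A) (a b : A) :
    F (l ++ (a + b) :: r) = F (l ++ a :: r) + F (l ++ b :: r) := by
  obtain ⟨f, hf⟩ := hF l r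
  simp only [hf, _root_.map_add]

theorem MultiLin.map_zsmul {F : List A → M} (hF : MultiLin F) (l r : List A) (n : ℤ) (a : A) :
    F (l ++ (n • a) :: r) = n • F (l ++ a :: r) := by
  obtain ⟨f, hf⟩ := hF l r
  simp only [hf, _root_.map_zsmul]

theorem MultiLin.map_zero {F : List A → M} (hF : MultiLin F) (l r : List A) :
    F (l ++ 0 :: r) = 0 := by
  obtain ⟨f, hf⟩ := hF l r
  simp only [hf, _root_.map_zero]

theorem MultiLin.map_neg {F : List A → M} (hF : MultiLin F) (l r : List A) (a : A) :
    F (l ++ (-a) :: r) = -F (l ++ a :: r) := by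
  obtain ⟨f, hf⟩ := hF l r
  simp only [hf, _root_.map_neg]

theorem MultiLin.add {F G : List A → M} (hF : MultiLin F) (hG : MultiLin G) : MultiLin (F + G) :=
  .of_add fun l r a b => by simp only [Pi.add_apply, hF.map_add, hG.map_add]; abel

theorem MultiLin.neg {F : List A → M} (hF : MultiLin F) : MultiLin (-F) :=
  .of_add fun l r a b => by simp only [Pi.neg_apply, hF.map_add]; abel

theorem MultiLin.sub {F G : List A → M} (hF : MultiLin F) (hG : MultiLin G) : MultiLin (F - G) :=
  sub_eq_add_neg F G ▸ hF.add hG.neg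

theorem MultiLin.comp {F : List A → M} (hF : MultiLin F) (g : M →+ N) :
    MultiLin (fun l => g (F l)) :=
  .of_add fun l r a b => by simp only [hF.map_add, _root_.map_add]

theorem MultiLin.map {F : List A → M} (hF : MultiLin F) (g : A →+ A) :
    MultiLin (fun l => F (l.map g)) :=
  .of_add fun l r a b => by
    simp only [List.map_append, List.map_cons, _root_.map_add, hF.map_add]

theorem MultiLin.cons {F : List A → M} (hF : MultiLin F) (a : A) : MultiLin (fun l => F (a :: l)) :=
  fun l r => hF (a :: l) r

/-- The entries are replaced one at a time, keeping a prefix of entries that are already in S. -/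
theorem MultiLin.eqOn {F G : List A → M} (hF : MultiLin F) (hG : MultiLin G) (S : Set A)
    (hS : AddSubgroup.closure S = ⊤) (h : ∀ l : List A, (∀ a ∈ l, a ∈ S) → F l = G l)
    (l : List A) : F l = G l := by
  suffices h' : ∀ l u : List A, (∀ a ∈ u, a ∈ S) → F (u ++ l) = G (u ++ l) from h' l [] (by simp)
  intro l
  induction l with
  | nil => intro u hu; simpa using h u hu
  | cons a l ih =>
    intro u hu
    have ha : a ∈ AddSubgroup.closure S := hS ▸ AddSubgroup.mem_top a
    induction ha using AddSubgroup.closure_induction with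
    | mem a ha =>
      have := ih (u ++ [a]) (by
        intro b hb
        rcases List.mem_append.1 hb with hb | hb
        · exact hu b hb
        · rw [List.mem_singleton.1 hb]; exact ha)
      simpa using this
    | zero => rw [hF.map_zero, hG.map_zero]
    | add a b _ _ iha ihb => rw [hF.map_add, hG.map_add, iha, ihb]
    | neg a _ iha => rw [hF.map_neg, hG.map_neg, iha]

end MultiLin

/-! ### Hochschild cochains as functions of lists -/

section CochainLists

variable {R A : Type*} [CommRing R] [Ring A] [Algebra R A]

theorem cochain_ext {α β : Cochain R A} (h : ∀ l, ev α l = ev β l) : α = β := by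
  funext s
  ext v
  rw [apply_eq_ev, apply_eq_ev, h]

theorem multiLin_ev (α : Cochain R A) : MultiLin (ev α) :=
  .of_add fun l r a b => (ev_listMultilinear α l r).map_add a b

theorem ev_zero (l : List A) : ev (0 : Cochain R A) l = 0 := rfl

theorem ev_sub (α β : Cochain R A) (l : List A) : ev (α - β) l = ev α l - ev β l := rfl

theorem ev_zsmul (n : ℤ) (α : Cochain R A) (l : List A) : ev (n • α) l = n • ev α l := rfl

variable (𝒜 : ZMod 2 → Submodule R A) [GradedAlgebra 𝒜]

theorem ev_braceHom (p : ZMod 2) (α β : Cochain R A) (l : List A) :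
    ev (braceHom 𝒜 p α β) l = brace (koszul 𝒜 (p - 1)) (ev α) (ev β) l := by
  rw [braceHom, ev_ofList, brace, splitSum_eq_sum_range]
  refine Finset.sum_congr rfl fun i _ => ?_
  rw [splitSum_eq_sum_range, List.length_drop]
  exact Finset.sum_congr rfl fun n _ => by rw [insTerm, List.drop_drop]

theorem ev_cupHom (p : ZMod 2) (α β : Cochain R A) :
    ev (cupHom 𝒜 p α β) = cupL (koszul 𝒜 p) (ev α) (ev β) := by
  funext l
  rw [cupHom, ev_ofList, cupL, splitSum_eq_sum_range]
  rfl

theorem cupHom_add_left (p : ZMod 2) (α α' β : Cochain R A) :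
    cupHom 𝒜 p (α + α') β = cupHom 𝒜 p α β + cupHom 𝒜 p α' β :=
  cochain_ext fun l => by
    simp only [ev_cupHom, ev_add, cupL, add_mul, splitSum_add]

theorem cupHom_add_right (p : ZMod 2) (α β β' : Cochain R A) :
    cupHom 𝒜 p α (β + β') = cupHom 𝒜 p α β + cupHom 𝒜 p α β' :=
  cochain_ext fun l => by
    simp only [ev_cupHom, ev_add, cupL, mul_add, splitSum_add]

theorem cup_add_left (α α' β : Cochain R A) : cup 𝒜 (α + α') β = cup 𝒜 α β + cup 𝒜 α' β := by
  simp only [cup, cupHom_add_left, Finset.sum_add_distrib]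

theorem cup_add_right (α β β' : Cochain R A) : cup 𝒜 α (β + β') = cup 𝒜 α β + cup 𝒜 α β' := by
  simp only [cup, parityPart_add, cupHom_add_right, Finset.sum_add_distrib]

theorem bracket_add_left (α α' β : Cochain R A) : gerstenhaberBracket 𝒜 (α + α') β
    = gerstenhaberBracket 𝒜 α β + gerstenhaberBracket 𝒜 α' β := by
  simp only [gerstenhaberBracket, parityPart_add, braceHom_add_left,
    braceHom_add_right, ← Finset.sum_add_distrib]
  refine Finset.sum_congr rfl fun p _ => Finset.sum_congr rfl fun q _ => ?_
  rw [smul_add]; abel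

theorem bracket_add_right (α β β' : Cochain R A) : gerstenhaberBracket 𝒜 α (β + β')
    = gerstenhaberBracket 𝒜 α β + gerstenhaberBracket 𝒜 α β' := by
  simp only [gerstenhaberBracket, parityPart_add, braceHom_add_left,
    braceHom_add_right, ← Finset.sum_add_distrib]
  refine Finset.sum_congr rfl fun p _ => Finset.sum_congr rfl fun q _ => ?_
  rw [smul_add]; abel

end CochainLists

/-! ### Degrees of cochains -/

section Degrees

variable (I : Type*) [Fintype I] [DecidableEq I]

theorem ev_map {ι : Type*} (α : Cochain ℤ (Ext I)) (L : List ι) (f : ι → Ext I) :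
    ev α (L.map f) = α L.length (fun i => f (L.get i)) := by
  rw [apply_eq_ev]
  congr 1
  apply List.ext_getElem <;> simp

/-- A list of elements with degrees. -/
def Homog (L : List (GG I × Ext I)) : Prop := ∀ x ∈ L, x.2 ∈ extGr I x.1

/-- The sum of the degrees in `A[1]` of the entries of a list. -/
def shiftDeg (L : List (GG I × Ext I)) : GG I := (L.map fun x => x.1 - GG.ofInt I 1).sum

theorem ofInt_add (a b : ℤ) : GG.ofInt I (a + b) = GG.ofInt I a + GG.ofInt I b := by
  have h : ((a + b, 0) : ℤ × (I → ℤ)) = (a, 0) + (b, 0) := by simp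
  exact congrArg QuotientAddGroup.mk h

/-- The homomorphism `k ↦ (k, 0)`. -/
def ofIntHom : ℤ →+ GG I := AddMonoidHom.mk' (GG.ofInt I) (ofInt_add I)

theorem ofInt_natCast (n : ℕ) : GG.ofInt I n = n • GG.ofInt I 1 := by
  have := map_nsmul (ofIntHom I) n 1
  rw [nsmul_eq_mul, mul_one] at this
  exact this

theorem shiftDeg_nil : shiftDeg I [] = 0 := rfl

theorem shiftDeg_cons (x : GG I × Ext I) (L : List (GG I × Ext I)) :
    shiftDeg I (x :: L) = x.1 - GG.ofInt I 1 + shiftDeg I L := rfl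

theorem shiftDeg_append (L L' : List (GG I × Ext I)) :
    shiftDeg I (L ++ L') = shiftDeg I L + shiftDeg I L' := by
  simp [shiftDeg]

theorem shiftDeg_eq (L : List (GG I × Ext I)) :
    shiftDeg I L = ∑ i, (L.get i).1 - GG.ofInt I L.length := by
  have h : ∑ i, (L.get i).1 = (L.map Prod.fst).sum := by
    rw [← List.sum_ofFn]
    congr 1
    apply List.ext_getElem <;> simp
  rw [h, ofInt_natCast]
  induction L with
  | nil => simp [shiftDeg]
  | cons x L ih =>
    have ih' := ih (by
      rw [← List.sum_ofFn]
      congr 1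
      apply List.ext_getElem <;> simp)
    rw [shiftDeg_cons, ih', List.map_cons, List.sum_cons, List.length_cons, succ_nsmul]
    abel

/-- Measuring arguments in A[1] absorbs the length-dependent shift y - s, so one condition covers
all lengths at once and composes well under insertion. -/
theorem mem_CCdeg_iff {y : GG I} {α : Cochain ℤ (Ext I)} :
    α ∈ CCdeg I y ↔ ∀ L, Homog I L → ev α (L.map Prod.snd) ∈ extGr I (shiftDeg I L + y) := by
  have h0 : α ∈ CCdeg I y ↔ ∀ s, α s ∈ homGr I s (y - GG.ofInt I s) := by
    simp [CCdeg, Submodule.mem_pi]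
  rw [h0]
  constructor
  · intro h L hL
    have := h L.length (fun i => (L.get i).1) (fun i => (L.get i).2)
      (fun i => hL _ (L.get_mem i))
    rw [ev_map, shiftDeg_eq, sub_add_eq_add_sub, add_sub_assoc]
    exact this
  · intro h s d a ha
    have := h (List.ofFn fun i => (d i, a i)) (by
      intro x hx
      obtain ⟨i, rfl⟩ := (List.mem_ofFn' _ _).1 hx
      exact ha i)
    have hs : shiftDeg I (List.ofFn fun i => (d i, a i)) = ∑ i, d i - GG.ofInt I s := by
      rw [shiftDeg, List.map_ofFn, List.sum_ofFn, ofInt_natCast]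
      simp [Finset.sum_sub_distrib]
    rw [hs, List.map_ofFn, sub_add_eq_add_sub, add_sub_assoc] at this
    rw [apply_eq_ev]
    exact this

theorem closure_homogeneous :
    AddSubgroup.closure {x : Ext I | ∃ d, x ∈ extGr I d} = ⊤ := by
  rw [eq_top_iff]
  rintro x -
  rw [← sum_extProj I x]
  exact sum_mem fun d _ => AddSubgroup.subset_closure ⟨d, extProj_mem I d x⟩

theorem exists_homog (l : List (Ext I)) (hl : ∀ a ∈ l, a ∈ {x : Ext I | ∃ d, x ∈ extGr I d}) :
    ∃ L, Homog I L ∧ L.map Prod.snd = l := by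
  induction l with
  | nil => exact ⟨[], by simp [Homog], rfl⟩
  | cons a l ih =>
    obtain ⟨L, hL, rfl⟩ := ih fun b hb => hl b (List.mem_cons_of_mem _ hb)
    obtain ⟨d, hd⟩ := hl a List.mem_cons_self
    refine ⟨(d, a) :: L, fun x hx => ?_, rfl⟩
    rcases List.mem_cons.1 hx with rfl | hx
    exacts [hd, hL x hx]

/-- Homogeneous elements generate the exterior algebra additively; this is how sign rules for
homogeneous arguments are extended to all arguments. -/
theorem multiLin_ext {M : Type*} [AddCommGroup M] {F G : List (Ext I) → M} (hF : MultiLin F)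
    (hG : MultiLin G) (h : ∀ L, Homog I L → F (L.map Prod.snd) = G (L.map Prod.snd))
    (l : List (Ext I)) : F l = G l := by
  refine hF.eqOn hG _ (closure_homogeneous I) (fun l hl => ?_) l
  obtain ⟨L, hL, rfl⟩ := exists_homog I l hl
  exact h L hL

/-- The list with `g` applied to all elements, in the same degrees. -/
theorem Homog.map_koszul {L : List (GG I × Ext I)} (hL : Homog I L) (p : ZMod 2) :
    Homog I (L.map (Prod.map id (koszul (extParity I) p))) := by
  intro x hx
  obtain ⟨z, hz, rfl⟩ := List.mem_map.1 hx
  exact koszul_mem I p (hL z hz)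

theorem shiftDeg_map_koszul (L : List (GG I × Ext I)) (p : ZMod 2) :
    shiftDeg I (L.map (Prod.map id (koszul (extParity I) p))) = shiftDeg I L := by
  simp [shiftDeg, Function.comp_def]

theorem map_snd_map_koszul (L : List (GG I × Ext I)) (p : ZMod 2) :
    (L.map (Prod.map id (koszul (extParity I) p))).map Prod.snd
      = (L.map Prod.snd).map (koszul (extParity I) p) := by
  simp

theorem braceHom_mem {y y' : GG I} {α β : Cochain ℤ (Ext I)} (hα : α ∈ CCdeg I y)
    (hβ : β ∈ CCdeg I y') (p : ZMod 2) :
    braceHom (extParity I) p α β ∈ CCdeg I (y + y' - GG.ofInt I 1) := by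
  rw [mem_CCdeg_iff] at hα hβ ⊢
  intro L hL
  rw [ev_braceHom, brace]
  simp only [splitSum_map]
  refine splitSum_mem _ fun u w huw => splitSum_mem _ fun v r hvr => ?_
  subst hvr huw
  have hv : Homog I v := fun x hx => hL x (by simp [hx])
  have hL' : Homog I (u.map (Prod.map id (koszul (extParity I) (p - 1)))
      ++ (shiftDeg I v + y', ev β (v.map Prod.snd)) :: r) := by
    intro x hx
    rcases List.mem_append.1 hx with hx | hx
    · exact Homog.map_koszul I (L := u) (fun x hx => hL x (by simp [hx])) _ x hx
    · rcases List.mem_cons.1 hx with rfl | hx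
      · exact hβ v hv
      · exact hL x (by simp [hx])
  have := hα _ hL'
  rw [List.map_append, map_snd_map_koszul, List.map_cons, shiftDeg_append, shiftDeg_map_koszul,
    shiftDeg_cons] at this
  dsimp only at this
  convert this using 2
  rw [shiftDeg_append, shiftDeg_append]
  abel

theorem cupHom_mem {y y' : GG I} {α β : Cochain ℤ (Ext I)} (hα : α ∈ CCdeg I y)
    (hβ : β ∈ CCdeg I y') (p : ZMod 2) :
    cupHom (extParity I) p α β ∈ CCdeg I (y + y') := by
  rw [mem_CCdeg_iff] at hα hβ ⊢
  intro L hL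
  rw [ev_cupHom, cupL, splitSum_map]
  refine splitSum_mem _ fun u v huv => ?_
  subst huv
  have hu := hα _ (Homog.map_koszul I (L := u) (fun x hx => hL x (by simp [hx])) p)
  have hv := hβ v fun x hx => hL x (by simp [hx])
  rw [map_snd_map_koszul, shiftDeg_map_koszul] at hu
  convert extGr_mul I hu hv using 2
  rw [shiftDeg_append]
  abel

/-- The values of `μ²`. -/
def mulL : List (Ext I) → Ext I
  | [a, b] => inv I a * b
  | _ => 0

theorem ev_mulCochain : ev (mulCochain (extParity I)) = mulL I := by
  funext l
  match l with
  | [] => rfl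
  | [a] => rfl
  | [a, b] =>
    simp only [ev, mulCochain, mulL]
    exact congrArg (· * b) (parityInv_extParity I a)
  | a :: b :: c :: l =>
    have : (mulCochain (extParity I) : Cochain ℤ (Ext I)) (a :: b :: c :: l).length = 0 :=
      Pi.single_eq_of_ne (by simp) _
    rw [ev, this]
    rfl

theorem mulCochain_mem : mulCochain (extParity I) ∈ CCdeg I (GG.ofInt I 2) := by
  rw [mem_CCdeg_iff]
  intro L hL
  rw [ev_mulCochain]
  match L with
  | [] => exact zero_mem _
  | [a] => exact zero_mem _
  | [a, b] =>
    have h1 := hL a (by simp)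
    have h2 := hL b (by simp)
    have e : shiftDeg I [a, b] + GG.ofInt I 2 = a.1 + b.1 := by
      rw [shiftDeg_cons, shiftDeg_cons, shiftDeg_nil, show GG.ofInt I 2 = _ from ofInt_add I 1 1]
      abel
    rw [e]
    exact extGr_mul I (inv_mem I h1) h2
  | a :: b :: c :: l => exact zero_mem _

/-- The sign rule for a homogeneous cochain. -/
theorem koszul_ev {y : GG I} {α : Cochain ℤ (Ext I)} (hα : α ∈ CCdeg I y) (r : ZMod 2)
    (l : List (Ext I)) : koszul (extParity I) r (ev α l)
      = sgn (r * (GG.parity I y - 1)) • ev α (l.map (koszul (extParity I) r)) := by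
  rw [mem_CCdeg_iff] at hα
  refine multiLin_ext I ((multiLin_ev α).comp (koszul (extParity I) r).toAddMonoidHom)
    (((multiLin_ev α).map (koszul (extParity I) r).toAddMonoidHom).comp
      (zsmulAddGroupHom (sgn (r * (GG.parity I y - 1))))) (fun L hL => ?_) l
  -- The arguments are treated one by one, so a prefix u of entries already dealt with is carried
  -- along.
  have hmap : ∀ L : List (GG I × Ext I), Homog I L → ∀ u : List (Ext I),
      ev α (u ++ (L.map Prod.snd).map (koszul (extParity I) r))
        = sgn (r * GG.parity I (shiftDeg I L)) • ev α (u ++ L.map Prod.snd) := by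
    intro L hL
    induction L with
    | nil => intro u; simp [shiftDeg_nil, sgn_zero]
    | cons x L ih =>
      intro u
      have ih' := ih (fun z hz => hL z (List.mem_cons_of_mem _ hz))
        (u ++ [koszul (extParity I) r x.2])
      simp only [List.map_cons]
      rw [← List.singleton_append, ← List.append_assoc, ih', List.append_assoc,
        List.singleton_append, koszul_of_mem I r (hL x List.mem_cons_self),
        (multiLin_ev α).map_zsmul, smul_smul, shiftDeg_cons, map_add, map_sub, parity_ofInt,
        mul_add, sgn_add, mul_comm (sgn _)]
      simp
  refine (koszul_of_mem I r (hα L hL)).trans ?_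
  have := hmap L hL []
  simp only [List.nil_append] at this
  change _ = sgn (r * (GG.parity I y - 1)) • ev α ((L.map Prod.snd).map (koszul (extParity I) r))
  rw [this, smul_smul, ← sgn_add]
  congr 2
  rw [map_add]
  ring

/-- On homogeneous arguments a single choice of parities survives in the defining sum. Hence the
sums over parities in `cup` and `gerstenhaberBracket` collapse to one term for homogeneous cochains.
-/
theorem parityPart_of_mem {y : GG I} {α : Cochain ℤ (Ext I)} (hα : α ∈ CCdeg I y) (p : ZMod 2) :
    parityPart (extParity I) p α = if GG.parity I y = p then α else 0 := by
  refine cochain_ext fun l => ?_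
  rw [mem_CCdeg_iff] at hα
  refine multiLin_ext I (multiLin_ev _) (multiLin_ev _) (fun L hL => ?_) l
  have hp : ∀ (q : ZMod 2) (d : GG I) (x : Ext I), x ∈ extGr I d →
      GradedAlgebra.proj (extParity I) q x = if GG.parity I d = q then x else 0 := by
    intro q d x hx
    rw [GradedAlgebra.proj_apply, DirectSum.decompose_of_mem (extParity I)
      (extGr_le_extParity I d hx)]
    rw [DirectSum.coe_of_apply]
    split_ifs <;> rfl
  rw [ev_map, parityPart, sum_apply]
  simp only [LinearMap.compMultilinearMap_apply, MultilinearMap.compLinearMap_apply]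
  have hz : ∀ i, (L.get i).2 ∈ extGr I (L.get i).1 := fun i => hL _ (L.get_mem i)
  rw [Finset.sum_eq_single fun i => GG.parity I (L.get i).1]
  · simp only [hp _ _ _ (hz _), if_true]
    have hm := hα L hL
    rw [ev_map] at hm
    rw [hp _ _ _ hm]
    have e : GG.parity I (shiftDeg I L + y) = p - L.length + ∑ i, GG.parity I (L.get i).1
        ↔ GG.parity I y = p := by
      rw [shiftDeg_eq, map_add, map_sub, map_sum, parity_ofInt]
      push_cast
      constructor
      · intro h; linear_combination h
      · intro h; rw [h]; ring
    simp only [e]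
    split_ifs
    · rw [ev_map]
    · rfl
  · intro f _ hf
    obtain ⟨i, hi⟩ := Function.ne_iff.1 hf
    rw [(α L.length).map_coord_zero i, map_zero]
    rw [hp _ _ _ (hz i), if_neg (Ne.symm hi)]
  · intro h; exact absurd (Finset.mem_univ _) h

theorem cup_of_mem (α : Cochain ℤ (Ext I)) {y : GG I} {β : Cochain ℤ (Ext I)}
    (hβ : β ∈ CCdeg I y) : cup (extParity I) α β = cupHom (extParity I) (GG.parity I y) α β := by
  have h0 : ∀ p, cupHom (extParity I) p α 0 = 0 := fun p =>
    cochain_ext fun l => by simp [ev_cupHom, cupL, ev_zero, splitSum_zero]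
  rw [cup, Finset.sum_eq_single (GG.parity I y)]
  · rw [parityPart_of_mem I hβ, if_pos rfl]
  · intro p _ hp
    rw [parityPart_of_mem I hβ, if_neg hp.symm, h0]
  · simp

theorem bracket_of_mem {y y' : GG I} {α β : Cochain ℤ (Ext I)} (hα : α ∈ CCdeg I y)
    (hβ : β ∈ CCdeg I y') : gerstenhaberBracket (extParity I) α β
      = braceHom (extParity I) (GG.parity I y') α β
        - sgn ((GG.parity I y - 1) * (GG.parity I y' - 1)) •
          braceHom (extParity I) (GG.parity I y) β α := by
  have h1 : ∀ p (α : Cochain ℤ (Ext I)), braceHom (extParity I) p α 0 = 0 := fun p α => by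
    simpa using braceHom_smul_right (extParity I) p 0 α 0
  have h2 : ∀ p (α : Cochain ℤ (Ext I)), braceHom (extParity I) p 0 α = 0 := fun p α => by
    simpa using braceHom_smul_left (extParity I) p 0 0 α
  rw [gerstenhaberBracket, Finset.sum_eq_single (GG.parity I y),
    Finset.sum_eq_single (GG.parity I y')]
  · rw [parityPart_of_mem I hα, parityPart_of_mem I hβ, if_pos rfl, if_pos rfl]
  · intro p _ hp
    rw [parityPart_of_mem I hβ, if_neg hp.symm, h1, h2, smul_zero, sub_zero]
  · simp
  · intro p _ hp
    refine Finset.sum_eq_zero fun q _ => ?_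
    rw [parityPart_of_mem I hα, if_neg hp.symm, h1, h2, smul_zero, sub_zero]
  · simp

end Degrees

/-! ### The differential and the Gerstenhaber identities for cochains -/

section Identities

variable (I : Type*) [Fintype I] [DecidableEq I]

/-- The identity of `A`, as a function of lists of length 1. -/
def idL {A : Type*} [Zero A] : List A → A
  | [a] => a
  | _ => 0

/-- The Hochschild differential of a function of lists of parity `p`, up to the sign `(-1)^p`. -/
def dL (p : ZMod 2) (F : List (Ext I) → Ext I) : List (Ext I) → Ext I :=
  cupL (koszul (extParity I) 1) F idL - sgn p • cupL (koszul (extParity I) p) idL F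
    + brace (koszul (extParity I) 1) F (mulL I)

/-- The product has two slots. Inserting F in the first leaves one argument on the right, inserting
it in the second leaves one on the left; both are cup products with the identity cochain. -/
theorem brace_mulL (g : Ext I → Ext I) (F : List (Ext I) → Ext I) :
    brace g (mulL I) F
      = cupL id (fun l => inv I (F l)) idL + cupL (fun a => inv I (g a)) idL F := by
  have h1 : ∀ v r, mulL I (F v :: r) = inv I (F v) * idL r := by
    intro v r
    match r with
    | [] => simp [mulL, idL]
    | [c] => rfl
    | c :: d :: r => simp [mulL, idL]
  have hz : ∀ c d l, brace g (fun t => mulL I (c :: d :: t)) F l = 0 := by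
    intro c d l
    have h : ∀ u v r, mulL I (c :: d :: (List.map g u ++ F v :: r)) = 0 := by
      intro u v r
      match u with
      | [] => rfl
      | _ :: _ => rfl
    simp only [brace, h, splitSum_zero]
  funext l
  match l with
  | [] => simp [brace_nil, mulL, cupL, splitSum, idL]
  | c :: l =>
    rw [brace_cons, Pi.add_apply]
    congr 1
    · rw [cupL]
      simp only [h1, List.map_id]
    · have h2 : ∀ l, brace g (fun t => mulL I (g c :: t)) F l = inv I (g c) * F l := by
        intro l
        have h3 : splitSum (fun v r => mulL I (g c :: F v :: r)) l = inv I (g c) * F l := by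
          rw [splitSum_right_nil]
          · rfl
          · intro u v hv
            match v with
            | [] => exact absurd rfl hv
            | _ :: _ => rfl
        match l with
        | [] => rfl
        | d :: l => rw [brace_cons, h3]; exact (congrArg _ (hz _ _ l)).trans (add_zero _)
      rw [h2, cupL]
      simp only [splitSum, List.map_nil, idL, zero_mul, zero_add, List.map_cons]
      rw [splitSum_left_nil]
      · rfl
      · intro u v hu
        match u with
        | [] => exact absurd rfl hu
        | _ :: _ => simp

/-- The two slots of `μ²` give the cup products with the identity and the other half of the bracket
gives F{μ²}. Factoring out (-1)^p makes the terms that act on the right end or inside independent of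
p. -/
theorem ev_hochschildDiff {y : GG I} {α : Cochain ℤ (Ext I)} (hα : α ∈ CCdeg I y) :
    ev (hochschildDiff (extParity I) α) = sgn (GG.parity I y) • dL I (GG.parity I y) (ev α) := by
  have hinv : ∀ l, inv I (ev α l)
      = sgn (GG.parity I y) • ev α (l.map (koszul (extParity I) 1)) := by
    intro l
    have h := koszul_ev I hα 1 l
    rw [koszul_one, neg_eq_iff_eq_neg, ← neg_smul] at h
    rw [h]
    congr 1
    generalize GG.parity I y = p
    revert p; decide
  have hk : ∀ a, inv I (koszul (extParity I) (GG.parity I y - 1) a)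
      = -koszul (extParity I) (GG.parity I y) a := by
    intro a
    rw [← neg_eq_iff_eq_neg, ← koszul_one, koszul_koszul, add_sub_cancel]
  have h0 : GG.parity I (GG.ofInt I 2) = 0 := (parity_ofInt I 2).trans (by decide)
  have h1 : (0 - 1 : ZMod 2) = 1 := by decide
  rw [hochschildDiff, bracket_of_mem I (mulCochain_mem I) hα, h0, h1]
  funext l
  simp only [ev_sub, ev_zsmul, ev_braceHom, ev_mulCochain, brace_mulL, h1, dL, Pi.add_apply,
    Pi.sub_apply, Pi.smul_apply, cupL, hinv, hk, smul_add, smul_sub, smul_smul, sgn_mul_self,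
    one_smul, List.map_id, smul_mul_assoc, splitSum_zsmul]
  have h2 : ∀ u v, idL (List.map (fun a => -koszul (extParity I) (GG.parity I y) a) u) * ev α v
      = (-1 : ℤ) • (idL (List.map (koszul (extParity I) (GG.parity I y)) u) * ev α v) := by
    intro u v
    match u with
    | [] => simp [idL]
    | [a] => simp [idL]
    | a :: b :: u => simp [idL]
  have h3 : sgn (1 * (GG.parity I y - 1)) = -sgn (GG.parity I y) := by
    generalize GG.parity I y = p
    revert p; decide
  simp only [h2, splitSum_zsmul, h3]
  module

theorem hochschildDiff_mem {y : GG I} {α : Cochain ℤ (Ext I)} (hα : α ∈ CCdeg I y) :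
    hochschildDiff (extParity I) α ∈ CCdeg I (y + GG.ofInt I 1) := by
  have h1 := braceHom_mem I (mulCochain_mem I) hα
  have h2 := braceHom_mem I hα (mulCochain_mem I)
  have e1 : GG.ofInt I 2 + y - GG.ofInt I 1 = y + GG.ofInt I 1 := by
    rw [show GG.ofInt I 2 = _ from ofInt_add I 1 1]; abel
  have e2 : y + GG.ofInt I 2 - GG.ofInt I 1 = y + GG.ofInt I 1 := by
    rw [show GG.ofInt I 2 = _ from ofInt_add I 1 1]; abel
  rw [e1] at h1
  rw [e2] at h2
  rw [hochschildDiff, bracket_of_mem I (mulCochain_mem I) hα]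
  exact sub_mem (h1 _) (Submodule.smul_mem _ _ (h2 _))

theorem bracket_mem {y y' : GG I} {α β : Cochain ℤ (Ext I)} (hα : α ∈ CCdeg I y)
    (hβ : β ∈ CCdeg I y') :
    gerstenhaberBracket (extParity I) α β ∈ CCdeg I (y + y' - GG.ofInt I 1) := by
  rw [bracket_of_mem I hα hβ]
  refine sub_mem (braceHom_mem I hα hβ _) (Submodule.smul_mem _ _ ?_)
  rw [add_comm y y']
  exact braceHom_mem I hβ hα _

theorem cup_mem {y y' : GG I} {α β : Cochain ℤ (Ext I)} (hα : α ∈ CCdeg I y)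
    (hβ : β ∈ CCdeg I y') : cup (extParity I) α β ∈ CCdeg I (y + y') := by
  rw [cup_of_mem I α hβ]
  exact cupHom_mem I hα hβ _

/-- By `brace_brace` the associator of the brace consists of the side-by-side insertions, and these
are symmetric up to sign in the two inserted cochains. -/
theorem preLie (α : Cochain ℤ (Ext I)) {y z : GG I} {β γ : Cochain ℤ (Ext I)}
    (hβ : β ∈ CCdeg I y) (hγ : γ ∈ CCdeg I z) {q r : ZMod 2} (hq : GG.parity I y = q)
    (hr : GG.parity I z = r) :
    braceHom (extParity I) r (braceHom (extParity I) q α β) γ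
        - braceHom (extParity I) (q + r - 1) α (braceHom (extParity I) r β γ)
      = sgn ((q - 1) * (r - 1)) •
        (braceHom (extParity I) q (braceHom (extParity I) r α γ) β
          - braceHom (extParity I) (q + r - 1) α (braceHom (extParity I) q γ β)) := by
  refine cochain_ext fun l => ?_
  have hev : ∀ p (α β : Cochain ℤ (Ext I)), ev (braceHom (extParity I) p α β)
      = brace (koszul (extParity I) (p - 1)) (ev α) (ev β) :=
    fun p α β => funext fun l => ev_braceHom _ p α β l
  have hc : ∀ a b x, koszul (extParity I) a (koszul (extParity I) b x)
      = koszul (extParity I) b (koszul (extParity I) a x) := fun a b x => by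
    rw [koszul_koszul, koszul_koszul, add_comm]
  have h1 := brace_brace (koszul (extParity I) (q - 1)) (koszul (extParity I) (r - 1)) (ev α) (ev β)
    (ev γ) (sgn ((q - 1) * (r - 1))) (multiLin_ev α) (hc _ _)
    (fun l => by rw [koszul_ev I hγ, hr]) l
  have h2 := brace_brace (koszul (extParity I) (r - 1)) (koszul (extParity I) (q - 1)) (ev α) (ev γ)
    (ev β) (sgn ((q - 1) * (r - 1))) (multiLin_ev α) (hc _ _)
    (fun l => by rw [koszul_ev I hβ, hq, mul_comm]) l
  rw [koszul_comp, show q - 1 + (r - 1) = q + r - 1 - 1 by ring] at h1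
  rw [koszul_comp, show r - 1 + (q - 1) = q + r - 1 - 1 by ring] at h2
  simp only [ev_sub, ev_zsmul, hev, h1, h2, add_sub_cancel_left, smul_add, smul_smul, sgn_mul_self,
    one_smul]
  exact add_comm _ _

theorem parity_bracket (x y : GG I) : GG.parity I (x + y - GG.ofInt I 1)
    = GG.parity I x + GG.parity I y - 1 := by
  rw [map_sub, map_add, parity_ofInt]
  simp

/-- The Jacobi identity for homogeneous cochains. -/
theorem bracket_jacobi {x y z : GG I} {α β γ : Cochain ℤ (Ext I)} (hα : α ∈ CCdeg I x)
    (hβ : β ∈ CCdeg I y) (hγ : γ ∈ CCdeg I z) :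
    gerstenhaberBracket (extParity I) α (gerstenhaberBracket (extParity I) β γ)
      = gerstenhaberBracket (extParity I) (gerstenhaberBracket (extParity I) α β) γ
        + sgn ((GG.parity I x - 1) * (GG.parity I y - 1)) •
          gerstenhaberBracket (extParity I) β (gerstenhaberBracket (extParity I) α γ) := by
  have p1 := preLie I α hβ hγ rfl rfl
  have p2 := preLie I β hα hγ rfl rfl
  have p3 := preLie I γ hα hβ rfl rfl
  rw [bracket_of_mem I hα (bracket_mem I hβ hγ), bracket_of_mem I (bracket_mem I hα hβ) hγ,
    bracket_of_mem I hβ (bracket_mem I hα hγ), bracket_of_mem I hα hβ, bracket_of_mem I hα hγ,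
    bracket_of_mem I hβ hγ, parity_bracket, parity_bracket, parity_bracket]
  generalize GG.parity I x = a at *
  generalize GG.parity I y = b at *
  generalize GG.parity I z = c at *
  have hsubr : ∀ p (α β γ : Cochain ℤ (Ext I)), braceHom (extParity I) p α (β - γ)
      = braceHom (extParity I) p α β - braceHom (extParity I) p α γ := fun p α β γ => by
    rw [eq_sub_iff_add_eq, ← braceHom_add_right, sub_add_cancel]
  have hsubl : ∀ p (α β γ : Cochain ℤ (Ext I)), braceHom (extParity I) p (α - β) γ
      = braceHom (extParity I) p α γ - braceHom (extParity I) p β γ := fun p α β γ => by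
    rw [eq_sub_iff_add_eq, ← braceHom_add_left, sub_add_cancel]
  have s1 : sgn ((a - 1) * (b + c - 1 - 1)) = sgn ((a - 1) * (b - 1)) * sgn ((a - 1) * (c - 1)) := by
    rw [← sgn_add]; congr 1; ring
  have s2 : sgn ((a + b - 1 - 1) * (c - 1)) = sgn ((a - 1) * (c - 1)) * sgn ((b - 1) * (c - 1)) := by
    rw [← sgn_add]; congr 1; ring
  have s3 : sgn ((b - 1) * (a + c - 1 - 1)) = sgn ((a - 1) * (b - 1)) * sgn ((b - 1) * (c - 1)) := by
    rw [← sgn_add]; congr 1; ring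
  have hpm : ∀ p, sgn p = 1 ∨ sgn p = -1 := by decide
  simp only [hsubr, hsubl, braceHom_smul_left, braceHom_smul_right, s1, s2, s3]
  -- All signs are products of the three pairwise signs. Once these are fixed as ±1, the Jacobi
  -- identity is a signed sum of the three pre-Lie relations, whose last two coefficients depend on
  -- the case.
  rcases hpm ((a - 1) * (b - 1)) with hu | hu <;> rcases hpm ((a - 1) * (c - 1)) with hv | hv <;>
    rcases hpm ((b - 1) * (c - 1)) with hw | hw <;>
    simp only [hu, hv, hw] at p1 p2 p3 ⊢ <;>
    first
    | linear_combination (norm := module) (-1 : ℤ) • p1 + (1 : ℤ) • p2 + (1 : ℤ) • p3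
    | linear_combination (norm := module) (-1 : ℤ) • p1 + (1 : ℤ) • p2 + (-1 : ℤ) • p3
    | linear_combination (norm := module) (-1 : ℤ) • p1 + (-1 : ℤ) • p2 + (1 : ℤ) • p3
    | linear_combination (norm := module) (-1 : ℤ) • p1 + (-1 : ℤ) • p2 + (-1 : ℤ) • p3

theorem koszul_mulL (q : ZMod 2) (l : List (Ext I)) :
    koszul (extParity I) q (mulL I l) = sgn q • mulL I (l.map (koszul (extParity I) q)) := by
  rcases zmodTwo_cases q with rfl | rfl
  · have : (koszul (extParity I) 0 : Ext I → Ext I) = id := funext (koszul_zero I)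
    rw [this, sgn_zero, one_smul, List.map_id]
    rfl
  · match l with
    | [] => simp [mulL]
    | [a] => simp [mulL]
    | [a, b] =>
      simp only [mulL, List.map_cons, List.map_nil, koszul_one, map_mul, map_neg, sgn_one,
        CliffordAlgebra.involute_involute]
      noncomm_ring
    | a :: b :: c :: l => simp [mulL]

/-- Inserting `μ²` is a derivation by `brace_splitSum`. The outer cup products with the identity
match by associativity, and the two terms with the identity between F and G cancel. -/
theorem dL_cupL (p q : ZMod 2) {F G : List (Ext I) → Ext I} (hF : MultiLin F) :
    dL I (p + q) (cupL (koszul (extParity I) q) F G)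
      = sgn q • cupL (koszul (extParity I) q) (dL I p F) G
        + cupL (koszul (extParity I) (q + 1)) F (dL I q G) := by
  have hc : ∀ a b x, koszul (extParity I) a (koszul (extParity I) b x)
      = koszul (extParity I) b (koszul (extParity I) a x) := fun a b x => by
    rw [koszul_koszul, koszul_koszul, add_comm]
  have hb : brace (koszul (extParity I) 1) (cupL (koszul (extParity I) q) F G) (mulL I)
      = cupL (koszul (extParity I) (q + 1)) F (brace (koszul (extParity I) 1) G (mulL I))
        + sgn q • cupL (koszul (extParity I) q) (brace (koszul (extParity I) 1) F (mulL I)) G := by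
    funext l
    refine (brace_splitSum (koszul (extParity I) q) (koszul (extParity I) 1)
      (fun u v => F u * G v) (mulL I) (sgn q) ?_ (hc q 1) (koszul_mulL I q) l).trans ?_
    · intro l r v
      obtain ⟨f, hf⟩ := hF l r
      exact ⟨(AddMonoidHom.mulRight (G v)).comp f, fun a => by simp [hf]⟩
    · have h1 : ∀ (b : Ext I) (g : Ext I → Ext I) (K : List (Ext I) → Ext I) l,
          brace g (fun t => b * K t) (mulL I) l = b * brace g K (mulL I) l := fun b g K l => by
        simp only [brace]
        exact ((map_splitSum (AddMonoidHom.mulLeft b) _ l).trans (splitSum_congr fun u w _ =>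
          map_splitSum (AddMonoidHom.mulLeft b) _ w)).symm
      have h2 : ∀ (b : Ext I) (g : Ext I → Ext I) (K : List (Ext I) → Ext I) l,
          brace g (fun t => K t * b) (mulL I) l = brace g K (mulL I) l * b := fun b g K l => by
        simp only [brace]
        exact ((map_splitSum (AddMonoidHom.mulRight b) _ l).trans (splitSum_congr fun u w _ =>
          map_splitSum (AddMonoidHom.mulRight b) _ w)).symm
      simp only [h2, koszul_comp, Pi.add_apply, Pi.smul_apply, cupL]
      congr 1
      exact splitSum_congr fun u v _ => h1 _ _ _ _
  rw [dL, hb, cupL_assoc, koszul_comp, show p + q = q + p from add_comm p q, ← koszul_comp I q p,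
    koszul_comp I q p, ← sub_eq_zero]
  have e1 : cupL (koszul (extParity I) (q + p)) idL (cupL (koszul (extParity I) q) F G)
      = cupL (koszul (extParity I) q) (cupL (koszul (extParity I) p) idL F) G := by
    rw [cupL_assoc, koszul_comp, add_comm p q]
  have e2 : cupL (koszul (extParity I) q) (cupL (koszul (extParity I) 1) F idL) G
      = cupL (koszul (extParity I) (q + 1)) F (cupL (koszul (extParity I) q) idL G) := by
    rw [cupL_assoc, koszul_comp, add_comm 1 q]
  have hsl : ∀ (g : Ext I → Ext I) (A B C : List (Ext I) → Ext I),
      cupL g (A - B) C = cupL g A C - cupL g B C := fun g A B C => by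
    rw [eq_sub_iff_add_eq, ← cupL_add_left, sub_add_cancel]
  have hsr : ∀ (g : Ext I → Ext I) (A B C : List (Ext I) → Ext I),
      cupL g A (B - C) = cupL g A B - cupL g A C := fun g A B C => by
    rw [eq_sub_iff_add_eq, ← cupL_add_right, sub_add_cancel]
  have hs : sgn (q + p) = sgn q * sgn p := sgn_add q p
  rw [e1, dL, dL, cupL_add_left, cupL_add_right, hsl, hsr, cupL_zsmul_left, cupL_zsmul_right, e2, hs]
  module

/-- The differential is a derivation of the cup product. -/
theorem hochschildDiff_cup {y y' : GG I} {α β : Cochain ℤ (Ext I)} (hα : α ∈ CCdeg I y)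
    (hβ : β ∈ CCdeg I y') : hochschildDiff (extParity I) (cup (extParity I) α β)
      = cup (extParity I) (hochschildDiff (extParity I) α) β
        + sgn (GG.parity I y) • cup (extParity I) α (hochschildDiff (extParity I) β) := by
  have hp : GG.parity I (y' + GG.ofInt I 1) = GG.parity I y' + 1 := by
    rw [map_add, parity_ofInt, Int.cast_one]
  refine cochain_ext fun l => ?_
  rw [ev_add, ev_zsmul, ev_hochschildDiff I (cup_mem I hα hβ), cup_of_mem I _ hβ, cup_of_mem I _ hβ,
    cup_of_mem I _ (hochschildDiff_mem I hβ), ev_cupHom, ev_cupHom, ev_cupHom,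
    ev_hochschildDiff I hα, ev_hochschildDiff I hβ, hp, map_add, dL_cupL I _ _ (multiLin_ev α),
    cupL_zsmul_left, cupL_zsmul_right, sgn_add]
  simp only [Pi.smul_apply, Pi.add_apply, smul_add, smul_smul, mul_assoc, sgn_mul_self, mul_one]

/-- The differential is a derivation of the bracket. -/
theorem hochschildDiff_bracket {y y' : GG I} {α β : Cochain ℤ (Ext I)} (hα : α ∈ CCdeg I y)
    (hβ : β ∈ CCdeg I y') :
    hochschildDiff (extParity I) (gerstenhaberBracket (extParity I) α β)
      = gerstenhaberBracket (extParity I) (hochschildDiff (extParity I) α) β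
        - sgn (GG.parity I y) •
          gerstenhaberBracket (extParity I) α (hochschildDiff (extParity I) β) := by
  have h : sgn ((GG.parity I (GG.ofInt I 2) - 1) * (GG.parity I y - 1))
      = -sgn (GG.parity I y) := by
    rw [parity_ofInt]
    generalize GG.parity I y = p
    revert p; decide
  simp only [hochschildDiff]
  -- Since δ is the bracket with `μ²`, this is the Jacobi identity with `μ²` in the first place.
  rw [bracket_jacobi I (mulCochain_mem I) hα hβ, h, neg_smul]
  exact (sub_eq_add_neg _ _).symm

end Identities

/-! ### The Hochschild complex with coefficients in a bimodule -/

/-- A bimodule over `A`, given by its two actions. -/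
structure Bimod (A M : Type*) [Ring A] [AddCommGroup M] where
  /-- the left action -/
  lam : A → M →+ M
  /-- the right action -/
  rho : A → M →+ M
  lam_one : ∀ m, lam 1 m = m
  lam_mul : ∀ a b m, lam (a * b) m = lam a (lam b m)
  lam_add : ∀ a b m, lam (a + b) m = lam a m + lam b m
  rho_one : ∀ m, rho 1 m = m
  rho_mul : ∀ a b m, rho (a * b) m = rho b (rho a m)
  rho_add : ∀ a b m, rho (a + b) m = rho a m + rho b m
  lam_rho : ∀ a b m, lam a (rho b m) = rho b (lam a m)

section Bar

variable {A M M' : Type*} [Ring A] [AddCommGroup M] [AddCommGroup M'] (σ : A →+* A)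

/-- The bimodule in which the left action is twisted by `σ`. -/
def Bimod.flip (B : Bimod A M) : Bimod A M where
  lam a := B.lam (σ a)
  rho := B.rho
  lam_one m := by rw [map_one, B.lam_one]
  lam_mul a b m := by rw [map_mul, B.lam_mul]
  lam_add a b m := by rw [map_add, B.lam_add]
  rho_one := B.rho_one
  rho_mul := B.rho_mul
  rho_add := B.rho_add
  lam_rho a := B.lam_rho (σ a)

theorem Bimod.flip_lam (B : Bimod A M) (a : A) (m : M) :
    (B.flip σ).lam a m = B.lam (σ a) m := rfl

theorem Bimod.lam_neg (B : Bimod A M) (a : A) (m : M) : B.lam (-a) m = -B.lam a m :=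
  map_neg (AddMonoidHom.mk' (fun a => B.lam a m) fun a b => B.lam_add a b m) a

theorem Bimod.rho_neg (B : Bimod A M) (a : A) (m : M) : B.rho (-a) m = -B.rho a m :=
  map_neg (AddMonoidHom.mk' (fun a => B.rho a m) fun a b => B.rho_add a b m) a

/-- The part of the Hochschild differential in which adjacent arguments are multiplied, or the last
one acts from the right. -/
def bar (rho : A → M →+ M) : List A → (List A → M) → M
  | [], _ => 0
  | [c], F => rho c (F [])
  | a :: b :: l, F => F (σ a * b :: l) + bar rho (b :: l) (fun t => F (-σ a :: t))

/-- The Hochschild differential. -/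
def dBar (B : Bimod A M) (F : List A → M) : List A → M
  | [] => 0
  | c :: l => -B.lam c (F l) + bar σ B.rho (c :: l) F

variable {σ}

theorem bar_map {rho : A → M →+ M} {rho' : A → M' →+ M'} (f : M →+ M')
    (hf : ∀ c m, f (rho c m) = rho' c (f m)) (l : List A) (F : List A → M) :
    bar σ rho' l (fun t => f (F t)) = f (bar σ rho l F) := by
  induction l generalizing F with
  | nil => simp [bar]
  | cons a l ih =>
    cases l with
    | nil => simp [bar, hf]
    | cons b l => rw [bar, bar, map_add, ← ih]

theorem bar_add (rho : A → M →+ M) (l : List A) (F G : List A → M) :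
    bar σ rho l (fun t => F t + G t) = bar σ rho l F + bar σ rho l G := by
  induction l generalizing F G with
  | nil => simp [bar]
  | cons a l ih =>
    cases l with
    | nil => simp [bar]
    | cons b l => rw [bar, bar, bar, ih]; abel

theorem bar_neg (rho : A → M →+ M) (l : List A) (F : List A → M) :
    bar σ rho l (fun t => -F t) = -bar σ rho l F :=
  bar_map (-AddMonoidHom.id M) (by simp) l F

theorem bar_zero (rho : A → M →+ M) (l : List A) :
    bar σ rho l (fun _ => (0 : M)) = 0 := by
  have := bar_add (σ := σ) rho l (fun _ => 0) (fun _ => 0)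
  simpa using this

theorem bar_sub (rho : A → M →+ M) (l : List A) (F G : List A → M) :
    bar σ rho l (fun t => F t - G t) = bar σ rho l F - bar σ rho l G := by
  simp only [sub_eq_add_neg, bar_add, bar_neg]

theorem bar_congr (rho : A → M →+ M) (l : List A) {F G : List A → M}
    (h : ∀ t : List A, t.length + 1 = l.length → F t = G t) : bar σ rho l F = bar σ rho l G := by
  induction l generalizing F G with
  | nil => rfl
  | cons a l ih =>
    cases l with
    | nil => simp [bar, h [] rfl]
    | cons b l => rw [bar, bar, h _ (by simp), ih fun t ht => h _ (by simpa using ht)]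

/-- Contractions at disjoint places cancel because contracting a pair removes one factor -1 from the
signs met later; overlapping ones cancel by associativity, or at the right end by `rho_mul`. -/
theorem bar_bar_aux {B : Bimod A M} (hσ : ∀ a, σ (σ a) = a) (l : List A) (a b : A)
    {F : List A → M} (hF : MultiLin F) :
    bar σ B.rho (σ a * b :: l) F + bar σ B.rho (b :: l) (fun t => bar σ B.rho (-σ a :: t) F)
      = 0 := by
  induction l generalizing a b F with
  | nil =>
    simp only [bar, B.rho_mul, B.rho_neg, map_neg, add_neg_cancel]
  | cons c l ih =>
    have h1 : ∀ t, bar σ B.rho (-σ a :: -σ b :: t) F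
        = F (a * σ b :: t) + bar σ B.rho (-σ b :: t) (fun t => F (a :: t)) := by
      intro t
      rw [bar]
      simp [hσ]
    have hneg := fun x t => hF.map_neg [] t x
    simp only [List.nil_append] at hneg
    rw [bar, bar]
    simp only [h1]
    rw [bar_add, bar]
    have h2 := ih b c (hF.cons a)
    simp only [map_mul, map_neg, hσ, neg_neg, neg_mul, hneg, bar_neg] at h2 ⊢
    rw [mul_assoc]
    linear_combination (norm := module) h2

/-- The second differential uses the twisted left action: the first argument meets `σ` when it is
multiplied into the next one or is passed over, and the twist lets the two left actions combine
through `lam_mul`. -/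
theorem dBar_dBar {B B' : Bimod A M} (hσ : ∀ a, σ (σ a) = a)
    (hlam : ∀ a m, B'.lam a m = B.lam (σ a) m) (hrho : B'.rho = B.rho) {F : List A → M}
    (hF : MultiLin F) (l : List A) : dBar σ B' (dBar σ B F) l = 0 := by
  match l with
  | [] => rfl
  | [a] => simp [dBar, bar]
  | a :: b :: l =>
    have h := bar_bar_aux (B := B) hσ l a b hF
    rw [dBar, hlam, dBar, hrho, bar, dBar]
    have h1 : bar σ B.rho (b :: l) (fun t => dBar σ B F (-σ a :: t))
        = B.lam (σ a) (bar σ B.rho (b :: l) F)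
          + bar σ B.rho (b :: l) (fun t => bar σ B.rho (-σ a :: t) F) := by
      rw [← bar_map (rho := B.rho) (B.lam (σ a)) (fun c m => B.lam_rho (σ a) c m), ← bar_add]
      congr 1
      funext t
      rw [dBar, B.lam_neg, neg_neg]
    rw [h1, B.lam_mul]
    simp only [map_add, map_neg]
    linear_combination (norm := module) h

/-! ### Coinduced bimodules -/

/-- The coinduced bimodule. -/
def coind (B : Bimod A M) : Bimod A (A →+ M) where
  lam c := AddMonoidHom.mk' (fun φ => φ.comp (AddMonoidHom.mulRight c)) fun _ _ => rfl
  rho c := AddMonoidHom.mk' (fun φ => (B.rho c).comp φ) fun φ ψ =>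
    AddMonoidHom.ext fun x => map_add (B.rho c) (φ x) (ψ x)
  lam_one φ := AddMonoidHom.ext fun x => congrArg φ (mul_one x)
  lam_mul a b φ := AddMonoidHom.ext fun x => congrArg φ (mul_assoc x a b).symm
  lam_add a b φ := AddMonoidHom.ext fun x =>
    (congrArg φ (mul_add x a b)).trans (map_add φ (x * a) (x * b))
  rho_one φ := AddMonoidHom.ext fun x => B.rho_one (φ x)
  rho_mul a b φ := AddMonoidHom.ext fun x => B.rho_mul a b (φ x)
  rho_add a b φ := AddMonoidHom.ext fun x => B.rho_add a b (φ x)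
  lam_rho _ _ _ := rfl

theorem coind_lam_apply (B : Bimod A M) (c : A) (φ : A →+ M) (x : A) :
    (coind B).lam c φ x = φ (x * c) := rfl

variable (σ) in
/-- The embedding of a bimodule into the coinduced one. -/
def toCoind (B : Bimod A M) : M →+ (A →+ M) :=
  AddMonoidHom.mk' (fun m => AddMonoidHom.mk' (fun x => B.lam (σ x) m)
    fun x y => by rw [map_add, B.lam_add]) fun m n =>
      AddMonoidHom.ext fun x => map_add (B.lam (σ x)) m n

theorem toCoind_apply (B : Bimod A M) (m : M) (x : A) : toCoind σ B m x = B.lam (σ x) m := rfl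

variable (A M) in
/-- The kernel of evaluation at `1`. -/
def Red : AddSubgroup (A →+ M) where
  carrier := {φ | φ 1 = 0}
  zero_mem' := rfl
  add_mem' {φ ψ} hφ hψ := by
    have h1 : φ 1 = 0 := hφ
    have h2 : ψ 1 = 0 := hψ
    change φ 1 + ψ 1 = 0
    rw [h1, h2, add_zero]
  neg_mem' {φ} hφ := by
    have h1 : φ 1 = 0 := hφ
    change -φ 1 = 0
    rw [h1, neg_zero]

theorem Red.ext {φ ψ : Red A M} (h : ∀ x, φ.1 x = ψ.1 x) : φ = ψ :=
  Subtype.ext (AddMonoidHom.ext h)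

theorem Red.apply_one (φ : Red A M) : φ.1 1 = 0 := φ.2

variable (σ) in
/-- The projection from the coinduced bimodule, with kernel the image of `toCoind`. -/
def toRed (B : Bimod A M) : (A →+ M) →+ Red A M :=
  AddMonoidHom.mk' (fun φ => ⟨φ - toCoind σ B (φ 1), by
    change φ 1 - B.lam (σ 1) (φ 1) = 0
    rw [map_one σ, B.lam_one, sub_self]⟩) fun φ ψ => Red.ext fun x => by
      change φ x + ψ x - B.lam (σ x) (φ 1 + ψ 1)
        = (φ x - B.lam (σ x) (φ 1)) + (ψ x - B.lam (σ x) (ψ 1))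
      rw [map_add]
      abel

theorem toRed_apply (B : Bimod A M) (φ : A →+ M) (x : A) :
    (toRed σ B φ).1 x = φ x - B.lam (σ x) (φ 1) := rfl

theorem toRed_coe (B : Bimod A M) (φ : Red A M) : toRed σ B φ.1 = φ := by
  refine Red.ext fun x => ?_
  rw [toRed_apply, Red.apply_one, map_zero, sub_zero]

theorem toRed_toCoind (B : Bimod A M) (m : M) : toRed σ B (toCoind σ B m) = 0 := by
  refine Red.ext fun x => ?_
  rw [toRed_apply, toCoind_apply, toCoind_apply, map_one, B.lam_one, sub_self]
  rfl

theorem toRed_lam (B : Bimod A M) (c : A) (φ : A →+ M) :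
    toRed σ B ((coind B).lam c (toRed σ B φ).1) = toRed σ B ((coind B).lam c φ) := by
  refine Red.ext fun x => ?_
  simp only [toRed_apply, coind_lam_apply, map_mul, one_mul, map_sub, B.lam_mul]
  abel

variable (σ) in
/-- The quotient of the coinduced bimodule by the given one. -/
def red (B : Bimod A M) : Bimod A (Red A M) where
  lam c := (toRed σ B).comp (((coind B).lam c).comp (Red A M).subtype)
  rho c := AddMonoidHom.mk' (fun φ => ⟨(coind B).rho c φ.1, by
    change B.rho c (φ.1 1) = 0
    rw [Red.apply_one, map_zero]⟩) fun φ ψ => Red.ext fun x => map_add (B.rho c) (φ.1 x) (ψ.1 x)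
  lam_one φ := (congrArg (toRed σ B) ((coind B).lam_one φ.1)).trans (toRed_coe B φ)
  lam_mul a b φ := (congrArg (toRed σ B) ((coind B).lam_mul a b φ.1)).trans
    (toRed_lam B a ((coind B).lam b φ.1)).symm
  lam_add a b φ := (congrArg (toRed σ B) ((coind B).lam_add a b φ.1)).trans
    (map_add (toRed σ B) _ _)
  rho_one φ := Red.ext fun x => B.rho_one (φ.1 x)
  rho_mul a b φ := Red.ext fun x => B.rho_mul a b (φ.1 x)
  rho_add a b φ := Red.ext fun x => B.rho_add a b (φ.1 x)
  lam_rho a b φ := Red.ext fun x => by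
    change B.rho b (φ.1 (x * a)) - B.lam (σ x) (B.rho b (φ.1 (1 * a)))
      = B.rho b (φ.1 (x * a) - B.lam (σ x) (φ.1 (1 * a)))
    rw [map_sub, B.lam_rho]

theorem red_lam (B : Bimod A M) (c : A) (φ : A →+ M) :
    (red σ B).lam c (toRed σ B φ) = toRed σ B ((coind B).lam c φ) :=
  toRed_lam B c φ

theorem red_rho (B : Bimod A M) (c : A) (φ : A →+ M) :
    (red σ B).rho c (toRed σ B φ) = toRed σ B ((coind B).rho c φ) := by
  refine Red.ext fun x => ?_
  change B.rho c (φ x - B.lam (σ x) (φ 1)) = B.rho c (φ x) - B.lam (σ x) (B.rho c (φ 1))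
  rw [map_sub, B.lam_rho]

/-! ### Dimension shifting along the coinduced bimodule. -/

/-- The first argument of a function of lists, split off. -/
def curryL (F : List A → M) (hF : MultiLin F) (l : List A) : A →+ M :=
  AddMonoidHom.mk' (fun x => F (x :: l)) fun x y => hF.map_add [] l x y

theorem curryL_apply (F : List A → M) (hF : MultiLin F) (l : List A) (x : A) :
    curryL F hF l x = F (x :: l) := rfl

theorem multiLin_curryL (F : List A → M) (hF : MultiLin F) : MultiLin (curryL F hF) :=
  .of_add fun l r a b => AddMonoidHom.ext fun x => hF.map_add (x :: l) r a b

theorem bar_coind (B : Bimod A M) (l : List A) (F : List A → A →+ M) (x : A) :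
    bar σ (coind B).rho l F x = bar σ B.rho l (fun t => F t x) :=
  (bar_map (rho := (coind B).rho) (AddMonoidHom.eval x) (fun _ _ => rfl) l F).symm

/-- A cocycle becomes a coboundary in the coinduced bimodule. -/
theorem dBar_curryL (B : Bimod A M) (hσ : ∀ a, σ (σ a) = a) {F : List A → M} (hF : MultiLin F)
    {c : A} {l : List A} (h : ∀ x, dBar σ B F (x :: c :: l) = 0) :
    dBar σ (coind B) (curryL F hF) (c :: l) = -toCoind σ B (F (c :: l)) := by
  refine AddMonoidHom.ext fun x => ?_
  -- The argument -σ x is chosen so that passing over it yields x, while multiplying it into c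
  -- yields -(x c).
  have hx := h (-σ x)
  rw [dBar, bar, B.lam_neg, neg_neg, map_neg, hσ, neg_neg] at hx
  have hn := hF.map_neg [] l (x * c)
  rw [List.nil_append, ← neg_mul] at hn
  rw [List.nil_append] at hn
  rw [hn] at hx
  change -F (x * c :: l) + bar σ (coind B).rho (c :: l) (curryL F hF) x = -B.lam (σ x) (F (c :: l))
  rw [bar_coind]
  simp only [curryL_apply]
  linear_combination (norm := module) hx

theorem dBar_map {B : Bimod A M} {B' : Bimod A M'} (f : M →+ M')
    (hl : ∀ c m, f (B.lam c m) = B'.lam c (f m)) (hr : ∀ c m, f (B.rho c m) = B'.rho c (f m))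
    (F : List A → M) (l : List A) : dBar σ B' (fun t => f (F t)) l = f (dBar σ B F l) := by
  match l with
  | [] => simp [dBar]
  | c :: l => rw [dBar, dBar, map_add, map_neg, hl, bar_map f hr]

theorem dBar_sub (B : Bimod A M) (F G : List A → M) (l : List A) :
    dBar σ B (fun t => F t - G t) l = dBar σ B F l - dBar σ B G l := by
  match l with
  | [] => simp [dBar]
  | c :: l => rw [dBar, dBar, dBar, map_sub, bar_sub]; abel

theorem dBar_congr (B : Bimod A M) {F G : List A → M} {l : List A}
    (h : ∀ t : List A, t.length + 1 = l.length → F t = G t) : dBar σ B F l = dBar σ B G l := by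
  match l with
  | [] => rfl
  | c :: l => rw [dBar, dBar, h l rfl, bar_congr B.rho _ h]

theorem multiLin_uncurryL (G : List A → A →+ M) (hG : MultiLin G) (f : A →+ A) (m : M) :
    MultiLin (fun l : List A => match l with | [] => m | c :: l => G l (f c)) := by
  refine .of_add fun l r a b => ?_
  match l with
  | [] => simp
  | c :: l => simp [hG.map_add l r a b]

theorem toCoind_injective (B : Bimod A M) : Function.Injective (toCoind σ B) := by
  intro m n h
  have := DFunLike.congr_fun h 1
  rwa [toCoind_apply, toCoind_apply, map_one, B.lam_one, B.lam_one] at this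

/-- The embedding m ↦ (x ↦ σ(x)m) is linear over the bimodule with twisted left action, which
accounts for the `flip`. -/
theorem dBar_toCoind (B : Bimod A M) (F : List A → M) (l : List A) :
    dBar σ (coind B) (fun t => toCoind σ B (F t)) l = toCoind σ B (dBar σ (B.flip σ) F l) := by
  refine dBar_map (B := B.flip σ) (B' := coind B) (toCoind σ B) (fun c m => ?_) (fun c m => ?_) F l
  · refine AddMonoidHom.ext fun x => ?_
    change B.lam (σ x) (B.lam (σ c) m) = B.lam (σ (x * c)) m
    rw [map_mul, B.lam_mul]
  · exact AddMonoidHom.ext fun x => B.lam_rho (σ x) c m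

theorem dBar_toRed (B : Bimod A M) (F : List A → A →+ M) (l : List A) :
    dBar σ ((red σ B).flip σ) (fun t => toRed σ B (F t)) l
      = toRed σ B (dBar σ ((coind B).flip σ) F l) :=
  dBar_map (B := (coind B).flip σ) (B' := (red σ B).flip σ) (toRed σ B)
    (fun c m => (red_lam B (σ c) m).symm) (fun c m => (red_rho B c m).symm) F l

/-- Exactness in the middle: two maps with the same image in the quotient differ by an element of M,
which evaluation at 1 recovers. -/
theorem sub_eq_toCoind (B : Bimod A M) {φ ψ : A →+ M} (h : toRed σ B φ = toRed σ B ψ) :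
    φ - ψ = toCoind σ B (φ 1 - ψ 1) := by
  refine AddMonoidHom.ext fun x => ?_
  have h2 := congrArg (fun φ : Red A M => φ.1 x) h
  simp only [toRed_apply] at h2
  rw [AddMonoidHom.sub_apply, toCoind_apply, map_sub]
  linear_combination (norm := module) h2

/-- All values of G vanish at 1, so only the left action contributes. The explicit result makes it
visible that this value is multilinear in the list. -/
theorem dBar_coind_apply_one (B : Bimod A M) (G : List A → Red A M) (l : List A) :
    dBar σ ((coind B).flip σ) (fun t => (G t).1) l 1
      = match l with | [] => 0 | c :: l => -(G l).1 (σ c) := by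
  match l with
  | [] => rfl
  | c :: l =>
    change -(G l).1 (1 * σ c) + bar σ (coind B).rho (c :: l) (fun l => (G l).1) 1 = _
    rw [bar_coind, one_mul]
    simp only [Red.apply_one, bar_zero, add_zero]

theorem dBar_coind_dBar (B : Bimod A M) (hσ : ∀ a, σ (σ a) = a) {F : List A → A →+ M}
    (hF : MultiLin F) (l : List A) :
    dBar σ (coind B) (dBar σ ((coind B).flip σ) F) l = 0 :=
  dBar_dBar (B := (coind B).flip σ) (B' := coind B) hσ
    (fun a m => by rw [Bimod.flip_lam, hσ]) rfl hF l

/-- A cocycle is a coboundary if its image with coefficients in the quotient of the coinduced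
bimodule is one. -/
theorem exists_of_red (B : Bimod A M) (hσ : ∀ a, σ (σ a) = a) {s : ℕ} {F : List A → M}
    (hF : MultiLin F) (hc : ∀ l : List A, l.length = s + 3 → dBar σ B F l = 0)
    {G : List A → Red A M} (hG : MultiLin G)
    (hFG : ∀ l : List A, l.length = s + 1 →
      dBar σ ((red σ B).flip σ) G l = toRed σ B (curryL F hF l)) :
    ∃ H : List A → M, MultiLin H ∧
      ∀ l : List A, l.length = s + 2 → dBar σ (B.flip σ) H l = F l := by
  have hG' : MultiLin (fun l => (G l).1) := hG.comp (Red A M).subtype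
  obtain ⟨D, hD⟩ : ∃ D, D = dBar σ ((coind B).flip σ) (fun l => (G l).1) := ⟨_, rfl⟩
  have hD1 : ∀ l, D l 1 = match l with | [] => 0 | c :: l => -(G l).1 (σ c) := fun l => by
    rw [hD]
    exact dBar_coind_apply_one B G l
  have hDD : ∀ l, dBar σ (coind B) D l = 0 := fun l => by
    rw [hD]
    exact dBar_coind_dBar B hσ hG' l
  have hη : ∀ l : List A, l.length = s + 1 →
      curryL F hF l - D l = toCoind σ B (F (1 :: l) - D l 1) := by
    intro l hl
    refine sub_eq_toCoind B ?_
    rw [← hFG l hl, hD, ← dBar_toRed]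
    simp only [toRed_coe]
  -- By `hη`, D minus the curried F is the image of this function under the embedding of M. Since D
  -- is closed, differentiating leaves minus the differential of the curried F, which is the
  -- embedded F.
  refine ⟨fun l => D l 1 - F (1 :: l), ?_, ?_⟩
  · refine MultiLin.sub ?_ (hF.cons 1)
    simp only [hD1]
    exact multiLin_uncurryL (fun l => -(G l).1) hG'.neg (σ : A →+ A) 0
  · intro l hl
    refine toCoind_injective (σ := σ) B ?_
    rw [← dBar_toCoind, dBar_congr (G := fun t => D t - curryL F hF t), dBar_sub, hDD]
    · match l, hl with
      | c :: l, hl =>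
        rw [dBar_curryL B hσ hF (c := c) (l := l) fun x => hc _ (by simp at hl ⊢; omega), zero_sub,
          neg_neg]
    · intro t ht
      rw [← neg_sub (curryL F hF t), hη t (by omega), ← map_neg, neg_sub]

end Bar

/-! ### Exactness of the Koszul complex -/

section Koszul

variable {I : Type*} {M M' : Type*} [AddCommGroup M] [AddCommGroup M']

/-- Multiplication by `zᵢ` of families indexed by monomials. -/
def zMul (i : I) : ((I →₀ ℕ) → M) →+ ((I →₀ ℕ) → M) :=
  AddMonoidHom.mk' (fun κ m => if m i = 0 then 0 else κ (m - Finsupp.single i 1)) fun κ κ' => by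
    funext m
    simp only [Pi.add_apply]
    split_ifs <;> simp

/-- Division by `zᵢ`. -/
def zDiv (i : I) (κ : (I →₀ ℕ) → M) (m : I →₀ ℕ) : M := κ (m + Finsupp.single i 1)

theorem zMul_apply (i : I) (κ : (I →₀ ℕ) → M) (m : I →₀ ℕ) :
    zMul i κ m = if m i = 0 then 0 else κ (m - Finsupp.single i 1) := rfl

theorem zMul_map (i : I) (f : M →+ M') (κ : (I →₀ ℕ) → M) :
    zMul i (fun m => f (κ m)) = fun m => f (zMul i κ m) := by
  funext m
  simp only [zMul_apply]
  split_ifs <;> simp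

theorem zMul_comm (i j : I) (κ : (I →₀ ℕ) → M) : zMul i (zMul j κ) = zMul j (zMul i κ) := by
  classical
  by_cases hij : i = j
  · rw [hij]
  · funext m
    simp only [zMul_apply, Finsupp.tsub_apply, Finsupp.single_apply, hij, Ne.symm hij, if_false,
      tsub_zero]
    rw [tsub_right_comm]
    split_ifs <;> rfl

theorem zDiv_zMul_self (i : I) (κ : (I →₀ ℕ) → M) : zDiv i (zMul i κ) = κ := by
  funext m
  simp [zDiv, zMul_apply]

theorem zDiv_zMul_of_ne {i j : I} (h : i ≠ j) (κ : (I →₀ ℕ) → M) :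
    zDiv i (zMul j κ) = zMul j (zDiv i κ) := by
  classical
  funext m
  simp only [zDiv, zMul_apply, Finsupp.add_apply, Finsupp.single_apply, if_neg h, add_zero]
  split_ifs with hm
  · rfl
  · congr 1
    ext k
    simp only [Finsupp.tsub_apply, Finsupp.add_apply, Finsupp.single_apply]
    by_cases hk : j = k
    · subst hk
      simp [h]
    · simp [hk]

theorem zMul_zDiv_self (i : I) (κ : (I →₀ ℕ) → M) (m : I →₀ ℕ) :
    zMul i (zDiv i κ) m = if m i = 0 then 0 else κ m := by
  rw [zMul_apply]
  split_ifs with h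
  · rfl
  · rw [zDiv, tsub_add_cancel_of_le]
    simpa [Finsupp.single_le_iff] using Nat.one_le_iff_ne_zero.2 h

variable [Fintype I] [DecidableEq I]

/-- The action of `θᵢ` on families by the commutator. -/
def kAct (B : Bimod (Ext I) M) (i : I) : M →+ M := B.rho (θ I i) - B.lam (θ I i)

/-- The Koszul differential. -/
def dK (B : Bimod (Ext I) M) (κ : (I →₀ ℕ) → M) : (I →₀ ℕ) → M :=
  ∑ i, zMul i (fun m => kAct B i (κ m))

/-- The bimodule with the left action twisted by parity. -/
abbrev Bimod.twist (B : Bimod (Ext I) M) : Bimod (Ext I) M := B.flip (inv I : Ext I →+* Ext I)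

theorem kAct_apply (B : Bimod (Ext I) M) (i : I) (m : M) :
    kAct B i m = B.rho (θ I i) m - B.lam (θ I i) m := rfl

theorem kAct_twist (B : Bimod (Ext I) M) (i : I) (m : M) :
    kAct B.twist i m = B.rho (θ I i) m + B.lam (θ I i) m := by
  have h : B.twist.lam (θ I i) m = B.lam (-θ I i) m := congrArg (B.lam · m) (inv_θ I i)
  rw [kAct_apply, h, B.lam_neg, sub_neg_eq_add]
  rfl

/-- Left and right actions commute with each other, while the θ's anticommute within each; passing
from a commutator to an anticommutator makes the mixed terms antisymmetric too. -/
theorem kAct_kAct (B B' : Bimod (Ext I) M) (h : ∀ i m, kAct B' i m = B.rho (θ I i) m + B.lam (θ I i) m)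
    (i j : I) (m : M) : kAct B' i (kAct B j m) = -kAct B' j (kAct B i m) := by
  have hr : ∀ i j m, B.rho (θ I i) (B.rho (θ I j) m) = -B.rho (θ I j) (B.rho (θ I i) m) := by
    intro i j m
    rw [← B.rho_mul, ← B.rho_mul, θ_mul_θ, B.rho_neg]
  have hl : ∀ i j m, B.lam (θ I i) (B.lam (θ I j) m) = -B.lam (θ I j) (B.lam (θ I i) m) := by
    intro i j m
    rw [← B.lam_mul, ← B.lam_mul, θ_mul_θ, B.lam_neg]
  simp only [h, kAct_apply, map_sub, B.lam_rho]
  rw [hr i j, hl i j]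
  abel

theorem kAct_kAct_self (B B' : Bimod (Ext I) M)
    (h : ∀ i m, kAct B' i m = B.rho (θ I i) m + B.lam (θ I i) m) (i : I) (m : M) :
    kAct B' i (kAct B i m) = 0 := by
  have hr : B.rho (θ I i) (B.rho (θ I i) m) = 0 := by
    rw [← B.rho_mul, θ_mul_self]
    exact add_eq_right.1 ((B.rho_add 0 0 m).symm.trans (by rw [add_zero]))
  have hl : B.lam (θ I i) (B.lam (θ I i) m) = 0 := by
    rw [← B.lam_mul, θ_mul_self]
    exact add_eq_right.1 ((B.lam_add 0 0 m).symm.trans (by rw [add_zero]))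
  simp only [h, kAct_apply, map_sub, B.lam_rho, hr, hl]
  abel

/-- Symmetric monomials against antisymmetric coefficients. This gives both that the Koszul
differential squares to zero and that products of adjacent generators drop out. -/
theorem sum_zMul_zMul_eq_zero (κ : I → I → (I →₀ ℕ) → M) (h : ∀ i j, κ i j = -κ j i)
    (h' : ∀ i, κ i i = 0) : ∑ i, ∑ j, zMul i (zMul j (κ i j)) = 0 := by
  rw [← Finset.sum_product']
  refine Finset.sum_involution (fun p _ => (p.2, p.1)) ?_ ?_ (by simp) (by simp)
  · rintro ⟨i, j⟩ -
    simp only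
    rw [h i j, zMul_comm]
    simp
  · rintro ⟨i, j⟩ - hne heq
    obtain rfl : j = i := congrArg Prod.fst heq
    exact hne (by simp [h'])

theorem dK_dK (B B' : Bimod (Ext I) M)
    (h : ∀ i m, kAct B' i m = B.rho (θ I i) m + B.lam (θ I i) m) (κ : (I →₀ ℕ) → M) :
    dK B' (dK B κ) = 0 := by
  have h1 : dK B' (dK B κ)
      = ∑ i, ∑ j, zMul i (zMul j (fun m => kAct B' i (kAct B j (κ m)))) := by
    rw [dK]
    refine Finset.sum_congr rfl fun i _ => ?_
    rw [← map_sum]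
    congr 1
    funext m
    simp only [dK, Finset.sum_apply, map_sum]
    refine Finset.sum_congr rfl fun j _ => ?_
    exact (congrFun (zMul_map j (kAct B' i) fun m => kAct B j (κ m)) m).symm
  rw [h1]
  refine sum_zMul_zMul_eq_zero _ (fun i j => ?_) fun i => ?_
  · funext m
    exact kAct_kAct B B' h i j (κ m)
  · funext m
    exact kAct_kAct_self B B' h i (κ m)

theorem dK_add (B : Bimod (Ext I) M) (κ κ' : (I →₀ ℕ) → M) :
    dK B (κ + κ') = dK B κ + dK B κ' := by
  simp only [dK, ← Finset.sum_add_distrib, ← map_add]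
  refine Finset.sum_congr rfl fun i _ => congrArg _ ?_
  funext m
  exact map_add (kAct B i) _ _

theorem dK_sub (B : Bimod (Ext I) M) (κ κ' : (I →₀ ℕ) → M) :
    dK B (κ - κ') = dK B κ - dK B κ' := by
  rw [eq_sub_iff_add_eq, ← dK_add, sub_add_cancel]

theorem dK_apply_zero (B : Bimod (Ext I) M) (κ : (I →₀ ℕ) → M) : dK B κ 0 = 0 := by
  simp [dK, zMul_apply]

/-- Contraction of the coinduced bimodule. -/
def coindContract (i : I) : (Ext I →+ M) →+ (Ext I →+ M) :=
  AddMonoidHom.mk' (fun φ => φ.comp (dright I i).toAddMonoidHom) fun _ _ => rfl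

/-- The canonical relation between contraction by ∂/∂θᵢ and multiplication by θⱼ, in dual form. It
supplies the homotopy for the Koszul complex. -/
theorem kAct_coindContract (B : Bimod (Ext I) M) (i j : I) (φ : Ext I →+ M) :
    kAct (coind B).twist j (coindContract i φ)
      = coindContract i (kAct (coind B) j φ) + if i = j then φ else 0 := by
  refine AddMonoidHom.ext fun x => ?_
  rw [kAct_twist]
  change B.rho (θ I j) (φ (dright I i x)) + φ (dright I i (x * θ I j))
    = (B.rho (θ I j) (φ (dright I i x)) - φ (dright I i x * θ I j)) + (if i = j then φ else 0) x
  rw [dright_mul_θ, map_sub]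
  split_ifs with hij
  · simp only [hij]
    abel
  · simp only [map_zero, AddMonoidHom.zero_apply]
    abel

/-- The Koszul complex of a coinduced bimodule is exact in positive degrees. -/
theorem exists_dK_eq (B : Bimod (Ext I) M) {κ : (I →₀ ℕ) → Ext I →+ M}
    (h : dK (coind B) κ = 0) (h0 : κ 0 = 0) : ∃ μ, dK (coind B).twist μ = κ := by
  -- The variables are treated one at a time: after T has been processed, κ is a boundary on all
  -- monomials that contain a variable of T.
  have hT : ∀ T : Finset I, ∃ μ, ∀ m : I →₀ ℕ, (∃ i ∈ T, m i ≠ 0) →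
      κ m - dK (coind B).twist μ m = 0 := by
    intro T
    induction T using Finset.induction_on with
    | empty => exact ⟨0, by simp⟩
    | insert i T hi ih =>
      obtain ⟨μ, hμ⟩ := ih
      set κ' := κ - dK (coind B).twist μ with hκ'
      have hc : dK (coind B) κ' = 0 := by
        rw [dK_sub, h, dK_dK _ _ (fun i m => ?_), sub_zero]
        have e : (coind B).twist.lam (θ I i) m = (coind B).lam (-θ I i) m :=
          congrArg ((coind B).lam · m) (inv_θ I i)
        rw [e, Bimod.lam_neg, ← sub_eq_add_neg]
        rfl
      -- The cocycle condition for κ', contracted by ∂/∂θᵢ and divided by zᵢ. Subtracting it below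
      -- replaces the action on a contraction by the Kronecker delta.
      have hc' : ∑ j, zDiv i (zMul j fun m => coindContract i (kAct (coind B) j (κ' m))) = 0 := by
        funext m
        have := congrArg (coindContract (M := M) i) (congrFun hc (m + Finsupp.single i 1))
        rw [dK, Finset.sum_apply, map_sum, Pi.zero_apply, map_zero] at this
        rw [Finset.sum_apply, Pi.zero_apply, ← this]
        refine Finset.sum_congr rfl fun j _ => ?_
        rw [zDiv, zMul_map]
      -- The homotopy operator for zᵢ: contract by ∂/∂θᵢ and divide by zᵢ. Its boundary is κ',
      -- except for an error on monomials without zᵢ.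
      refine ⟨μ + zDiv i (fun m => coindContract i (κ' m)), fun m hm => ?_⟩
      have key : dK (coind B).twist (zDiv i (fun m => coindContract i (κ' m))) m
          = κ' m - if m i = 0 then kAct (coind B).twist i (coindContract i (κ' m)) else 0 := by
        have hcm := congrFun hc' m
        rw [Finset.sum_apply, Pi.zero_apply] at hcm
        refine (sub_zero _).symm.trans ((congrArg (_ - ·) hcm.symm).trans ?_)
        rw [dK, Finset.sum_apply, ← Finset.sum_sub_distrib, Finset.sum_eq_single i]
        · rw [zDiv_zMul_self]
          refine (congrArg (· - _) (zMul_zDiv_self i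
            (fun m => kAct (coind B).twist i (coindContract i (κ' m))) m)).trans ?_
          have h1 := kAct_coindContract B i i (κ' m)
          rw [if_pos rfl] at h1
          rw [h1]
          split_ifs <;> abel
        · intro j _ hj
          rw [zDiv_zMul_of_ne hj.symm, sub_eq_zero]
          refine congrFun (congrArg (zMul j) (funext fun m => ?_)) m
          have h1 := kAct_coindContract B i j (κ' (m + Finsupp.single i 1))
          rw [if_neg hj.symm, add_zero] at h1
          exact h1
        · simp
      rw [dK_add, Pi.add_apply, key, ← sub_sub]
      have hm' : κ m - dK (coind B).twist μ m = κ' m := rfl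
      rw [hm', sub_sub_cancel]
      -- If zᵢ is absent, the remaining error is a linear expression in κ' m, which is already zero
      -- when m contains a variable of T; so earlier progress is kept.
      split_ifs with hmi
      · obtain ⟨j, hj, hmj⟩ := hm
        rcases Finset.mem_insert.1 hj with rfl | hj
        · exact absurd hmi hmj
        · have : κ' m = 0 := hμ m ⟨j, hj, hmj⟩
          rw [this, map_zero, map_zero]
      · rfl
  obtain ⟨μ, hμ⟩ := hT Finset.univ
  refine ⟨μ, funext fun m => ?_⟩
  by_cases hm : m = 0
  · rw [hm, dK_apply_zero, h0]
  · obtain ⟨i, hi⟩ := Finsupp.ne_iff.1 hm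
    exact (sub_eq_zero.1 (hμ m ⟨i, Finset.mem_univ i, hi⟩)).symm

end Koszul

/-! ### Restriction of cochains to the generators -/

universe u

section SymSum

variable {I : Type u} [Fintype I] [DecidableEq I]
  {M M' : Type*} [AddCommGroup M] [AddCommGroup M']

variable (I) in
/-- The parity involution as a ring homomorphism. -/
abbrev invR : Ext I →+* Ext I := (inv I : Ext I →+* Ext I)

theorem inv_inv_apply (x : Ext I) : inv I (inv I x) = x := CliffordAlgebra.involute_involute x

/-- The sum of `z_{i₁} ⋯ z_{iₛ} F(θ_{i₁}, …, θ_{iₛ})` over all `i₁, …, iₛ`. -/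
def symSum : ℕ → (List (Ext I) → M) → (I →₀ ℕ) → M
  | 0, F => fun m => if m = 0 then F [] else 0
  | s + 1, F => ∑ i, zMul i (symSum s fun l => F (θ I i :: l))

theorem symSum_congr (s : ℕ) {F G : List (Ext I) → M} (h : ∀ l : List (Ext I), l.length = s → F l = G l) :
    symSum s F = symSum s G := by
  induction s generalizing F G with
  | zero => rw [symSum, symSum, h [] rfl]
  | succ s ih =>
    rw [symSum, symSum]
    refine Finset.sum_congr rfl fun i _ => congrArg _ (ih fun l hl => h _ (by simp [hl]))

theorem symSum_map (f : M →+ M') (s : ℕ) (F : List (Ext I) → M) :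
    symSum s (fun l => f (F l)) = fun m => f (symSum s F m) := by
  induction s generalizing F with
  | zero =>
    funext m
    simp only [symSum]
    split_ifs <;> simp
  | succ s ih =>
    funext m
    simp only [symSum, Finset.sum_apply, map_sum, ih, zMul_map]

theorem symSum_add (s : ℕ) (F G : List (Ext I) → M) :
    symSum s (fun l => F l + G l) = symSum s F + symSum s G := by
  induction s generalizing F G with
  | zero =>
    funext m
    simp only [symSum, Pi.add_apply]
    split_ifs <;> simp
  | succ s ih => simp only [symSum, ih, map_add, Finset.sum_add_distrib]

theorem symSum_zero (s : ℕ) : symSum s (fun _ : List (Ext I) => (0 : M)) = 0 := by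
  have := symSum_add (I := I) (M := M) s (fun _ => 0) (fun _ => 0)
  simpa using this

theorem zMul_apply_zero (i : I) (κ : (I →₀ ℕ) → M) : zMul i κ 0 = 0 := by simp [zMul_apply]

theorem zMul_apply_single (i j : I) (κ : (I →₀ ℕ) → M) :
    zMul i κ (Finsupp.single j 1) = if i = j then κ 0 else 0 := by
  rw [zMul_apply]
  by_cases h : i = j
  · subst h
    simp
  · simp [h]

theorem symSum_succ_apply_zero (s : ℕ) (F : List (Ext I) → M) : symSum (s + 1) F 0 = 0 := by
  rw [symSum, Finset.sum_apply]
  exact Finset.sum_eq_zero fun i _ => zMul_apply_zero i _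

theorem symSum_apply_single (s : ℕ) (F : List (Ext I) → M) (j : I) :
    symSum (s + 1) F (Finsupp.single j 1) = symSum s (fun l => F (θ I j :: l)) 0 := by
  simp [symSum, Finset.sum_apply, zMul_apply_single]

theorem dK_apply_single (B : Bimod (Ext I) M) (κ : (I →₀ ℕ) → M) (j : I) :
    dK B κ (Finsupp.single j 1) = kAct B j (κ 0) := by
  simp [dK, Finset.sum_apply, zMul_apply_single]

/-- The Koszul sign is trivial on generators, and the terms that multiply adjacent arguments cancel
between θᵢθⱼ and θⱼθᵢ. Only the right action of the last argument is left. -/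
theorem symSum_bar (B : Bimod (Ext I) M) (s : ℕ) {F : List (Ext I) → M} (hF : MultiLin F) :
    symSum (s + 1) (fun l => bar (invR I) B.rho l F)
      = ∑ i, zMul i (fun m => B.rho (θ I i) (symSum s F m)) := by
  induction s generalizing F with
  | zero =>
    rw [symSum]
    refine Finset.sum_congr rfl fun i _ => congrArg _ ?_
    refine Eq.trans ?_ (symSum_map (B.rho (θ I i)) 0 F)
    exact symSum_congr 0 fun l hl => by rw [List.length_eq_zero_iff.1 hl]; rfl
  | succ s ih =>
    have hinv : ∀ i, invR I (θ I i) = -θ I i := inv_θ I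
    have h1 : symSum (s + 2) (fun l => bar (invR I) B.rho l F)
        = ∑ i, ∑ j, zMul i (zMul j (symSum s fun l => F (invR I (θ I i) * θ I j :: l)))
          + ∑ i, zMul i (symSum (s + 1) fun l => bar (invR I) B.rho l fun t => F (θ I i :: t)) := by
      rw [symSum, ← Finset.sum_add_distrib]
      refine Finset.sum_congr rfl fun i _ => ?_
      rw [symSum, symSum, ← map_sum, ← map_add, ← Finset.sum_add_distrib]
      refine congrArg _ (Finset.sum_congr rfl fun j _ => ?_)
      rw [← map_add, ← symSum_add]
      simp only [bar, hinv, neg_neg]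
    have hn : ∀ x, symSum s (fun l => F (-x :: l)) = -symSum s (fun l => F (x :: l)) := by
      intro x
      have := symSum_map (-AddMonoidHom.id M) s (fun l => F (x :: l))
      refine Eq.trans ?_ this
      congr 1
      funext l
      simpa using hF.map_neg [] l x
    have h2 : ∑ i, ∑ j, zMul i (zMul j (symSum s fun l => F (invR I (θ I i) * θ I j :: l)))
        = (0 : (I →₀ ℕ) → M) := by
      refine sum_zMul_zMul_eq_zero _ (fun i j => ?_) fun i => ?_
      · rw [← hn, hinv, hinv, neg_mul, neg_mul, θ_mul_θ, neg_neg]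
      · rw [hinv, neg_mul, θ_mul_self, neg_zero, ← symSum_zero s]
        congr 1
        funext l
        exact hF.map_zero [] l
    rw [h1, h2, zero_add]
    simp only [ih (hF.cons _)]
    simp only [symSum, Finset.sum_apply, map_sum]
    rw [Finset.sum_comm]
    refine Finset.sum_congr rfl fun i _ => ?_
    have h3 : (fun m => ∑ j, B.rho (θ I i) (zMul j (symSum s fun l => F (θ I j :: l)) m))
        = ∑ j, zMul j (fun m => B.rho (θ I i) (symSum s (fun l => F (θ I j :: l)) m)) := by
      funext m
      rw [Finset.sum_apply]
      exact Finset.sum_congr rfl fun j _ => (congrFun (zMul_map j _ _) m).symm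
    rw [h3, map_sum]
    exact Finset.sum_congr rfl fun j _ => zMul_comm _ _ _

/-- This makes substitution of 𝐳 a map from the bar complex to the Koszul complex: the first
argument contributes the left action, the last one the right action. -/
theorem symSum_dBar (B : Bimod (Ext I) M) (s : ℕ) {F : List (Ext I) → M} (hF : MultiLin F) :
    symSum (s + 1) (dBar (invR I) B F) = dK B (symSum s F) := by
  have h1 : symSum (s + 1) (dBar (invR I) B F)
      = ∑ i, zMul i (symSum s fun l => -B.lam (θ I i) (F l))
        + symSum (s + 1) (fun l => bar (invR I) B.rho l F) := by
    rw [symSum, symSum, ← Finset.sum_add_distrib]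
    refine Finset.sum_congr rfl fun i _ => ?_
    rw [← map_add, ← symSum_add]
    rfl
  rw [h1, symSum_bar B s hF, dK, ← Finset.sum_add_distrib]
  refine Finset.sum_congr rfl fun i _ => ?_
  rw [← map_add]
  have h2 : (symSum s fun l => -B.lam (θ I i) (F l)) = fun m => -B.lam (θ I i) (symSum s F m) :=
    symSum_map (-B.lam (θ I i)) s F
  rw [h2]
  refine congrArg _ (funext fun m => ?_)
  rw [kAct_apply, Pi.add_apply, neg_add_eq_sub]

theorem dK_map {B : Bimod (Ext I) M} {B' : Bimod (Ext I) M'} (f : M →+ M')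
    (hl : ∀ c m, f (B.lam c m) = B'.lam c (f m)) (hr : ∀ c m, f (B.rho c m) = B'.rho c (f m))
    (κ : (I →₀ ℕ) → M) : dK B' (fun m => f (κ m)) = fun m => f (dK B κ m) := by
  have h : ∀ i m, kAct B' i (f m) = f (kAct B i m) := fun i m => by
    rw [kAct_apply, kAct_apply, map_sub, hl, hr]
  funext m
  simp only [dK, h, zMul_map, Finset.sum_apply, map_sum]

theorem dK_toCoind (B : Bimod (Ext I) M) (κ : (I →₀ ℕ) → M) :
    dK (coind B) (fun m => toCoind (invR I) B (κ m))
      = fun m => toCoind (invR I) B (dK B.twist κ m) := by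
  refine dK_map (B := B.twist) (B' := coind B) (toCoind (invR I) B) (fun c m => ?_)
    (fun c m => ?_) κ
  · refine AddMonoidHom.ext fun x => ?_
    change B.lam (invR I x) (B.lam (invR I c) m) = B.lam (invR I (x * c)) m
    rw [map_mul, B.lam_mul]
  · exact AddMonoidHom.ext fun x => B.lam_rho (invR I x) c m

theorem dK_toRed (B : Bimod (Ext I) M) (κ : (I →₀ ℕ) → Ext I →+ M) :
    dK (red (invR I) B).twist (fun m => toRed (invR I) B (κ m))
      = fun m => toRed (invR I) B (dK (coind B).twist κ m) :=
  dK_map (B := (coind B).twist) (B' := (red (invR I) B).twist) (toRed (invR I) B)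
    (fun c m => (red_lam B (invR I c) m).symm) (fun c m => (red_rho B c m).symm) κ

/-- A derivation that vanishes on the generators vanishes. -/
theorem eq_zero_of_derivation (B : Bimod (Ext I) M) (D : Ext I →+ M)
    (hD : ∀ a b, D (a * b) = B.lam (inv I a) (D b) + B.rho b (D a)) (h : ∀ i, D (θ I i) = 0) :
    D = 0 := by
  have h1 : D 1 = 0 := by
    have := hD 1 1
    rwa [mul_one, map_one (inv I), B.lam_one, B.rho_one, left_eq_add] at this
  have : D.toIntLinearMap = 0 := by
    refine ext_linear I fun l => ?_
    change D (θprod I l) = 0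
    induction l with
    | nil => rwa [θprod_nil]
    | cons i l ih => rw [θprod_cons, hD, ih, h, map_zero, map_zero, add_zero]
  exact AddMonoidHom.ext fun x => DFunLike.congr_fun this x

/-- A cocycle of length 1 is a twisted derivation, and the hypothesis says that it agrees on the
generators with the inner derivation given by κ 0. Derivations are determined on generators. -/
theorem exists_dBar_eq_one (B : Bimod (Ext I) M) {F : List (Ext I) → M} (hF : MultiLin F)
    (hc : ∀ l : List (Ext I), l.length = 2 → dBar (invR I) B F l = 0) {κ : (I →₀ ℕ) → M}
    (hκ : symSum 1 F = dK B.twist κ) :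
    ∃ H : List (Ext I) → M, MultiLin H ∧
      ∀ l : List (Ext I), l.length = 1 → dBar (invR I) B.twist H l = F l := by
  have hθ : ∀ i, F [θ I i] = B.rho (θ I i) (κ 0) + B.lam (θ I i) (κ 0) := by
    intro i
    have := congrFun hκ (Finsupp.single i 1)
    rw [symSum_apply_single, dK_apply_single, kAct_twist] at this
    simpa [symSum] using this
  have hmul : ∀ a b, F [a * b] = B.lam (inv I a) (F [b]) + B.rho b (F [a]) := by
    intro a b
    have h1 := hc [inv I a, b] rfl
    have h2 : invR I (inv I a) = a  := inv_inv_apply a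
    have h3 := hF.map_neg [] [] a
    rw [List.nil_append, List.nil_append] at h3
    simp only [dBar, bar, h2, h3, map_neg] at h1
    linear_combination (norm := module) h1
  refine ⟨fun l => match l with | [] => κ 0 | _ :: _ => 0, .of_add fun l r a b => ?_, ?_⟩
  · cases l <;> simp
  · have hD := eq_zero_of_derivation B
      (AddMonoidHom.mk' (fun c => F [c] - (B.rho c (κ 0) - B.lam (inv I c) (κ 0))) fun a b => by
        have := hF.map_add [] [] a b
        rw [List.nil_append, List.nil_append, List.nil_append] at this
        rw [this, B.rho_add, map_add, B.lam_add]
        abel)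
      (fun a b => by
        simp only [AddMonoidHom.mk'_apply, hmul, B.rho_mul, map_mul, B.lam_mul, map_sub, B.lam_rho]
        abel)
      (fun i => by
        simp only [AddMonoidHom.mk'_apply, hθ, inv_θ, B.lam_neg]
        abel)
    intro l hl
    obtain ⟨c, rfl⟩ := List.length_eq_one_iff.1 hl
    have := DFunLike.congr_fun hD c
    simp only [AddMonoidHom.mk'_apply, AddMonoidHom.zero_apply] at this
    change -B.lam (inv I c) (κ 0) + B.rho c (κ 0) = F [c]
    linear_combination (norm := module) -this

end SymSum

/-- A Hochschild cocycle is a coboundary if its restriction to the generators is one. -/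
theorem exists_dBar_eq {I : Type u} [Fintype I] [DecidableEq I] (s : ℕ) {M : Type u}
    [AddCommGroup M] (B : Bimod (Ext I) M) {F : List (Ext I) → M} (hF : MultiLin F)
    (hc : ∀ l : List (Ext I), l.length = s + 1 → dBar (invR I) B F l = 0) {κ : (I →₀ ℕ) → M}
    (hκ : symSum s F = dK B.twist κ) :
    ∃ H : List (Ext I) → M, MultiLin H ∧
      ∀ l : List (Ext I), l.length = s → dBar (invR I) B.twist H l = F l := by
  match s with
  | 0 =>
    refine ⟨fun _ => 0, .of_add fun l r a b => by simp, fun l hl => ?_⟩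
    -- In length 0 the only value is the coefficient at the monomial 1, where a Koszul boundary
    -- vanishes.
    rw [List.length_eq_zero_iff.1 hl]
    have := congrFun hκ 0
    rw [dK_apply_zero] at this
    simpa [symSum, dBar] using this.symm
  | 1 => exact exists_dBar_eq_one B hF hc hκ
  | s + 2 =>
    have hinv : ∀ a, invR I (invR I a) = a  := inv_inv_apply
    -- The substitution has degree at least 2 in the zᵢ, so its linear coefficients vanish.
    have hκ0 : ∀ i, kAct B.twist i (κ 0) = 0 := fun i => by
      rw [← dK_apply_single, ← hκ, symSum_apply_single, symSum_succ_apply_zero]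
    -- The constant term of κ does not affect its boundary and is removed, because exactness for the
    -- coinduced bimodule is available only for families vanishing at the monomial 1.
    obtain ⟨κ', hκ', hκ'0⟩ : ∃ κ' : (I →₀ ℕ) → M, symSum (s + 2) F = dK B.twist κ' ∧ κ' 0 = 0 := by
      refine ⟨κ - fun m => if m = 0 then κ 0 else 0, ?_, by simp⟩
      rw [dK_sub, hκ, eq_comm, sub_eq_self, dK]
      refine Finset.sum_eq_zero fun i _ => ?_
      have : (fun m : I →₀ ℕ => kAct B.twist i (if m = 0 then κ 0 else 0)) = 0 := by
        funext m
        split_ifs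
        · exact hκ0 i
        · exact map_zero _
      rw [this, map_zero]
    have hcur : ∀ l : List (Ext I), l.length = s + 2 →
        dBar (invR I) (coind B) (curryL F hF) l = -toCoind (invR I) B (F l) := by
      intro l hl
      match l, hl with
      | c :: l, hl => exact dBar_curryL B hinv hF fun x => hc _ (by simp at hl ⊢; omega)
    have hψ : dK (coind B) (symSum (s + 1) (curryL F hF))
        = fun m => -toCoind (invR I) B (symSum (s + 2) F m) := by
      rw [← symSum_dBar _ _ (multiLin_curryL F hF), symSum_congr _ hcur]
      exact symSum_map (-toCoind (invR I) B) _ _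
    -- The boundary of the substituted curried cochain is minus the embedded substitution of F;
    -- adding the embedded κ' corrects it to a Koszul cocycle.
    obtain ⟨μ, hμ⟩ := exists_dK_eq B
      (κ := symSum (s + 1) (curryL F hF) + fun m => toCoind (invR I) B (κ' m))
      (by
        rw [dK_add, hψ, dK_toCoind, ← hκ']
        funext m
        exact neg_add_cancel _)
      (by rw [Pi.add_apply, symSum_succ_apply_zero, hκ'0, map_zero, add_zero])
    -- In the quotient bimodule the embedded κ' disappears, so the curried cochain, one argument
    -- shorter, again satisfies both hypotheses, now with the image of μ.
    obtain ⟨G, hG, hFG⟩ := exists_dBar_eq (s + 1) (red (invR I) B)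
      (F := fun l => toRed (invR I) B (curryL F hF l)) ((multiLin_curryL F hF).comp _)
      (fun l hl => by
        rw [dBar_map (B := coind B) (toRed (invR I) B) (fun c m => (red_lam B c m).symm)
          (fun c m => (red_rho B c m).symm), hcur l hl, map_neg, toRed_toCoind, neg_zero])
      (κ := fun m => toRed (invR I) B (μ m))
      (by
        rw [dK_toRed, hμ, symSum_map]
        funext m
        rw [Pi.add_apply, map_add, toRed_toCoind, add_zero])
    exact exists_of_red B hinv hF hc hG hFG

/-! ### The Hochschild differential as a bar differential -/

section Link

variable (I : Type u) [Fintype I] [DecidableEq I]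

/-- The `p`-th power of the parity involution. -/
def tw (p : ZMod 2) : Ext I →+* Ext I := if p = 0 then RingHom.id _ else invR I

theorem tw_zero (x : Ext I) : tw I 0 x = x := rfl

theorem tw_one (x : Ext I) : tw I 1 x = inv I x := rfl

theorem tw_inv (p : ZMod 2) (x : Ext I) : tw I p (invR I x) = tw I (p + 1) x := by
  rcases zmodTwo_cases p with rfl | rfl
  · rfl
  · exact inv_inv_apply x

theorem sgn_smul_koszul (p : ZMod 2) (x : Ext I) :
    sgn p • koszul (extParity I) p x = tw I p x := by
  rcases zmodTwo_cases p with rfl | rfl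
  · rw [koszul_zero, sgn_zero, one_smul, tw_zero]
  · rw [koszul_one, sgn_one, tw_one, neg_smul, one_smul, neg_neg]

/-- The exterior algebra as a bimodule over itself, with the left action twisted by `p`. -/
def extBimod (p : ZMod 2) : Bimod (Ext I) (Ext I) where
  lam a := AddMonoidHom.mulLeft (tw I p a)
  rho a := AddMonoidHom.mulRight a
  lam_one m := by simp
  lam_mul a b m := by simp [mul_assoc]
  lam_add a b m := by simp [add_mul]
  rho_one m := by simp
  rho_mul a b m := by simp [mul_assoc]
  rho_add a b m := by simp [mul_add]
  lam_rho a b m := by simp [mul_assoc]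

theorem extBimod_lam (p : ZMod 2) (a m : Ext I) : (extBimod I p).lam a m = tw I p a * m := rfl

theorem extBimod_rho (p : ZMod 2) (a m : Ext I) : (extBimod I p).rho a m = m * a := rfl

theorem dBar_extBimod_twist (p : ZMod 2) (F : List (Ext I) → Ext I) (l : List (Ext I)) :
    dBar (invR I) (extBimod I p).twist F l = dBar (invR I) (extBimod I (p + 1)) F l :=
  (dBar_map (B := (extBimod I p).twist) (B' := extBimod I (p + 1)) (AddMonoidHom.id _)
    (fun c m => by
      change tw I p (invR I c) * m = tw I (p + 1) c * m
      rw [tw_inv]) (fun _ _ => rfl) F l).symm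

/-- The sum of cup product and brace is unfolded along the list: its first step multiplies the first
two arguments, and later steps pass over the first argument with its Koszul sign. -/
theorem bar_extBimod (p : ZMod 2) {F : List (Ext I) → Ext I} (hF : MultiLin F) (l : List (Ext I)) :
    bar (invR I) (extBimod I p).rho l F
      = cupL (koszul (extParity I) 1) F idL l + brace (koszul (extParity I) 1) F (mulL I) l := by
  have hz : ∀ r, F (0 :: r) = 0 := fun r => hF.map_zero [] r
  induction l generalizing F with
  | nil => simp [bar, cupL, splitSum, idL, brace_nil, mulL, hz]
  | cons a l ih =>
    cases l with
    | nil =>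
      have hz' : ∀ x, F [x, 0] = 0 := fun x => hF.map_zero [x] []
      simp [bar, cupL, splitSum, idL, brace, mulL, hz, hz', extBimod_rho]
    | cons b l =>
      have hk : koszul (extParity I) 1 a = -invR I a := koszul_one I a
      rw [bar, ih (hF.cons _) fun r => hF.map_zero [_] r,
        brace_cons (koszul (extParity I) 1) F (mulL I) a, hk]
      have h1 : splitSum (fun v r => F (mulL I v :: r)) (a :: b :: l) = F (invR I a * b :: l) := by
        simp only [splitSum, mulL, hz, zero_add]
        exact splitSum_left_nil _ l fun u v hu => by
          match u with
          | [] => exact absurd rfl hu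
          | _ :: _ => exact hz v
      have h2 : cupL (koszul (extParity I) 1) F idL (a :: b :: l)
          = cupL (koszul (extParity I) 1) (fun t => F (-invR I a :: t)) idL (b :: l) := by
        rw [cupL, splitSum]
        simp only [List.map_nil, idL, mul_zero, zero_add, List.map_cons, hk]
        rfl
      rw [h1, h2]
      abel

/-- The cup product with the identity on the left involves only the first argument; its Koszul
operator times (-1)^p is the twist of the left action. -/
theorem dL_eq_dBar (p : ZMod 2) {F : List (Ext I) → Ext I} (hF : MultiLin F) (l : List (Ext I)) :
    dL I p F l = dBar (invR I) (extBimod I p) F l := by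
  have hz : ∀ r, F (0 :: r) = 0 := fun r => hF.map_zero [] r
  match l with
  | [] => simp [dL, dBar, cupL, splitSum, idL, brace_nil, mulL, hz]
  | c :: l =>
    rw [dBar, bar_extBimod I p hF, dL, Pi.add_apply, Pi.sub_apply, Pi.smul_apply, extBimod_lam,
      ← sgn_smul_koszul]
    have h : cupL (koszul (extParity I) p) idL F (c :: l) = koszul (extParity I) p c * F l := by
      rw [cupL, splitSum]
      simp only [List.map_nil, idL, zero_mul, zero_add, List.map_cons]
      exact splitSum_left_nil _ l fun u v hu => by
        match u with
        | [] => exact absurd rfl hu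
        | _ :: _ => exact zero_mul _
    rw [h, smul_mul_assoc]
    abel

theorem ev_hochschildDiff_eq {y : GG I} {α : Cochain ℤ (Ext I)} (hα : α ∈ CCdeg I y)
    (l : List (Ext I)) : ev (hochschildDiff (extParity I) α) l
      = sgn (GG.parity I y) • dBar (invR I) (extBimod I (GG.parity I y)) (ev α) l := by
  rw [ev_hochschildDiff I hα, Pi.smul_apply, dL_eq_dBar I _ (multiLin_ev α)]

theorem parity_add_one (y : GG I) : GG.parity I (y + GG.ofInt I 1) = GG.parity I y + 1 := by
  rw [map_add, parity_ofInt, Int.cast_one]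

theorem dBar_zsmul {A M : Type*} [Ring A] [AddCommGroup M] (σ : A →+* A) (B : Bimod A M) (n : ℤ)
    (F : List A → M) (l : List A) : dBar σ B (fun t => n • F t) l = n • dBar σ B F l :=
  dBar_map (zsmulAddGroupHom n) (fun c m => (map_zsmul (B.lam c) n m).symm)
    (fun c m => (map_zsmul (B.rho c) n m).symm) F l

/-- The differential changes the parity of the cochain, which is exactly the change of twist needed
for two bar differentials to compose to zero. -/
theorem hochschildDiff_hochschildDiff {y : GG I} {α : Cochain ℤ (Ext I)} (hα : α ∈ CCdeg I y) :
    hochschildDiff (extParity I) (hochschildDiff (extParity I) α) = 0 := by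
  refine cochain_ext fun l => ?_
  rw [ev_hochschildDiff_eq I (hochschildDiff_mem I hα), parity_add_one,
    show ev (hochschildDiff (extParity I) α) = _ from funext (ev_hochschildDiff_eq I hα),
    dBar_zsmul]
  have h : dBar (invR I) (extBimod I (GG.parity I y + 1))
      (dBar (invR I) (extBimod I (GG.parity I y)) (ev α)) l = 0 :=
    dBar_dBar (σ := invR I) (B := extBimod I (GG.parity I y))
      (B' := extBimod I (GG.parity I y + 1)) inv_inv_apply
      (fun a m => by rw [extBimod_lam, extBimod_lam, tw_inv]) rfl (multiLin_ev α) l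
  rw [h, smul_zero, smul_zero, ev_zero]

/-! ### Homogeneous components of cochains -/

/-- The part of degree `e` of a function of lists. -/
def degL : GG I → (List (Ext I) → Ext I) → List (Ext I) → Ext I
  | e, F, [] => extProj I e (F [])
  | e, F, a :: l => ∑ d ∈ extDegrees I,
      degL (e + (d - GG.ofInt I 1)) (fun t => F (extProj I d a :: t)) l

theorem degL_add (e : GG I) (F G : List (Ext I) → Ext I) (l : List (Ext I)) :
    degL I e (fun t => F t + G t) l = degL I e F l + degL I e G l := by
  induction l generalizing e F G with
  | nil => simp [degL]
  | cons a l ih => simp only [degL, ih, Finset.sum_add_distrib]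

theorem degL_zero (e : GG I) (l : List (Ext I)) : degL I e (fun _ => 0) l = 0 := by
  have := degL_add I e (fun _ => 0) (fun _ => 0) l
  simpa using this

theorem multiLin_degL (e : GG I) {F : List (Ext I) → Ext I} (hF : MultiLin F) :
    MultiLin (degL I e F) := by
  refine .of_add fun l r a b => ?_
  induction l generalizing e F with
  | nil =>
    simp only [List.nil_append, degL, ← Finset.sum_add_distrib, ← degL_add]
    refine Finset.sum_congr rfl fun d _ => ?_
    congr 1
    funext t
    rw [map_add]
    exact hF.map_add [] t _ _
  | cons c l ih =>
    simp only [List.cons_append, degL, ← Finset.sum_add_distrib]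
    exact Finset.sum_congr rfl fun d _ => ih _ (hF.cons _)

/-- For homogeneous arguments only one degree contributes at each entry; if that degree is missing
from `extDegrees`, the entry is zero. -/
theorem degL_of_homog (e : GG I) {F : List (Ext I) → Ext I} (hF : MultiLin F)
    {L : List (GG I × Ext I)} (hL : Homog I L) :
    degL I e F (L.map Prod.snd) = extProj I (shiftDeg I L + e) (F (L.map Prod.snd)) := by
  classical
  induction L generalizing e F with
  | nil => simp [degL, shiftDeg_nil]
  | cons x L ih =>
    have hz : (fun t => F (0 :: t)) = fun _ => 0 := funext fun t => hF.map_zero [] t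
    have hx := hL x List.mem_cons_self
    rw [List.map_cons, degL, Finset.sum_eq_single x.1]
    · rw [extProj_of_mem I hx, if_pos rfl,
        ih _ (hF.cons _) fun z hz => hL z (List.mem_cons_of_mem _ hz), shiftDeg_cons]
      congr 2
      abel
    · intro d _ hd
      rw [extProj_of_mem I hx, if_neg hd.symm, hz, degL_zero]
    · intro hd
      have : x.2 = 0 := by
        by_contra h0
        exact hd (mem_extDegrees I hx h0)
      rw [this, map_zero, hz, degL_zero]

/-- The cochain with the given values. -/
def ofMultiLin (F : List (Ext I) → Ext I) (hF : MultiLin F) : Cochain ℤ (Ext I) :=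
  ofList F fun l r => ⟨hF.map_add l r, fun n a => hF.map_zsmul l r n a⟩

theorem ev_ofMultiLin (F : List (Ext I) → Ext I) (hF : MultiLin F) :
    ev (ofMultiLin I F hF) = F :=
  funext fun l => ev_ofList F _ l

/-- The part of degree `y` of a cochain. -/
def degProj (y : GG I) (α : Cochain ℤ (Ext I)) : Cochain ℤ (Ext I) :=
  ofMultiLin I (degL I y (ev α)) (multiLin_degL I y (multiLin_ev α))

theorem ev_degProj (y : GG I) (α : Cochain ℤ (Ext I)) : ev (degProj I y α) = degL I y (ev α) :=
  ev_ofMultiLin I _ _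

open Classical in
theorem degProj_of_mem {y z : GG I} {α : Cochain ℤ (Ext I)} (hα : α ∈ CCdeg I z) :
    degProj I y α = if z = y then α else 0 := by
  refine cochain_ext fun l => multiLin_ext I (multiLin_ev _) (multiLin_ev _) (fun L hL => ?_) l
  rw [ev_degProj, degL_of_homog I y (multiLin_ev α) hL,
    extProj_of_mem I ((mem_CCdeg_iff I).1 hα L hL)]
  simp only [add_right_inj]
  split_ifs <;> rfl

theorem degProj_add (y : GG I) (α β : Cochain ℤ (Ext I)) :
    degProj I y (α + β) = degProj I y α + degProj I y β := by
  refine cochain_ext fun l => ?_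
  rw [ev_add, ev_degProj, ev_degProj, ev_degProj, ← degL_add]
  rfl

theorem extProj_mul_right (e : GG I) {d : GG I} (x : Ext I) {c : Ext I} (hc : c ∈ extGr I d) :
    extProj I (e + d) (x * c) = extProj I e x * c := by
  classical
  rw [← sum_extProj I x, Finset.sum_mul, map_sum, map_sum, Finset.sum_mul]
  refine Finset.sum_congr rfl fun f _ => ?_
  rw [extProj_of_mem I (extGr_mul I (extProj_mem I f x) hc), extProj_of_mem I (extProj_mem I f x)]
  simp only [add_left_inj]
  split_ifs <;> simp

theorem extProj_mul_left (e : GG I) {d : GG I} (x : Ext I) {c : Ext I} (hc : c ∈ extGr I d) :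
    extProj I (e + d) (c * x) = c * extProj I e x := by
  classical
  rw [← sum_extProj I x, Finset.mul_sum, map_sum, map_sum, Finset.mul_sum]
  refine Finset.sum_congr rfl fun f _ => ?_
  rw [extProj_of_mem I (extGr_mul I hc (extProj_mem I f x)), extProj_of_mem I (extProj_mem I f x),
    add_comm d f]
  simp only [add_left_inj]
  split_ifs <;> simp

theorem tw_mem (p : ZMod 2) {d : GG I} {x : Ext I} (hx : x ∈ extGr I d) : tw I p x ∈ extGr I d := by
  rcases zmodTwo_cases p with rfl | rfl
  exacts [hx, inv_mem I hx]

/-- Multiplying adjacent arguments or acting on the right adds degrees. The shift by 1 arises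
because one argument fewer is counted in A[1]. -/
theorem bar_extProj (p : ZMod 2) (y : GG I) {F G : List (Ext I) → Ext I}
    (h : ∀ L, Homog I L → G (L.map Prod.snd) = extProj I (shiftDeg I L + y) (F (L.map Prod.snd)))
    {L : List (GG I × Ext I)} (hL : Homog I L) :
    bar (invR I) (extBimod I p).rho (L.map Prod.snd) G
      = extProj I (shiftDeg I L + (y + GG.ofInt I 1))
        (bar (invR I) (extBimod I p).rho (L.map Prod.snd) F) := by
  match L with
  | [] => simp [bar]
  | [c] =>
    have h0 := h [] (by simp [Homog])
    simp only [List.map_cons, List.map_nil, bar, extBimod_rho] at h0 ⊢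
    rw [h0, ← extProj_mul_right I _ _ (hL c List.mem_cons_self), shiftDeg_cons, shiftDeg_nil]
    congr 1
    congr 1
    abel
  | a :: b :: L =>
    have ha := hL a (by simp)
    have hb := hL b (by simp)
    have hL' : Homog I L := fun x hx => hL x (by simp [hx])
    have h1 := h ((a.1 + b.1, invR I a.2 * b.2) :: L) (fun x hx => by
      rcases List.mem_cons.1 hx with rfl | hx
      exacts [extGr_mul I (inv_mem I ha) hb, hL' x hx])
    have h2 := bar_extProj p (a.1 - GG.ofInt I 1 + y) (F := fun t => F (-invR I a.2 :: t))
      (G := fun t => G (-invR I a.2 :: t)) (fun L hL => by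
        have := h ((a.1, -invR I a.2) :: L) (fun x hx => by
          rcases List.mem_cons.1 hx with rfl | hx
          exacts [neg_mem (inv_mem I ha), hL x hx])
        rw [List.map_cons] at this
        rw [this, shiftDeg_cons]
        congr 2
        abel) (L := b :: L) (fun x hx => hL x (List.mem_cons_of_mem _ hx))
    simp only [List.map_cons, bar] at h1 h2 ⊢
    rw [h1, h2, map_add]
    simp only [shiftDeg_cons]
    congr 3 <;> abel

/-- Taking the homogeneous part commutes with the differential, so a primitive found without regard
to degrees may be replaced by a homogeneous one. -/
theorem dBar_degL (p : ZMod 2) (y : GG I) {F : List (Ext I) → Ext I} (hF : MultiLin F)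
    {L : List (GG I × Ext I)} (hL : Homog I L) :
    dBar (invR I) (extBimod I p) (degL I y F) (L.map Prod.snd)
      = extProj I (shiftDeg I L + (y + GG.ofInt I 1))
        (dBar (invR I) (extBimod I p) F (L.map Prod.snd)) := by
  match L with
  | [] => simp [dBar]
  | c :: L =>
    have h1 := bar_extProj I p y (fun L hL => degL_of_homog I y hF hL) hL
    rw [List.map_cons] at h1 ⊢
    rw [dBar, dBar, map_add, h1, map_neg, extBimod_lam, extBimod_lam,
      degL_of_homog I y hF fun x hx => hL x (List.mem_cons_of_mem _ hx),
      ← extProj_mul_left I _ _ (tw_mem I p (hL c List.mem_cons_self)), shiftDeg_cons]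
    congr 4
    abel

/-- Independence may be tested after an injective map T; the Qᵢ play the role of projections and
need not take values in M. -/
theorem iSupIndep_of_proj {ι M N : Type*} [AddCommGroup M] [AddCommGroup N]
    {S : ι → Submodule ℤ M} (T : M →+ N) (hT : ∀ x, T x = 0 → x = 0) (Q : ι → M →+ N)
    (h1 : ∀ i, ∀ x ∈ S i, Q i x = T x) (h2 : ∀ i j, i ≠ j → ∀ x ∈ S j, Q i x = 0) :
    iSupIndep S := by
  intro i
  rw [disjoint_iff_inf_le]
  rintro x ⟨hx, hx'⟩
  refine hT x ?_
  rw [← h1 i x hx]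
  refine Submodule.iSup_induction _ hx' (motive := fun x => Q i x = 0) (fun j x hx => ?_) (map_zero _)
    fun x y hx hy => by rw [map_add, hx, hy, add_zero]
  refine Submodule.iSup_induction _ hx (motive := fun x => Q i x = 0) (fun hj x hx => ?_)
    (map_zero _) fun x y hx hy => by rw [map_add, hx, hy, add_zero]
  exact h2 i j (Ne.symm hj) x hx

/-! ### Cocycles and coboundaries on the generators. -/

/-- A homogeneous cocycle that vanishes on the generators is a coboundary. -/
theorem exists_hochschildDiff_eq {y : GG I} {α : Cochain ℤ (Ext I)} (hα : α ∈ CCdeg I y)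
    (hδ : hochschildDiff (extParity I) α = 0) (h0 : ∀ s, symSum s (ev α) = 0) :
    ∃ β ∈ CCdeg I (y - GG.ofInt I 1), hochschildDiff (extParity I) β = α := by
  set p := GG.parity I y with hp
  have hc : ∀ l, dBar (invR I) (extBimod I p) (ev α) l = 0 := by
    intro l
    have h1 : ev (hochschildDiff (extParity I) α) l = 0 := by rw [hδ, ev_zero]
    rw [ev_hochschildDiff_eq I hα] at h1
    have h2 := congrArg (sgn p • ·) h1
    simpa only [smul_smul, sgn_mul_self, one_smul, smul_zero, ← hp] using h2
  -- Each length is solved separately, with zero as the Koszul primitive.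
  have hex : ∀ s, ∃ H : List (Ext I) → Ext I, MultiLin H ∧ ∀ l : List (Ext I), l.length = s →
      dBar (invR I) (extBimod I (p + 1)) H l = ev α l := by
    intro s
    obtain ⟨H, hH, hH'⟩ := exists_dBar_eq s (extBimod I p) (multiLin_ev α) (fun l _ => hc l)
      (κ := 0) (by rw [h0]; simp [dK, ← Pi.zero_def])
    exact ⟨H, hH, fun l hl => by rw [← dBar_extBimod_twist, hH' l hl]⟩
  choose H hH hH' using hex
  -- A primitive for length t + 1 is used on lists of length t, hence the index `l.length + 1`.
  have hβ : MultiLin fun l : List (Ext I) => H (l.length + 1) l := .of_add fun l r a b => by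
    simp only [List.length_append, List.length_cons, (hH _).map_add]
  have hd : ∀ l, dBar (invR I) (extBimod I (p + 1)) (fun l => H (l.length + 1) l) l = ev α l := by
    intro l
    rw [← hH' _ l rfl]
    exact dBar_congr _ fun t ht => by rw [ht]
  have hp' : GG.parity I (y - GG.ofInt I 1) = p + 1 := by
    rw [map_sub, parity_ofInt, Int.cast_one, sub_eq_add_neg]
    rfl
  -- The sign compensates the factor between the Hochschild and bar differentials for a primitive of
  -- parity p + 1.
  refine ⟨sgn (p + 1) • ofMultiLin I _ (multiLin_degL I (y - GG.ofInt I 1) hβ), ?_, ?_⟩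
  · refine Submodule.smul_mem _ _ ?_
    rw [mem_CCdeg_iff]
    intro L hL
    rw [ev_ofMultiLin, degL_of_homog I _ hβ hL]
    exact extProj_mem I _ _
  · have hm : ofMultiLin I _ (multiLin_degL I (y - GG.ofInt I 1) hβ)
        ∈ CCdeg I (y - GG.ofInt I 1) := by
      rw [mem_CCdeg_iff]
      intro L hL
      rw [ev_ofMultiLin, degL_of_homog I _ hβ hL]
      exact extProj_mem I _ _
    have hsm : hochschildDiff (extParity I)
        (sgn (p + 1) • ofMultiLin I _ (multiLin_degL I (y - GG.ofInt I 1) hβ))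
          = sgn (p + 1) • hochschildDiff (extParity I)
            (ofMultiLin I _ (multiLin_degL I (y - GG.ofInt I 1) hβ)) :=
      map_zsmul (hochschildDiffₗ (extParity I)) _ _
    classical
    refine cochain_ext fun l => multiLin_ext I (multiLin_ev _) (multiLin_ev _) (fun L hL => ?_) l
    rw [hsm, ev_zsmul, ev_hochschildDiff_eq I hm, hp', smul_smul, sgn_mul_self, one_smul,
      ev_ofMultiLin, dBar_degL I _ _ hβ hL, hd, sub_add_cancel,
      extProj_of_mem I ((mem_CCdeg_iff I).1 hα L hL), if_pos rfl]

/-- The restriction of a coboundary to the generators vanishes. -/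
theorem symSum_hochschildDiff {y : GG I} {β : Cochain ℤ (Ext I)} (hβ : β ∈ CCdeg I y) (s : ℕ) :
    symSum s (ev (hochschildDiff (extParity I) β)) = 0 := by
  rw [show ev (hochschildDiff (extParity I) β) = _ from funext (ev_hochschildDiff_eq I hβ)]
  refine (symSum_map (zsmulAddGroupHom (sgn (GG.parity I y)) : Ext I →+ Ext I) s _).trans ?_
  have key : symSum s (dBar (invR I) (extBimod I (GG.parity I y)) (ev β)) = 0 := by
    cases s with
    | zero =>
      funext m
      simp [symSum, dBar]
    | succ s =>
      rw [symSum_dBar _ s (multiLin_ev β)]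
      -- The coefficients of the substitution have the parity of the cochain, since generators are
      -- even in A[1]. Graded commutativity then kills the twisted commutator with each θᵢ.
      have hmem : ∀ (s : ℕ) (F : List (Ext I) → Ext I) (z : GG I),
          (∀ L, Homog I L → F (L.map Prod.snd) ∈ extGr I (shiftDeg I L + z)) → ∀ m i,
          kAct (extBimod I (GG.parity I z)) i (symSum s F m) = 0 := by
        intro s
        induction s with
        | zero =>
          intro F z hF m i
          simp only [symSum]
          split_ifs
          · have h0 := hF [] (by simp [Homog])
            rw [shiftDeg_nil, zero_add, List.map_nil] at h0
            have h1 := inv_of_mem I h0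
            rw [kAct_apply, extBimod_lam, extBimod_rho]
            rcases zmodTwo_cases (GG.parity I z) with hz | hz
            · rw [hz, sgn_zero, one_smul] at h1
              rw [hz, tw_zero, θ_mul, h1, sub_self]
            · rw [hz, sgn_one, neg_smul, one_smul] at h1
              rw [hz, tw_one, inv_θ, neg_mul, θ_mul, h1, neg_mul, neg_neg, sub_self]
          · exact map_zero _
        | succ s ih =>
          intro F z hF m i
          rw [symSum, Finset.sum_apply, map_sum]
          refine Finset.sum_eq_zero fun j _ => ?_
          rw [zMul_apply]
          split_ifs
          · exact map_zero _
          · have := ih (fun l => F (θ I j :: l)) (θdeg I j - GG.ofInt I 1 + z) (fun L hL => by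
              have := hF ((θdeg I j, θ I j) :: L) (fun x hx => by
                rcases List.mem_cons.1 hx with rfl | hx
                exacts [θ_mem I j, hL x hx])
              rw [shiftDeg_cons, List.map_cons] at this
              convert this using 2
              abel) (m - Finsupp.single j 1) i
            rwa [map_add, map_sub, parity_θdeg, parity_ofInt, Int.cast_one, sub_self,
              zero_add] at this
      rw [dK]
      refine Finset.sum_eq_zero fun i _ => ?_
      have : (fun m => kAct (extBimod I (GG.parity I y)) i (symSum s (ev β) m)) = 0 :=
        funext fun m => hmem s (ev β) y (fun L hL => (mem_CCdeg_iff I).1 hβ L hL) m i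
      rw [this, map_zero]
  rw [key]
  funext m
  exact map_zero _

end Link

/-! ### The algebra of polyvector fields -/

section Poly

variable (I : Type u) [Fintype I] [DecidableEq I]

/-- `z^m a`. -/
abbrev zmon (m : I →₀ ℕ) (a : Ext I) : PolyExt I := MvPolynomial.monomial m (1 : ℤ) ⊗ₜ[ℤ] a

/-- The variable `zᵢ`. -/
abbrev zvar (i : I) : PolyExt I := MvPolynomial.X i ⊗ₜ[ℤ] 1

theorem zmon_mul (m m' : I →₀ ℕ) (a a' : Ext I) :
    zmon I m a * zmon I m' a' = zmon I (m + m') (a * a') := by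
  rw [Algebra.TensorProduct.tmul_mul_tmul, MvPolynomial.monomial_mul, one_mul]

theorem zmon_add (m : I →₀ ℕ) (a b : Ext I) : zmon I m (a + b) = zmon I m a + zmon I m b :=
  TensorProduct.tmul_add _ _ _

theorem zvar_eq (i : I) : zvar I i = zmon I (Finsupp.single i 1) 1 := rfl

theorem polyExt_induction {P : PolyExt I → Prop} (h : ∀ m a, P (zmon I m a))
    (hadd : ∀ x y, P x → P y → P (x + y)) (x : PolyExt I) : P x := by
  have h0 : P 0 := by simpa using h 0 0
  induction x using TensorProduct.induction_on with
  | zero => exact h0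
  | add x y hx hy => exact hadd x y hx hy
  | tmul p a =>
    induction p using MvPolynomial.induction_on' with
    | monomial m c =>
      have : MvPolynomial.monomial m c ⊗ₜ[ℤ] a = zmon I m (c • a) := by
        rw [zmon, TensorProduct.tmul_smul, TensorProduct.smul_tmul', MvPolynomial.smul_monomial,
          smul_eq_mul, mul_one]
      rw [this]
      exact h _ _
    | add p q hp hq =>
      rw [TensorProduct.add_tmul]
      exact hadd _ _ hp hq

theorem zvar_comm (i : I) (x : PolyExt I) : zvar I i * x = x * zvar I i := by
  refine polyExt_induction I (P := fun x => zvar I i * x = x * zvar I i) (fun m a => ?_)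
    (fun x y hx hy => ?_) x
  · rw [zvar_eq, zmon_mul, zmon_mul, add_comm, one_mul, mul_one]
  · rw [mul_add, add_mul, hx, hy]

/-- The coefficients of an element of `ℤ[zᵢ, θᵢ]`. -/
def coeffs : PolyExt I →ₗ[ℤ] ((I →₀ ℕ) → Ext I) :=
  (Finsupp.lcoeFun).comp ((TensorProduct.congr (MvPolynomial.basisMonomials I ℤ).repr
    (LinearEquiv.refl ℤ (Ext I))).trans (TensorProduct.finsuppScalarLeft ℤ (Ext I) (I →₀ ℕ))).toLinearMap

theorem coeffs_injective : Function.Injective (coeffs I) := by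
  refine Function.Injective.comp (g := fun f : (I →₀ ℕ) →₀ Ext I => (f : (I →₀ ℕ) → Ext I))
    DFunLike.coe_injective (LinearEquiv.injective _)

theorem coeffs_zmon (m : I →₀ ℕ) (a : Ext I) (n : I →₀ ℕ) :
    coeffs I (zmon I m a) n = if n = m then a else 0 := by
  refine (TensorProduct.finsuppScalarLeft_apply_tmul_apply _ _ _).trans ?_
  change MvPolynomial.coeff n (MvPolynomial.monomial m 1) • a = _
  rw [MvPolynomial.coeff_monomial]
  split_ifs with h1 h2 h2 <;> simp_all

/-- Identifies multiplication in the polyvector algebra with the shift of families used in the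
Koszul complex. -/
theorem coeffs_zvar_mul (i : I) (x : PolyExt I) :
    coeffs I (zvar I i * x) = zMul i (coeffs I x) := by
  refine polyExt_induction I (P := fun x => coeffs I (zvar I i * x) = zMul i (coeffs I x))
    (fun m a => ?_) (fun x y hx hy => ?_) x
  · funext n
    rw [zvar_eq, zmon_mul, one_mul, coeffs_zmon, zMul_apply, coeffs_zmon]
    by_cases hn : n i = 0
    · rw [if_pos hn, if_neg]
      rintro rfl
      simp at hn
    · rw [if_neg hn]
      congr 1
      have : Finsupp.single i 1 ≤ n := by
        simpa [Finsupp.single_le_iff] using Nat.one_le_iff_ne_zero.2 hn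
      rw [eq_iff_iff, tsub_eq_iff_eq_add_of_le this, add_comm]
  · rw [mul_add, map_add, map_add, map_add, hx, hy]

/-- The degree of `z^m`. -/
def monoDeg : (I →₀ ℕ) →+ GG I × ℤ :=
  Finsupp.liftAddHom fun i => (multiplesHom (GG I × ℤ)) (zdeg I i, 1)

theorem monoDeg_single (i : I) : monoDeg I (Finsupp.single i 1) = (zdeg I i, 1) := by
  simp [monoDeg]

theorem sum_map_θdeg (l : List I) :
    (l.map fun i => ((θdeg I i, 0) : GG I × ℤ)).sum = ((l.map (θdeg I)).sum, 0) := by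
  induction l with
  | nil => rfl
  | cons i l ih => simp [ih]

theorem monoDeg_snd (m : I →₀ ℕ) : (monoDeg I m).2 = Finsupp.degree m := by
  have : (AddMonoidHom.snd (GG I) ℤ).comp (monoDeg I)
      = (Nat.castAddMonoidHom ℤ).comp Finsupp.degree := by
    refine Finsupp.addHom_ext' fun i => AddMonoidHom.ext_nat ?_
    change (monoDeg I (Finsupp.single i 1)).2 = ((Finsupp.degree (Finsupp.single i 1) : ℕ) : ℤ)
    rw [monoDeg_single]
    simp
  exact DFunLike.congr_fun this m

theorem parity_monoDeg (m : I →₀ ℕ) : GG.parity I (monoDeg I m).1 = 0 := by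
  have : (bigParity I).comp (monoDeg I) = 0 := by
    refine Finsupp.addHom_ext' fun i => AddMonoidHom.ext_nat ?_
    change GG.parity I (monoDeg I (Finsupp.single i 1)).1 = 0
    rw [monoDeg_single]
    exact parity_zdeg I i
  exact DFunLike.congr_fun this m

theorem zmon_mem {e : GG I} {a : Ext I} (ha : a ∈ extGr I e) (m : I →₀ ℕ) :
    zmon I m a ∈ polyExtGr I (monoDeg I m + (e, 0)) := by
  induction ha using Submodule.span_induction with
  | mem a ha =>
    obtain ⟨l, rfl, rfl⟩ := ha
    exact Submodule.subset_span ⟨m, l, by rw [sum_map_θdeg]; rfl, rfl⟩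
  | zero => rw [zmon, TensorProduct.tmul_zero]; exact zero_mem _
  | add a b _ _ iha ihb => rw [zmon_add]; exact add_mem iha ihb
  | smul c a _ iha => rw [zmon, TensorProduct.tmul_smul]; exact Submodule.smul_mem _ _ iha

/-- Integer coefficients are absorbed into the exterior factor, so scalar multiples need no separate
case. -/
theorem polyExtGr_induction {d : GG I × ℤ} {P : PolyExt I → Prop}
    (h : ∀ m e a, a ∈ extGr I e → monoDeg I m + (e, 0) = d → P (zmon I m a)) (h0 : P 0)
    (hadd : ∀ x y, P x → P y → P (x + y)) {x : PolyExt I} (hx : x ∈ polyExtGr I d) : P x := by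
  have hsmul : ∀ m e a (c : ℤ), a ∈ extGr I e → monoDeg I m + (e, 0) = d →
      P (c • zmon I m a) := fun m e a c ha he => by
    rw [zmon, ← TensorProduct.tmul_smul]
    exact h m e _ (Submodule.smul_mem _ _ ha) he
  induction hx using Submodule.closure_induction with
  | zero => exact h0
  | add x y _ _ ihx ihy => exact hadd x y ihx ihy
  | smul_mem c x hx =>
    obtain ⟨m, l, hd, rfl⟩ := hx
    refine hsmul m _ _ c (θprod_mem I l) ?_
    rw [← hd, sum_map_θdeg]
    rfl

theorem polyExtGr_mul {c d : GG I × ℤ} {x y : PolyExt I} (hx : x ∈ polyExtGr I c)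
    (hy : y ∈ polyExtGr I d) : x * y ∈ polyExtGr I (c + d) := by
  refine polyExtGr_induction I (P := fun x => x * y ∈ polyExtGr I (c + d))
    (fun m e a ha hc => ?_) (by rw [zero_mul]; exact zero_mem _)
    (fun x x' h h' => by rw [add_mul]; exact add_mem h h') hx
  refine polyExtGr_induction I (P := fun y => zmon I m a * y ∈ polyExtGr I (c + d))
    (fun m' e' a' ha' hd => ?_) (by rw [mul_zero]; exact zero_mem _)
    (fun x x' h h' => by rw [mul_add]; exact add_mem h h') hy
  rw [zmon_mul]
  have := zmon_mem I (extGr_mul I ha ha') (m + m')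
  convert this using 1
  rw [← hc, ← hd, map_add, show ((e + e', 0) : GG I × ℤ) = (e, 0) + (e', 0) by simp]
  abel_nf

theorem one_mem_polyExtGr : (1 : PolyExt I) ∈ polyExtGr I 0 := by
  have := zmon_mem I (extGr_zero_one I) 0
  rwa [map_zero, zero_add] at this

theorem iSup_polyExtGr : ⨆ d, polyExtGr I d = ⊤ := by
  rw [eq_top_iff]
  rintro x -
  refine polyExt_induction I (fun m a => ?_) (fun x y hx hy => add_mem hx hy) x
  rw [← sum_extProj I a, zmon, TensorProduct.tmul_sum]
  exact sum_mem fun e _ => Submodule.mem_iSup_of_mem _ (zmon_mem I (extProj_mem I e a) m)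

theorem iSupIndep_polyExtGr : iSupIndep (polyExtGr I) := by
  classical
  -- The coefficient at z^n of an element of degree d has exterior degree d minus that of z^n;
  -- projecting every coefficient in this way selects degree d.
  have key : ∀ (d d' : GG I × ℤ) (x : PolyExt I), x ∈ polyExtGr I d' → ∀ n : I →₀ ℕ,
      (if (monoDeg I n).2 = d.2 then extProj I (d.1 - (monoDeg I n).1) (coeffs I x n) else 0)
        = if d = d' then coeffs I x n else 0 := by
    intro d d' x hx n
    refine polyExtGr_induction I (P := fun x => (if (monoDeg I n).2 = d.2 then
        extProj I (d.1 - (monoDeg I n).1) (coeffs I x n) else 0)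
          = if d = d' then coeffs I x n else 0)
      (fun m e a ha hd => ?_) (by simp) (fun x y hx hy => ?_) hx
    · rw [coeffs_zmon]
      by_cases hn : n = m
      · subst hn
        rw [if_pos rfl, extProj_of_mem I ha, ← ite_and]
        congr 1
        rw [eq_iff_iff, ← hd, Prod.ext_iff]
        simp only [Prod.fst_add, Prod.snd_add, add_zero]
        constructor
        · rintro ⟨h1, h2⟩
          exact ⟨by rw [h2]; abel, h1.symm⟩
        · rintro ⟨h1, h2⟩
          exact ⟨h2.symm, by rw [h1]; abel⟩
      · simp [hn]
    · rw [map_add, Pi.add_apply]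
      split_ifs at hx hy ⊢ <;> simp_all
  refine iSupIndep_of_proj (coeffs I).toAddMonoidHom
    (fun x hx => coeffs_injective I (hx.trans (map_zero (coeffs I)).symm))
    (fun d => AddMonoidHom.mk' (fun x n => if (monoDeg I n).2 = d.2 then
      extProj I (d.1 - (monoDeg I n).1) (coeffs I x n) else 0) fun x y => ?_)
    (fun d x hx => ?_) fun d d' hd x hx => ?_
  · funext n
    simp only [map_add, Pi.add_apply]
    split_ifs <;> simp
  · funext n
    exact (key d d x hx n).trans (if_pos rfl)
  · funext n
    exact (key d d' x hx n).trans (if_neg hd)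

theorem isInternal_polyExtGr : DirectSum.IsInternal (polyExtGr I) :=
  DirectSum.isInternal_submodule_of_iSupIndep_of_iSup_eq_top (iSupIndep_polyExtGr I)
    (iSup_polyExtGr I)

end Poly

/-! ### The HKR map -/

section HKRMap

variable (I : Type u) [Fintype I] [DecidableEq I]

/-- `F(𝐳, …, 𝐳)` for a function of lists, of length `s`. -/
def polySum : ℕ → (List (Ext I) → Ext I) → PolyExt I
  | 0, F => 1 ⊗ₜ[ℤ] F []
  | s + 1, F => ∑ i, zvar I i * polySum s fun l => F (θ I i :: l)

/-- Links Ξ, which has polynomial values, with the families of coefficients for which the Koszul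
argument is made. -/
theorem coeffs_polySum (s : ℕ) (F : List (Ext I) → Ext I) :
    coeffs I (polySum I s F) = symSum s F := by
  induction s generalizing F with
  | zero =>
    funext m
    exact coeffs_zmon I 0 (F []) m
  | succ s ih => simp only [polySum, symSum, map_sum, coeffs_zvar_mul, ih]

theorem polySum_eq (s : ℕ) (F : List (Ext I) → Ext I) :
    polySum I s F = ∑ f : Fin s → I, (∏ k, MvPolynomial.X (f k)) ⊗ₜ[ℤ]
      F (List.ofFn fun k => θ I (f k)) := by
  induction s generalizing F with
  | zero => simp [polySum]
  | succ s ih =>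
    rw [← (Fin.consEquiv fun _ => I).sum_comp, Fintype.sum_prod_type, polySum]
    refine Finset.sum_congr rfl fun i _ => ?_
    rw [ih, Finset.mul_sum]
    refine Finset.sum_congr rfl fun f _ => ?_
    rw [Algebra.TensorProduct.tmul_mul_tmul, one_mul, Fin.prod_univ_succ, List.ofFn_succ]
    rfl

theorem evalz_eq (α : Cochain ℤ (Ext I)) (s : ℕ) : evalz I α s = polySum I s (ev α) := by
  rw [polySum_eq, evalz]
  exact Finset.sum_congr rfl fun f _ => by rw [apply_eq_ev]

theorem coeffs_evalz (α : Cochain ℤ (Ext I)) (s : ℕ) :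
    coeffs I (evalz I α s) = symSum s (ev α) := by rw [evalz_eq, coeffs_polySum]

theorem symSum_apply_of_ne {M : Type*} [AddCommGroup M] (s : ℕ) (F : List (Ext I) → M)
    {m : I →₀ ℕ} (hm : Finsupp.degree m ≠ s) : symSum s F m = 0 := by
  induction s generalizing F m with
  | zero =>
    refine if_neg ?_
    rintro rfl
    simp at hm
  | succ s ih =>
    rw [symSum, Finset.sum_apply]
    refine Finset.sum_eq_zero fun i _ => ?_
    rw [zMul_apply]
    split_ifs with hi
    · rfl
    · refine ih _ fun h => hm ?_
      have hle : Finsupp.single i 1 ≤ m := by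
        simpa [Finsupp.single_le_iff] using Nat.one_le_iff_ne_zero.2 hi
      rw [← tsub_add_cancel_of_le hle, map_add, h]
      simp

/-- The degree of θᵢ in A[1] cancels that of zᵢ, so 𝐳 has shifted degree zero in the first
component. This is why Ξ preserves degrees. -/
theorem θdeg_eq (i : I) : θdeg I i - GG.ofInt I 1 = -zdeg I i := by
  rw [sub_eq_iff_eq_add, neg_add_eq_sub, eq_sub_iff_add_eq]
  change (QuotientAddGroup.mk (((-1, Pi.single i 1) : ℤ × (I → ℤ)) + (2, -Pi.single i 1)) : GG I)
    = QuotientAddGroup.mk (1, 0)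
  congr 1
  simp

theorem polySum_mem (s : ℕ) {F : List (Ext I) → Ext I} {y : GG I}
    (hF : ∀ L, Homog I L → F (L.map Prod.snd) ∈ extGr I (shiftDeg I L + y)) :
    polySum I s F ∈ polyExtGr I (y, s) := by
  induction s generalizing F y with
  | zero =>
    have h0 := hF [] (by simp [Homog])
    rw [shiftDeg_nil, zero_add] at h0
    have := zmon_mem I h0 0
    rwa [map_zero, zero_add] at this
  | succ s ih =>
    refine sum_mem fun i _ => ?_
    have h1 := ih (F := fun l => F (θ I i :: l)) (y := y - zdeg I i) fun L hL => by
      have := hF ((θdeg I i, θ I i) :: L) (fun x hx => by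
        rcases List.mem_cons.1 hx with rfl | hx
        exacts [θ_mem I i, hL x hx])
      rw [shiftDeg_cons, List.map_cons] at this
      convert this using 2
      rw [θdeg_eq]
      abel
    have h2 := polyExtGr_mul I (zmon_mem I (extGr_zero_one I) (Finsupp.single i 1)) h1
    rw [monoDeg_single] at h2
    refine Eq.mp (congrArg (fun d => zvar I i * _ ∈ polyExtGr I d) ?_) h2
    ext <;> simp [add_comm]

theorem evalz_mem {y : GG I} {α : Cochain ℤ (Ext I)} (hα : α ∈ CCdeg I y) (s : ℕ) :
    evalz I α s ∈ polyExtGr I (y, s) := by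
  rw [evalz_eq]
  exact polySum_mem I s fun L hL => (mem_CCdeg_iff I).1 hα L hL

/-- A homomorphism that detects lengths. -/
def lengthHom : GG I →+ ℤ :=
  QuotientAddGroup.lift _
    (AddMonoidHom.mk' (fun x : ℤ × (I → ℤ) => (Fintype.card I : ℤ) * x.1
      - 2 * (1 - (Fintype.card I : ℤ)) * ∑ i, x.2 i) fun x y => by
        simp only [Prod.fst_add, Prod.snd_add, Pi.add_apply, Finset.sum_add_distrib]
        ring) (by
    rw [AddSubgroup.zmultiples_le, AddMonoidHom.mem_ker]
    simp only [AddMonoidHom.mk'_apply, Finset.sum_const, Finset.card_univ, nsmul_eq_mul, mul_one]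
    ring)

theorem lengthHom_zdeg (i : I) : lengthHom I (zdeg I i) = 2 := by
  change (Fintype.card I : ℤ) * 2
    - 2 * (1 - (Fintype.card I : ℤ)) * ∑ j, (-Pi.single i 1 : I → ℤ) j = 2
  simp only [Pi.neg_apply, Finset.sum_neg_distrib, Finset.sum_pi_single', Finset.mem_univ, if_true]
  ring

theorem evalz_finite_of_mem {y : GG I} {α : Cochain ℤ (Ext I)} (hα : α ∈ CCdeg I y) :
    {s : ℕ | evalz I α s ≠ 0}.Finite := by
  -- Every zᵢ has image 2 under `lengthHom`, so a nonzero part of length s forces an exterior degree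
  -- with image lowered by 2s.
  have h : ∀ s, evalz I α s ≠ 0 → ∃ d ∈ extDegrees I, lengthHom I d = lengthHom I y - 2 * s := by
    intro s hs
    by_contra! hd
    refine hs ?_
    rw [evalz_eq]
    have : ∀ (s : ℕ) (F : List (Ext I) → Ext I) (z : GG I),
        (∀ L, Homog I L → F (L.map Prod.snd) ∈ extGr I (shiftDeg I L + z)) →
        (∀ d ∈ extDegrees I, lengthHom I d ≠ lengthHom I z - 2 * s) → polySum I s F = 0 := by
      intro s
      induction s with
      | zero =>
        intro F z hF hd
        have h0 := hF [] (by simp [Homog])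
        rw [shiftDeg_nil, zero_add, List.map_nil] at h0
        have : F [] = 0 := by
          by_contra hne
          exact hd z (mem_extDegrees I h0 hne) (by simp)
        rw [polySum, this, TensorProduct.tmul_zero]
      | succ s ih =>
        intro F z hF hd
        refine Finset.sum_eq_zero fun i _ => ?_
        rw [ih _ (z - zdeg I i) (fun L hL => ?_) fun d hd' => ?_, mul_zero]
        · have := hF ((θdeg I i, θ I i) :: L) (fun x hx => by
            rcases List.mem_cons.1 hx with rfl | hx
            exacts [θ_mem I i, hL x hx])
          rw [shiftDeg_cons, List.map_cons] at this
          convert this using 2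
          rw [θdeg_eq]
          abel
        · have := hd d hd'
          rw [map_sub, lengthHom_zdeg]
          push_cast at this
          intro h
          exact this (by rw [h]; ring)
    exact this s _ y (fun L hL => (mem_CCdeg_iff I).1 hα L hL) hd
  -- There are finitely many exterior degrees, and each determines s.
  refine Set.Finite.subset (Set.Finite.biUnion (extDegrees I).finite_toSet
    (t := fun d => {s : ℕ | lengthHom I d = lengthHom I y - 2 * s}) fun d _ => ?_) fun s hs => ?_
  · refine Set.Subsingleton.finite fun s hs t ht => ?_
    simp only [Set.mem_ofPred_eq] at hs ht
    omega
  · obtain ⟨d, hd, hd'⟩ := h s hs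
    exact Set.mem_biUnion hd hd'

theorem evalz_add (α β : Cochain ℤ (Ext I)) (s : ℕ) :
    evalz I (α + β) s = evalz I α s + evalz I β s := by
  simp only [evalz, Pi.add_apply, add_apply, TensorProduct.tmul_add,
    Finset.sum_add_distrib]

theorem evalz_zero (s : ℕ) : evalz I 0 s = 0 := by simp [evalz]

theorem evalz_smul (n : ℤ) (α : Cochain ℤ (Ext I)) (s : ℕ) :
    evalz I (n • α) s = n • evalz I α s := by
  simp only [evalz, Pi.smul_apply, smul_apply, TensorProduct.tmul_smul,
    Finset.smul_sum]

theorem evalz_finite {α : Cochain ℤ (Ext I)} (hα : α ∈ CC I) :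
    {s : ℕ | evalz I α s ≠ 0}.Finite := by
  refine Submodule.iSup_induction (CCdeg I) hα (motive := fun α => {s : ℕ | evalz I α s ≠ 0}.Finite)
    (fun y α h => evalz_finite_of_mem I h) (by simp [evalz_zero]) fun α β h h' => ?_
  refine (h.union h').subset fun s hs => ?_
  by_contra hn
  simp only [Set.mem_union, Set.mem_ofPred_eq, not_or, not_not] at hn
  exact hs (by rw [evalz_add, hn.1, hn.2, add_zero])

theorem Xi_add {α β : Cochain ℤ (Ext I)} (hα : α ∈ CC I) (hβ : β ∈ CC I) :
    Xi I (α + β) = Xi I α + Xi I β := by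
  simp only [Xi, evalz_add]
  exact finsum_add_distrib (evalz_finite I hα) (evalz_finite I hβ)

/-- The HKR map as a linear map. -/
def XiHom : CC I →ₗ[ℤ] PolyExt I :=
  (AddMonoidHom.mk' (fun α : CC I => Xi I α.1) fun α β => Xi_add I α.2 β.2).toIntLinearMap

/-- Only the part of length equal to the degree of the monomial contributes, so Ξ remembers all
lengths separately. -/
theorem coeffs_Xi {α : Cochain ℤ (Ext I)} (hα : α ∈ CC I) (m : I →₀ ℕ) :
    coeffs I (Xi I α) m = symSum (Finsupp.degree m) (ev α) m := by
  have h : Xi I α = ∑ s ∈ insert (Finsupp.degree m) (evalz_finite I hα).toFinset, evalz I α s :=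
    finsum_eq_sum_of_support_subset _ fun s hs => by
      simp only [Finset.coe_insert, Set.Finite.coe_toFinset]
      exact Or.inr hs
  rw [h, map_sum, Finset.sum_apply, Finset.sum_eq_single (Finsupp.degree m)]
  · rw [coeffs_evalz]
  · intro s _ hs
    rw [coeffs_evalz, symSum_apply_of_ne I s _ hs.symm]
  · intro h
    exact absurd (Finset.mem_insert_self _ _) h

theorem Xi_eq_evalz {α : Cochain ℤ (Ext I)} (s : ℕ) (h : ∀ t, t ≠ s → α t = 0) :
    Xi I α = evalz I α s :=
  finsum_eq_single _ s fun t ht => by simp [evalz, h t ht]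

theorem mem_CCbideg_iff {d : GG I × ℤ} {α : Cochain ℤ (Ext I)} :
    α ∈ CCbideg I d ↔ α ∈ CCdeg I d.1 ∧ ∀ s : ℕ, (s : ℤ) ≠ d.2 → α s = 0 := by
  simp [CCbideg, Submodule.mem_inf, Submodule.mem_pi]

theorem Xi_mem {d : GG I × ℤ} {α : Cochain ℤ (Ext I)} (hα : α ∈ CCbideg I d) :
    Xi I α ∈ polyExtGr I d := by
  obtain ⟨h1, h2⟩ := (mem_CCbideg_iff I).1 hα
  by_cases hd : 0 ≤ d.2
  · obtain ⟨s, hs⟩ := Int.eq_ofNat_of_zero_le hd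
    rw [Xi_eq_evalz I s fun t ht => h2 t (by rw [hs]; exact_mod_cast ht)]
    have := evalz_mem I h1 s
    rwa [← hs] at this
  · have : α = 0 := funext fun s => h2 s (by omega)
    rw [this, Xi_eq_evalz I (α := 0) 0 fun t _ => rfl, evalz_zero]
    exact zero_mem _

end HKRMap

/-! ### Standard cocycles -/

section Std

variable (I : Type u) [Fintype I] [DecidableEq I]

theorem CCdeg_le_CC (y : GG I) : CCdeg I y ≤ CC I := le_iSup (CCdeg I) y

theorem hochschildDiff_add (α β : Cochain ℤ (Ext I)) : hochschildDiff (extParity I) (α + β)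
    = hochschildDiff (extParity I) α + hochschildDiff (extParity I) β :=
  map_add (hochschildDiffₗ (extParity I)) α β

theorem hochschildDiff_zero : hochschildDiff (extParity I) (0 : Cochain ℤ (Ext I)) = 0 :=
  map_zero (hochschildDiffₗ (extParity I))

theorem hochschildDiff_sub (α β : Cochain ℤ (Ext I)) : hochschildDiff (extParity I) (α - β)
    = hochschildDiff (extParity I) α - hochschildDiff (extParity I) β :=
  map_sub (hochschildDiffₗ (extParity I)) α β

theorem cup_zero_left (β : Cochain ℤ (Ext I)) : cup (extParity I) 0 β = 0 := by
  have := cup_add_left (extParity I) 0 0 β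
  simpa using this

theorem cup_zero_right (α : Cochain ℤ (Ext I)) : cup (extParity I) α 0 = 0 := by
  have := cup_add_right (extParity I) α 0 0
  simpa using this

/-- For homogeneous a, graded commutativity identifies the twisted left action with the right
action; hence constants are cocycles. -/
theorem tw_mul {e : GG I} {a : Ext I} (ha : a ∈ extGr I e) (c : Ext I) :
    tw I (GG.parity I e) c * a = a * c := by
  rw [← sum_extProj I c, map_sum, Finset.sum_mul, Finset.mul_sum]
  refine Finset.sum_congr rfl fun d _ => ?_
  rw [extGr_mul_comm I ha (extProj_mem I d c)]
  rcases zmodTwo_cases (GG.parity I e) with h | h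
  · rw [h, tw_zero, zero_mul, sgn_zero, one_smul]
  · rw [h, tw_one, inv_of_mem I (extProj_mem I d c), one_mul, smul_mul_assoc]

theorem dBar_eq_zero_of_length {A M : Type*} [Ring A] [AddCommGroup M] (σ : A →+* A)
    (B : Bimod A M) {F : List A → M} {l : List A}
    (h : ∀ t : List A, t.length + 1 = l.length → F t = 0) : dBar σ B F l = 0 := by
  rw [dBar_congr B (G := fun _ => 0) h]
  match l with
  | [] => rfl
  | c :: l => rw [dBar, map_zero, bar_zero, neg_zero, add_zero]

/-- The cochain of length 0 with the given value. -/
def constCochain (a : Ext I) : Cochain ℤ (Ext I) :=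
  Pi.single 0 (MultilinearMap.constOfIsEmpty ℤ _ a)

theorem ev_constCochain_nil (a : Ext I) : ev (constCochain I a) [] = a := rfl

theorem ev_constCochain_cons (a c : Ext I) (l : List (Ext I)) :
    ev (constCochain I a) (c :: l) = 0 := by
  have : constCochain I a (c :: l).length = 0 := Pi.single_eq_of_ne (by simp) _
  rw [ev, this]
  rfl

theorem constCochain_add (a b : Ext I) :
    constCochain I (a + b) = constCochain I a + constCochain I b := by
  refine cochain_ext fun l => ?_
  cases l with
  | nil => rfl
  | cons c l => rw [ev_add, ev_constCochain_cons, ev_constCochain_cons, ev_constCochain_cons, add_zero]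

theorem constCochain_mem {e : GG I} {a : Ext I} (ha : a ∈ extGr I e) :
    constCochain I a ∈ CCdeg I e := by
  rw [mem_CCdeg_iff]
  intro L hL
  match L with
  | [] => rwa [List.map_nil, ev_constCochain_nil, shiftDeg_nil, zero_add]
  | x :: L => rw [List.map_cons, ev_constCochain_cons]; exact zero_mem _

theorem hochschildDiff_constCochain {e : GG I} {a : Ext I} (ha : a ∈ extGr I e) :
    hochschildDiff (extParity I) (constCochain I a) = 0 := by
  refine cochain_ext fun l => ?_
  rw [ev_hochschildDiff_eq I (constCochain_mem I ha), ev_zero]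
  match l with
  | [] => exact smul_zero _
  | [c] =>
    rw [dBar, bar, ev_constCochain_nil, extBimod_lam, extBimod_rho, tw_mul I ha, neg_add_cancel,
      smul_zero]
  | c :: d :: l =>
    rw [dBar_eq_zero_of_length, smul_zero]
    intro t ht
    match t, ht with
    | x :: t, _ => exact ev_constCochain_cons I a x t

/-- The values of the derivation `∂/∂θᵢ`. -/
def derL (i : I) : List (Ext I) → Ext I
  | [c] => dleft I i c
  | _ => 0

theorem multiLin_derL (i : I) : MultiLin (derL I i) := by
  refine .of_add fun l r a b => ?_
  match l, r with
  | [], [] => exact map_add (dleft I i) a b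
  | [], x :: r => exact (add_zero 0).symm
  | [x], r => exact (add_zero 0).symm
  | x :: y :: l, r => exact (add_zero 0).symm

/-- The derivation `∂/∂θᵢ` as a cochain of length 1. -/
def derCochain (i : I) : Cochain ℤ (Ext I) := ofMultiLin I (derL I i) (multiLin_derL I i)

theorem ev_derCochain (i : I) : ev (derCochain I i) = derL I i := ev_ofMultiLin I _ _

theorem derCochain_mem (i : I) : derCochain I i ∈ CCdeg I (zdeg I i) := by
  rw [mem_CCdeg_iff]
  intro L hL
  rw [ev_derCochain]
  match L with
  | [] => exact zero_mem _
  | [x] =>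
    have := dleft_mem I i (hL x List.mem_cons_self)
    have e : shiftDeg I [x] + zdeg I i = x.1 - θdeg I i := by
      rw [shiftDeg_cons, shiftDeg_nil, ← neg_neg (zdeg I i), ← θdeg_eq]
      abel
    rw [e]
    exact this
  | x :: y :: L => exact zero_mem _

/-- In length 2 this is the graded Leibniz rule for ∂/∂θᵢ; no other length contributes. -/
theorem hochschildDiff_derCochain (i : I) :
    hochschildDiff (extParity I) (derCochain I i) = 0 := by
  refine cochain_ext fun l => ?_
  rw [ev_hochschildDiff_eq I (derCochain_mem I i), ev_zero, ev_derCochain, parity_zdeg]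
  match l with
  | [] => exact smul_zero _
  | [c] => simp [dBar, bar, derL]
  | [a, b] =>
    have h1 : derL I i [invR I a * b] = dleft I i (invR I a) * b + a * dleft I i b := by
      refine (dleft_mul I i (invR I a) b).trans ?_
      rw [show inv I (invR I a) = a from inv_inv_apply a]
    have h2 : derL I i [-invR I a] = -dleft I i (invR I a) := map_neg (dleft I i) _
    rw [dBar, bar, bar, h1, h2, extBimod_lam, extBimod_rho, tw_zero]
    simp only [derL]
    rw [neg_mul, add_neg_cancel_comm, neg_add_cancel, smul_zero]
  | a :: b :: c :: l =>
    rw [dBar_eq_zero_of_length, smul_zero]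
    intro t ht
    match t, ht with
    | x :: y :: t, _ => rfl

/-! ### Cup products of the derivations ∂/∂θᵢ. -/

/-- The monomial `z_{i₁} ⋯ z_{iₖ}` for a list `[i₁, …, iₖ]`. -/
def listMon (l : List I) : I →₀ ℕ := (l.map fun i => Finsupp.single i 1).sum

/-- The variables of a monomial, as a list. -/
def monList (m : I →₀ ℕ) : List I := (Finsupp.toMultiset m).toList

theorem listMon_cons (i : I) (l : List I) :
    listMon I (i :: l) = Finsupp.single i 1 + listMon I l := by simp [listMon]

theorem listMon_monList (m : I →₀ ℕ) : listMon I (monList I m) = m := by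
  have h : ∀ l : List I, Finsupp.toMultiset (listMon I l) = (l : Multiset I) := by
    intro l
    induction l with
    | nil => simp [listMon]
    | cons i l ih => rw [listMon_cons, map_add, ih, Finsupp.toMultiset_single]; simp
  rw [← Finsupp.toMultiset_toFinsupp (listMon I _), h, monList, Multiset.coe_toList,
    Finsupp.toMultiset_toFinsupp]

/-- The cup product of the derivations `∂/∂θ_{i₁}, …, ∂/∂θ_{iₖ}`. -/
def derProd : List I → Cochain ℤ (Ext I)
  | [] => constCochain I 1
  | i :: l => cup (extParity I) (derCochain I i) (derProd l)

theorem derProd_mem (l : List I) : derProd I l ∈ CCdeg I (monoDeg I (listMon I l)).1 := by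
  induction l with
  | nil =>
    rw [show listMon I [] = 0 from rfl, map_zero]
    exact constCochain_mem I (extGr_zero_one I)
  | cons i l ih =>
    rw [listMon_cons, map_add, monoDeg_single]
    exact cup_mem I (derCochain_mem I i) ih

theorem hochschildDiff_derProd (l : List I) :
    hochschildDiff (extParity I) (derProd I l) = 0 := by
  induction l with
  | nil => exact hochschildDiff_constCochain I (extGr_zero_one I)
  | cons i l ih =>
    rw [derProd, hochschildDiff_cup I (derCochain_mem I i) (derProd_mem I l),
      hochschildDiff_derCochain, ih, cup_zero_left, cup_zero_right, smul_zero, add_zero]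

/-- The standard cocycle `a ∂/∂θ_{i₁} ∪ ⋯ ∪ ∂/∂θ_{iₖ}`. -/
def std (a : Ext I) (l : List I) : Cochain ℤ (Ext I) :=
  cup (extParity I) (constCochain I a) (derProd I l)

/-- The values of the cup product of derivations. -/
def derProdL : List I → List (Ext I) → Ext I
  | [], [] => 1
  | [], _ :: _ => 0
  | _ :: _, [] => 0
  | i :: l, c :: cs => dleft I i c * derProdL l cs

/-- The derivations ∂/∂θᵢ and their products are even, so no sign operators appear in the standard
cocycles. -/
theorem ev_cup_of_even (α : Cochain ℤ (Ext I)) {y : GG I} {β : Cochain ℤ (Ext I)}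
    (hβ : β ∈ CCdeg I y) (hy : GG.parity I y = 0) :
    ev (cup (extParity I) α β) = cupL id (ev α) (ev β) := by
  rw [cup_of_mem I α hβ, ev_cupHom, hy]
  congr 1

theorem ev_derProd (l : List I) : ev (derProd I l) = derProdL I l := by
  induction l with
  | nil =>
    funext cs
    cases cs with
    | nil => rfl
    | cons c cs => exact ev_constCochain_cons I 1 c cs
  | cons i l ih =>
    rw [derProd, ev_cup_of_even I _ (derProd_mem I l) (parity_monoDeg I _), ev_derCochain, ih]
    funext cs
    cases cs with
    | nil => simp [cupL, splitSum, derL, derProdL]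
    | cons c cs =>
      rw [cupL, splitSum, splitSum_left_nil]
      · simp [derL, derProdL]
      · intro u v hu
        match u with
        | [] => exact absurd rfl hu
        | _ :: _ => exact zero_mul _

theorem ev_std (a : Ext I) (l : List I) : ev (std I a l) = fun cs => a * derProdL I l cs := by
  rw [std, ev_cup_of_even I _ (derProd_mem I l) (parity_monoDeg I _), ev_derProd]
  funext cs
  refine splitSum_left_nil _ _ fun u v hu => ?_
  · match u with
    | [] => exact absurd rfl hu
    | x :: u => rw [List.map_id, ev_constCochain_cons, zero_mul]

theorem derProdL_eq_zero {l : List I} {cs : List (Ext I)} (h : cs.length ≠ l.length) :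
    derProdL I l cs = 0 := by
  induction l generalizing cs with
  | nil =>
    cases cs with
    | nil => exact absurd rfl h
    | cons c cs => rfl
  | cons i l ih =>
    cases cs with
    | nil => rfl
    | cons c cs => rw [derProdL, ih (by simpa using h), mul_zero]

theorem std_mem {e : GG I} {a : Ext I} (ha : a ∈ extGr I e) (l : List I) :
    std I a l ∈ CCbideg I (monoDeg I (listMon I l) + (e, 0)) := by
  rw [mem_CCbideg_iff]
  refine ⟨?_, fun s hs => ?_⟩
  · rw [Prod.fst_add, add_comm]
    exact cup_mem I (constCochain_mem I ha) (derProd_mem I l)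
  · ext v
    rw [apply_eq_ev, ev_std]
    change a * derProdL I l (List.ofFn v) = 0
    rw [derProdL_eq_zero, mul_zero]
    rw [List.length_ofFn]
    rintro rfl
    refine hs ?_
    rw [Prod.snd_add, monoDeg_snd, add_zero, listMon]
    clear hs v
    induction l with
    | nil => simp
    | cons i l ih => simp [ih, add_comm]

theorem hochschildDiff_std {e : GG I} {a : Ext I} (ha : a ∈ extGr I e) (l : List I) :
    hochschildDiff (extParity I) (std I a l) = 0 := by
  rw [std, hochschildDiff_cup I (constCochain_mem I ha) (derProd_mem I l),
    hochschildDiff_constCochain I ha, hochschildDiff_derProd, cup_zero_left, cup_zero_right,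
    smul_zero, add_zero]

theorem std_add (a b : Ext I) (l : List I) : std I (a + b) l = std I a l + std I b l := by
  rw [std, constCochain_add, cup_add_left]
  rfl

theorem polySum_zero (s : ℕ) : polySum I s (fun _ => 0) = 0 := by
  induction s with
  | zero => exact TensorProduct.tmul_zero _ _
  | succ s ih => rw [polySum, ih]; simp

theorem polySum_mul_left (a : Ext I) (s : ℕ) (F : List (Ext I) → Ext I) :
    polySum I s (fun l => a * F l) = zmon I 0 a * polySum I s F := by
  induction s generalizing F with
  | zero => exact ((zmon_mul I 0 0 a (F [])).trans (by rw [add_zero]; rfl)).symm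
  | succ s ih =>
    rw [polySum, polySum, Finset.mul_sum]
    refine Finset.sum_congr rfl fun i _ => ?_
    rw [ih, ← mul_assoc, ← mul_assoc, zvar_comm]

/-- On generators each ∂/∂θᵢ is a Kronecker delta, so exactly one sequence of variables survives. -/
theorem polySum_derProdL (l : List I) (s : ℕ) :
    polySum I s (derProdL I l) = if s = l.length then zmon I (listMon I l) 1 else 0 := by
  induction l generalizing s with
  | nil =>
    cases s with
    | zero => rfl
    | succ s =>
      rw [if_neg (by simp)]
      simp only [polySum, derProdL, polySum_zero, mul_zero, Finset.sum_const_zero]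
  | cons i l ih =>
    cases s with
    | zero => exact TensorProduct.tmul_zero _ _
    | succ s =>
      rw [polySum, Finset.sum_eq_single i]
      · simp only [derProdL, dleft_θ, if_true, one_mul]
        rw [ih, List.length_cons, listMon_cons]
        simp only [add_left_inj]
        split_ifs
        · rw [zvar_eq, zmon_mul, one_mul]
        · exact mul_zero _
      · intro j _ hj
        simp only [derProdL, dleft_θ, if_neg hj.symm, zero_mul, polySum_zero, mul_zero]
      · simp

theorem evalz_std (a : Ext I) (l : List I) (s : ℕ) :
    evalz I (std I a l) s = if s = l.length then zmon I (listMon I l) a else 0 := by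
  rw [evalz_eq, ev_std, polySum_mul_left, polySum_derProdL]
  split_ifs
  · rw [zmon_mul, zero_add, mul_one]
  · exact mul_zero _

theorem Xi_std (a : Ext I) (l : List I) : Xi I (std I a l) = zmon I (listMon I l) a := by
  rw [Xi, finsum_eq_single _ l.length fun s hs => by rw [evalz_std, if_neg hs], evalz_std,
    if_pos rfl]

/-- The linear map that sends `z^m a` to a standard cocycle. -/
def stdHom : PolyExt I →ₗ[ℤ] Cochain ℤ (Ext I) :=
  (TensorProduct.lift ((MvPolynomial.basisMonomials I ℤ).constr ℤ fun m =>
    (AddMonoidHom.mk' (fun a => std I a (monList I m)) fun a b =>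
      std_add I a b (monList I m)).toIntLinearMap)).toAddMonoidHom.toIntLinearMap

theorem stdHom_zmon (m : I →₀ ℕ) (a : Ext I) : stdHom I (zmon I m a) = std I a (monList I m) := by
  refine (TensorProduct.lift.tmul _ _).trans ?_
  rw [show MvPolynomial.monomial m (1 : ℤ) = MvPolynomial.basisMonomials I ℤ m from rfl,
    Module.Basis.constr_basis]
  rfl

theorem stdHom_mem {d : GG I × ℤ} {x : PolyExt I} (hx : x ∈ polyExtGr I d) :
    stdHom I x ∈ CCbideg I d := by
  refine polyExtGr_induction I (P := fun x => stdHom I x ∈ CCbideg I d) (fun m e a ha hd => ?_)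
    (by rw [map_zero]; exact zero_mem _) (fun x y hx hy => by rw [map_add]; exact add_mem hx hy) hx
  rw [stdHom_zmon, ← hd]
  have := std_mem I ha (monList I m)
  rwa [listMon_monList] at this

theorem mem_CC_of_CCbideg {d : GG I × ℤ} {α : Cochain ℤ (Ext I)} (hα : α ∈ CCbideg I d) :
    α ∈ CC I := CCdeg_le_CC I d.1 ((mem_CCbideg_iff I).1 hα).1

theorem stdHom_mem_CC (x : PolyExt I) : stdHom I x ∈ CC I := by
  have hx : x ∈ ⨆ d, polyExtGr I d := by rw [iSup_polyExtGr]; trivial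
  refine Submodule.iSup_induction _ hx (motive := fun x => stdHom I x ∈ CC I)
    (fun d x hx => mem_CC_of_CCbideg I (stdHom_mem I hx)) (by rw [map_zero]; exact zero_mem _)
    fun x y hx hy => by rw [map_add]; exact add_mem hx hy

theorem hochschildDiff_stdHom (x : PolyExt I) :
    hochschildDiff (extParity I) (stdHom I x) = 0 := by
  have hx : x ∈ ⨆ d, polyExtGr I d := by rw [iSup_polyExtGr]; trivial
  refine Submodule.iSup_induction _ hx
    (motive := fun x => hochschildDiff (extParity I) (stdHom I x) = 0) (fun d x hx => ?_)
    (by rw [map_zero, hochschildDiff_zero])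
    fun x y hx hy => by rw [map_add, hochschildDiff_add, hx, hy, add_zero]
  refine polyExtGr_induction I (P := fun x => hochschildDiff (extParity I) (stdHom I x) = 0)
    (fun m e a ha hd => ?_) (by rw [map_zero, hochschildDiff_zero])
    (fun x y hx hy => by rw [map_add, hochschildDiff_add, hx, hy, add_zero]) hx
  rw [stdHom_zmon]
  exact hochschildDiff_std I ha _

theorem Xi_stdHom (x : PolyExt I) : Xi I (stdHom I x) = x := by
  refine polyExt_induction I (P := fun x => Xi I (stdHom I x) = x) (fun m a => ?_)
    (fun x y hx hy => ?_) x
  · rw [stdHom_zmon, Xi_std, listMon_monList]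
  · rw [map_add, Xi_add I (stdHom_mem_CC I x) (stdHom_mem_CC I y), hx, hy]

theorem Xi_sub {α β : Cochain ℤ (Ext I)} (hα : α ∈ CC I) (hβ : β ∈ CC I) :
    Xi I (α - β) = Xi I α - Xi I β := by
  rw [eq_sub_iff_add_eq, ← Xi_add I (sub_mem hα hβ) hβ, sub_add_cancel]

/-! ### Reduction of cocycles to standard ones. -/

/-- A homogeneous cocycle is the sum of a standard one and a coboundary. -/
theorem exists_eq_std_add {y : GG I} {α : Cochain ℤ (Ext I)} (hα : α ∈ CCdeg I y)
    (hδ : hochschildDiff (extParity I) α = 0) :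
    ∃ γ ∈ CCdeg I (y - GG.ofInt I 1), α = stdHom I (Xi I α) + hochschildDiff (extParity I) γ := by
  -- All parts of Ξ α have the same first degree y, whatever their length.
  have hσ : stdHom I (Xi I α) ∈ CCdeg I y := by
    refine finsum_induction (fun x => stdHom I x ∈ CCdeg I y) (by rw [map_zero]; exact zero_mem _)
      (fun x z hx hz => by rw [map_add]; exact add_mem hx hz) fun s => ?_
    exact ((mem_CCbideg_iff I).1 (stdHom_mem I (evalz_mem I hα s))).1
  have hsub : α - stdHom I (Xi I α) ∈ CCdeg I y := sub_mem hα hσ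
  have hXi : Xi I (α - stdHom I (Xi I α)) = 0 := by
    rw [Xi_sub I (CCdeg_le_CC I y hα) (stdHom_mem_CC I _), Xi_stdHom, sub_self]
  -- The difference has zero image under Ξ, so its substitutions vanish in each length separately:
  -- other monomials cannot occur for reasons of degree.
  obtain ⟨γ, hγ, h⟩ := exists_hochschildDiff_eq I hsub
    (by rw [hochschildDiff_sub, hδ, hochschildDiff_stdHom, sub_zero]) fun s => by
      funext m
      by_cases hm : Finsupp.degree m = s
      · rw [← hm, ← coeffs_Xi I (CCdeg_le_CC I y hsub), hXi, map_zero]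
      · exact symSum_apply_of_ne I s _ hm
  exact ⟨γ, hγ, by rw [h, add_sub_cancel]⟩

theorem degProj_zero (y : GG I) : degProj I y 0 = 0 := by
  have := degProj_add I y 0 0
  simpa using this

theorem degProj_sum {ι : Type*} (y : GG I) (S : Finset ι) (f : ι → Cochain ℤ (Ext I)) :
    degProj I y (∑ i ∈ S, f i) = ∑ i ∈ S, degProj I y (f i) := by
  classical
  induction S using Finset.induction_on with
  | empty => exact degProj_zero I y
  | insert i S hi ih => rw [Finset.sum_insert hi, Finset.sum_insert hi, degProj_add, ih]

theorem degProj_hochschildDiff (y : GG I) {α : Cochain ℤ (Ext I)} (hα : α ∈ CC I) :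
    degProj I (y + GG.ofInt I 1) (hochschildDiff (extParity I) α)
      = hochschildDiff (extParity I) (degProj I y α) := by
  classical
  refine Submodule.iSup_induction (CCdeg I) hα (motive := fun α =>
    degProj I (y + GG.ofInt I 1) (hochschildDiff (extParity I) α)
      = hochschildDiff (extParity I) (degProj I y α)) (fun z α hα => ?_)
    (by rw [hochschildDiff_zero, degProj_zero, degProj_zero, hochschildDiff_zero])
    fun α β hα hβ => by
      rw [hochschildDiff_add, degProj_add, degProj_add, hochschildDiff_add, hα, hβ]
  rw [degProj_of_mem I hα, degProj_of_mem I (hochschildDiff_mem I hα)]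
  simp only [add_left_inj]
  split_ifs
  · rfl
  · exact (hochschildDiff_zero I).symm

/-- A cocycle is a sum of homogeneous cocycles. -/
theorem cocycle_induction {P : Cochain ℤ (Ext I) → Prop}
    (h : ∀ y, ∀ α ∈ CCdeg I y, hochschildDiff (extParity I) α = 0 → P α)
    (hadd : ∀ α β, α ∈ cocycles I → β ∈ cocycles I → P α → P β → P (α + β))
    {α : Cochain ℤ (Ext I)} (hα : α ∈ cocycles I) : P α := by
  classical
  obtain ⟨hCC, hδ⟩ := hα
  obtain ⟨f, hf, hsum⟩ := (Submodule.mem_iSup_iff_exists_finsupp (CCdeg I) α).1 hCC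
  have hsum' : α = ∑ y ∈ f.support, f y := hsum.symm
  -- The summands of α are recovered by projection, which commutes with δ up to the shift of degree;
  -- hence each is itself a cocycle.
  have hproj : ∀ y, degProj I y α = f y := by
    intro y
    rw [hsum', degProj_sum, Finset.sum_congr rfl fun z _ => degProj_of_mem I (hf z),
      Finset.sum_ite_eq']
    split_ifs with hy
    · rfl
    · exact (Finsupp.notMem_support_iff.1 hy).symm
  have hfδ : ∀ y, hochschildDiff (extParity I) (f y) = 0 := by
    intro y
    have hz : hochschildDiff (extParity I) α = 0 := hδ
    rw [← hproj y, ← degProj_hochschildDiff I y hCC, hz, degProj_zero]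
  have hmem : ∀ y, f y ∈ cocycles I := fun y => ⟨CCdeg_le_CC I y (hf y), hfδ y⟩
  have key : ∀ S : Finset (GG I), ∑ y ∈ S, f y ∈ cocycles I ∧ P (∑ y ∈ S, f y) := by
    intro S
    induction S using Finset.induction_on with
    | empty => exact ⟨zero_mem _, h 0 0 (zero_mem _) (hochschildDiff_zero I)⟩
    | insert y S hy ih =>
      rw [Finset.sum_insert hy]
      exact ⟨add_mem (hmem y) ih.1, hadd _ _ (hmem y) ih.1 (h y _ (hf y) (hfδ y)) ih.2⟩
  rw [hsum']
  exact (key f.support).2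

end Std

/-! ### The HKR map respects products and brackets -/

section Products

variable (I : Type u) [Fintype I] [DecidableEq I]

theorem bracket_zero_left (β : Cochain ℤ (Ext I)) : gerstenhaberBracket (extParity I) 0 β = 0 := by
  have := bracket_add_left (extParity I) 0 0 β
  simpa using this

theorem bracket_zero_right (α : Cochain ℤ (Ext I)) :
    gerstenhaberBracket (extParity I) α 0 = 0 := by
  have := bracket_add_right (extParity I) α 0 0
  simpa using this

theorem mem_cocycles_of {y : GG I} {α : Cochain ℤ (Ext I)} (hα : α ∈ CCdeg I y)
    (h : hochschildDiff (extParity I) α = 0) : α ∈ cocycles I := ⟨CCdeg_le_CC I y hα, h⟩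

theorem mem_coboundaries_of {y : GG I} {α : Cochain ℤ (Ext I)} (hα : α ∈ CCdeg I y) :
    hochschildDiff (extParity I) α ∈ coboundaries I := ⟨α, CCdeg_le_CC I y hα, rfl⟩

theorem stdHom_mem_cocycles (x : PolyExt I) : stdHom I x ∈ cocycles I :=
  ⟨stdHom_mem_CC I x, hochschildDiff_stdHom I x⟩

theorem coboundaries_induction {P : Cochain ℤ (Ext I) → Prop}
    (h : ∀ y, ∀ γ ∈ CCdeg I y, P (hochschildDiff (extParity I) γ))
    (hadd : ∀ α β, P α → P β → P (α + β)) {α : Cochain ℤ (Ext I)} (hα : α ∈ coboundaries I) :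
    P α := by
  obtain ⟨γ, hγ, rfl⟩ := hα
  refine Submodule.iSup_induction (CCdeg I) hγ
    (motive := fun γ => P (hochschildDiff (extParity I) γ)) h (h 0 0 (zero_mem _))
    fun x y hx hy => ?_
  rw [hochschildDiff_add]
  exact hadd _ _ hx hy

theorem coboundaries_le : coboundaries I ≤ cocycles I := fun _ hα =>
  coboundaries_induction I (P := fun α => α ∈ cocycles I) (fun _ _ hγ =>
    mem_cocycles_of I (hochschildDiff_mem I hγ) (hochschildDiff_hochschildDiff I hγ))
    (fun _ _ h h' => add_mem h h') hα

theorem Xi_of_mem_coboundaries {α : Cochain ℤ (Ext I)} (hα : α ∈ coboundaries I) :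
    Xi I α = 0 := by
  have key : α ∈ CC I ∧ Xi I α = 0 := by
    refine coboundaries_induction I (P := fun α => α ∈ CC I ∧ Xi I α = 0) (fun y γ hγ => ?_)
      (fun α β h h' => ⟨add_mem h.1 h'.1, by rw [Xi_add I h.1 h'.1, h.2, h'.2, add_zero]⟩) hα
    refine ⟨CCdeg_le_CC I _ (hochschildDiff_mem I hγ), ?_⟩
    refine (finsum_congr fun s => ?_).trans finsum_zero
    refine coeffs_injective I ?_
    rw [coeffs_evalz, symSum_hochschildDiff I hγ, map_zero]
  exact key.2

/-- A cocycle is the sum of a standard one and a coboundary. -/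
theorem sub_stdHom_mem {α : Cochain ℤ (Ext I)} (hα : α ∈ cocycles I) :
    α - stdHom I (Xi I α) ∈ coboundaries I := by
  refine cocycle_induction I (P := fun α => α - stdHom I (Xi I α) ∈ coboundaries I)
    (fun y α hα hδ => ?_) (fun α β hα hβ h h' => ?_) hα
  · obtain ⟨γ, hγ, h⟩ := exists_eq_std_add I hα hδ
    rw [sub_eq_iff_eq_add'.2 h]
    exact mem_coboundaries_of I hγ
  · rw [Xi_add I hα.1 hβ.1, map_add, add_sub_add_comm]
    exact add_mem h h'

/-- A product on cochains that respects cocycles and coboundaries corresponds to a given product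
under the HKR map when it does so for standard cocycles. -/
theorem Xi_op {op : Cochain ℤ (Ext I) → Cochain ℤ (Ext I) → Cochain ℤ (Ext I)}
    (op' : PolyExt I →ₗ[ℤ] PolyExt I →ₗ[ℤ] PolyExt I)
    (hl : ∀ α α' β, op (α + α') β = op α β + op α' β)
    (hr : ∀ α β β', op α (β + β') = op α β + op α β')
    (h1 : ∀ y y' α β, α ∈ CCdeg I y → β ∈ CCdeg I y' → hochschildDiff (extParity I) α = 0 →
      hochschildDiff (extParity I) β = 0 → op α β ∈ cocycles I)
    (h2 : ∀ y y' γ β, γ ∈ CCdeg I y → β ∈ CCdeg I y' →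
      hochschildDiff (extParity I) β = 0 → op (hochschildDiff (extParity I) γ) β ∈ coboundaries I)
    (h3 : ∀ y y' α γ, α ∈ CCdeg I y → γ ∈ CCdeg I y' →
      hochschildDiff (extParity I) α = 0 → op α (hochschildDiff (extParity I) γ) ∈ coboundaries I)
    (h4 : ∀ l e a l' e' a', a ∈ extGr I e → a' ∈ extGr I e' →
      Xi I (op (std I a l) (std I a' l')) = op' (zmon I (listMon I l) a) (zmon I (listMon I l') a'))
    {α β : Cochain ℤ (Ext I)} (hα : α ∈ cocycles I) (hβ : β ∈ cocycles I) :
    op α β ∈ cocycles I ∧ Xi I (op α β) = op' (Xi I α) (Xi I β) := by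
  have hc : ∀ {α β : Cochain ℤ (Ext I)}, α ∈ cocycles I → β ∈ cocycles I →
      op α β ∈ cocycles I := fun hα hβ => by
    refine cocycle_induction I (P := fun α => op α _ ∈ cocycles I) (fun y α hα hδ => ?_)
      (fun α β _ _ h h' => by rw [hl]; exact add_mem h h') hα
    exact cocycle_induction I (P := fun β => op α β ∈ cocycles I)
      (fun y' β hβ hδ' => h1 y y' α β hα hβ hδ hδ')
      (fun α β _ _ h h' => by rw [hr]; exact add_mem h h') hβ
  have hbl : ∀ {α β : Cochain ℤ (Ext I)}, α ∈ coboundaries I → β ∈ cocycles I →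
      op α β ∈ coboundaries I := fun hα hβ => by
    refine coboundaries_induction I (P := fun α => op α _ ∈ coboundaries I) (fun y γ hγ => ?_)
      (fun α β h h' => by rw [hl]; exact add_mem h h') hα
    exact cocycle_induction I (P := fun β => op _ β ∈ coboundaries I)
      (fun y' β hβ hδ' => h2 y y' γ β hγ hβ hδ')
      (fun α β _ _ h h' => by rw [hr]; exact add_mem h h') hβ
  have hbr : ∀ {α β : Cochain ℤ (Ext I)}, α ∈ cocycles I → β ∈ coboundaries I →
      op α β ∈ coboundaries I := fun hα hβ => by
    refine cocycle_induction I (P := fun α => op α _ ∈ coboundaries I) (fun y α hα hδ => ?_)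
      (fun α β _ _ h h' => by rw [hl]; exact add_mem h h') hα
    exact coboundaries_induction I (P := fun β => op α β ∈ coboundaries I)
      (fun y' γ hγ => h3 y y' α γ hα hγ hδ)
      (fun α β h h' => by rw [hr]; exact add_mem h h') hβ
  have hstd : ∀ x x', Xi I (op (stdHom I x) (stdHom I x')) = op' x x' := by
    have hx : ∀ x : PolyExt I, x ∈ ⨆ d, polyExtGr I d := fun x => by rw [iSup_polyExtGr]; trivial
    have hind : ∀ {P : PolyExt I → Prop}, (∀ l e a, a ∈ extGr I e → P (zmon I (listMon I l) a)) →
        (∀ x y, P x → P y → P (x + y)) → ∀ x, P x := fun {P} h hadd x => by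
      have h0 : P 0 := by simpa using h [] 0 0 (zero_mem _)
      refine Submodule.iSup_induction _ (hx x) (motive := P) (fun d x hx => ?_) h0 hadd
      refine polyExtGr_induction I (fun m e a ha _ => ?_) h0 hadd hx
      have := h (monList I m) e a ha
      rwa [listMon_monList] at this
    intro x x'
    refine hind (P := fun x => Xi I (op (stdHom I x) (stdHom I x')) = op' x x')
      (fun l e a ha => ?_) (fun x y h h' => ?_) x
    · refine hind (P := fun x' => Xi I (op (stdHom I (zmon I (listMon I l) a)) (stdHom I x'))
        = op' (zmon I (listMon I l) a) x') (fun l' e' a' ha' => ?_) (fun x y h h' => ?_) x'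
      · rw [stdHom_zmon, stdHom_zmon, h4 _ e a _ e' a' ha ha', listMon_monList, listMon_monList]
      · rw [map_add, hr, Xi_add I (hc (stdHom_mem_cocycles I _) (stdHom_mem_cocycles I _)).1
          (hc (stdHom_mem_cocycles I _) (stdHom_mem_cocycles I _)).1, h, h', map_add]
    · rw [map_add, hl, Xi_add I (hc (stdHom_mem_cocycles I _) (stdHom_mem_cocycles I _)).1
        (hc (stdHom_mem_cocycles I _) (stdHom_mem_cocycles I _)).1, h, h', map_add,
        LinearMap.add_apply]
  refine ⟨hc hα hβ, ?_⟩
  -- The factors are replaced by standard cocycles one after the other. Each replacement costs the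
  -- product of a cocycle and a coboundary.
  have e1 : op α β = op (stdHom I (Xi I α)) (stdHom I (Xi I β))
      + (op (α - stdHom I (Xi I α)) β + op (stdHom I (Xi I α)) (β - stdHom I (Xi I β))) := by
    rw [add_left_comm, ← hr, add_sub_cancel, ← hl, sub_add_cancel]
  have hb : op (α - stdHom I (Xi I α)) β + op (stdHom I (Xi I α)) (β - stdHom I (Xi I β))
      ∈ coboundaries I :=
    add_mem (hbl (sub_stdHom_mem I hα) hβ) (hbr (stdHom_mem_cocycles I _) (sub_stdHom_mem I hβ))
  rw [e1, Xi_add I (hc (stdHom_mem_cocycles I _) (stdHom_mem_cocycles I _)).1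
    (coboundaries_le I hb).1, Xi_of_mem_coboundaries I hb, add_zero, hstd]

/-! #### Products -/

theorem polySum_add (s : ℕ) (F G : List (Ext I) → Ext I) :
    polySum I s (fun l => F l + G l) = polySum I s F + polySum I s G := by
  induction s generalizing F G with
  | zero => exact TensorProduct.tmul_add _ _ _
  | succ s ih => simp only [polySum, ih, mul_add, Finset.sum_add_distrib]

/-- Cutting a list of copies of 𝐳 into two splits the substitution into a product. The sign operator
is invisible on generators, and the zᵢ are central. -/
theorem polySum_cupL {g : Ext I → Ext I} (hg : ∀ i, g (θ I i) = θ I i) (s : ℕ)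
    (F G : List (Ext I) → Ext I) : polySum I s (cupL g F G)
      = ∑ p ∈ Finset.HasAntidiagonal.antidiagonal s, polySum I p.1 F * polySum I p.2 G := by
  induction s generalizing F G with
  | zero =>
    rw [Finset.HasAntidiagonal.antidiagonal_zero, Finset.sum_singleton]
    exact (zmon_mul I 0 0 (F []) (G [])).symm
  | succ s ih =>
    have h0 : polySum I (s + 1) (cupL g F G)
        = ∑ i, zvar I i * polySum I s (fun l => cupL g F G (θ I i :: l)) := rfl
    rw [h0, Finset.Nat.sum_antidiagonal_succ]
    have h1 : ∀ i, polySum I s (fun l => cupL g F G (θ I i :: l))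
        = zmon I 0 (F []) * polySum I s (fun l => G (θ I i :: l))
          + ∑ p ∈ Finset.HasAntidiagonal.antidiagonal s,
            polySum I p.1 (fun l => F (θ I i :: l)) * polySum I p.2 G := by
      intro i
      rw [← polySum_mul_left, ← ih, ← polySum_add]
      congr 1
      funext l
      rw [cupL, splitSum]
      simp only [List.map_nil, List.map_cons, hg]
      rfl
    simp only [h1, mul_add, Finset.sum_add_distrib]
    congr 1
    · change _ = zmon I 0 (F []) * ∑ i, zvar I i * polySum I s fun l => G (θ I i :: l)
      rw [Finset.mul_sum]
      exact Finset.sum_congr rfl fun i _ => by rw [← mul_assoc, zvar_comm, mul_assoc]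
    · simp only [Finset.mul_sum]
      rw [Finset.sum_comm]
      refine Finset.sum_congr rfl fun p _ => ?_
      rw [polySum, Finset.sum_mul]
      exact Finset.sum_congr rfl fun i _ => (mul_assoc _ _ _).symm

theorem evalz_cup (α : Cochain ℤ (Ext I)) {y : GG I} {β : Cochain ℤ (Ext I)} (hβ : β ∈ CCdeg I y)
    (s : ℕ) : evalz I (cup (extParity I) α β) s
      = ∑ p ∈ Finset.HasAntidiagonal.antidiagonal s, evalz I α p.1 * evalz I β p.2 := by
  simp only [evalz_eq]
  rw [cup_of_mem I α hβ, ev_cupHom, polySum_cupL I (koszul_θ I _)]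

theorem std_mem_CCdeg {e : GG I} {a : Ext I} (ha : a ∈ extGr I e) (l : List I) :
    std I a l ∈ CCdeg I ((monoDeg I (listMon I l)).1 + e) :=
  ((mem_CCbideg_iff I).1 (std_mem I ha l)).1

theorem Xi_cup_std {e : GG I} {a : Ext I} (l : List I) {l' : List I} {a' : Ext I}
    (ha' : a' ∈ extGr I e) : Xi I (cup (extParity I) (std I a l) (std I a' l'))
      = zmon I (listMon I l) a * zmon I (listMon I l') a' := by
  have h : ∀ s, evalz I (cup (extParity I) (std I a l) (std I a' l')) s
      = if s = l.length + l'.length then zmon I (listMon I l) a * zmon I (listMon I l') a'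
        else 0 := by
    intro s
    rw [evalz_cup I _ (std_mem_CCdeg I ha' l')]
    simp only [evalz_std]
    split_ifs with hs
    · rw [Finset.sum_eq_single (l.length, l'.length)]
      · simp
      · rintro ⟨i, j⟩ _ hij
        rw [ne_eq, Prod.mk.injEq, not_and_or] at hij
        rcases hij with h | h <;> simp [h]
      · intro hn
        exact absurd (Finset.HasAntidiagonal.mem_antidiagonal.2 hs.symm) hn
    · refine Finset.sum_eq_zero ?_
      rintro ⟨i, j⟩ hij
      rw [Finset.HasAntidiagonal.mem_antidiagonal] at hij
      dsimp only at hij ⊢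
      by_cases hi : i = l.length
      · have hj : j ≠ l'.length := fun hj => hs (by rw [← hij, hi, hj])
        rw [if_neg hj, mul_zero]
      · rw [if_neg hi, zero_mul]
  rw [Xi, finsum_eq_single _ (l.length + l'.length) fun s hs => by rw [h, if_neg hs], h, if_pos rfl]

theorem Xi_cup {α β : Cochain ℤ (Ext I)} (hα : α ∈ cocycles I) (hβ : β ∈ cocycles I) :
    cup (extParity I) α β ∈ cocycles I ∧
      Xi I (cup (extParity I) α β) = Xi I α * Xi I β := by
  refine Xi_op I (LinearMap.mul ℤ (PolyExt I)) (cup_add_left _) (cup_add_right _)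
    (fun y y' α β hα hβ h h' => ?_) (fun y y' γ β hγ hβ h => ?_) (fun y y' α γ hα hγ h => ?_)
    (fun l e a l' e' a' ha ha' => Xi_cup_std I l ha') hα hβ
  · refine mem_cocycles_of I (cup_mem I hα hβ) ?_
    rw [hochschildDiff_cup I hα hβ, h, h', cup_zero_left, cup_zero_right, smul_zero, add_zero]
  · have := hochschildDiff_cup I hγ hβ
    rw [h, cup_zero_right, smul_zero, add_zero] at this
    rw [← this]
    exact mem_coboundaries_of I (cup_mem I hγ hβ)
  · have := hochschildDiff_cup I hα hγ
    rw [h, cup_zero_left, zero_add] at this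
    have h2 := congrArg (sgn (GG.parity I y) • ·) this
    simp only [smul_smul, sgn_mul_self, one_smul] at h2
    rw [← h2]
    exact Submodule.smul_mem _ _ (mem_coboundaries_of I (cup_mem I hα hγ))

/-! #### Brackets -/

theorem dz_zmon (i : I) (m : I →₀ ℕ) (a : Ext I) :
    dz I i (zmon I m a) = MvPolynomial.pderiv i (MvPolynomial.monomial m (1 : ℤ)) ⊗ₜ[ℤ] a := rfl

theorem dθleft_zmon (i : I) (m : I →₀ ℕ) (a : Ext I) :
    dθleft I i (zmon I m a) = zmon I m (dleft I i a) := rfl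

theorem dθright_zmon (i : I) (m : I →₀ ℕ) (a : Ext I) :
    dθright I i (zmon I m a) = zmon I m (dright I i a) := rfl

theorem dz_mul (i : I) (x y : PolyExt I) : dz I i (x * y) = dz I i x * y + x * dz I i y := by
  refine polyExt_induction I (P := fun x => dz I i (x * y) = dz I i x * y + x * dz I i y)
    (fun m a => ?_) (fun x x' h h' => ?_) x
  · refine polyExt_induction I (P := fun y => dz I i (zmon I m a * y)
      = dz I i (zmon I m a) * y + zmon I m a * dz I i y) (fun m' a' => ?_) (fun x x' h h' => ?_) y
    · rw [dz_zmon, dz_zmon, Algebra.TensorProduct.tmul_mul_tmul,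
        Algebra.TensorProduct.tmul_mul_tmul, Algebra.TensorProduct.tmul_mul_tmul,
        ← TensorProduct.add_tmul]
      refine (?_ : _ = MvPolynomial.pderiv i (MvPolynomial.monomial m (1 : ℤ)
        * MvPolynomial.monomial m' 1) ⊗ₜ[ℤ] (a * a')).trans ?_
      · rfl
      · rw [Derivation.leibniz, smul_eq_mul, smul_eq_mul, add_comm,
          mul_comm (MvPolynomial.monomial m' 1)]
    · rw [mul_add, map_add, map_add, mul_add, mul_add, h, h']
      abel
  · rw [add_mul, map_add, map_add, add_mul, add_mul, h, h']
    abel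

theorem dz_zvar (i j : I) : dz I i (zvar I j) = if i = j then 1 else 0 := by
  rw [zvar, show dz I i (MvPolynomial.X j ⊗ₜ[ℤ] 1) = MvPolynomial.pderiv i (MvPolynomial.X j)
    ⊗ₜ[ℤ] (1 : Ext I) from rfl, MvPolynomial.pderiv_X, Pi.single_apply]
  by_cases h : i = j
  · rw [if_pos h.symm, if_pos h]; rfl
  · rw [if_neg (Ne.symm h), if_neg h, TensorProduct.zero_tmul]

/-- The first half of the Schouten bracket. -/
def halfSchouten (x y : PolyExt I) : PolyExt I := ∑ i, dz I i x * dθleft I i y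

/-- The Leibniz rule for ∂/∂zᵢ, in the form needed for the induction on the derivations in
`polySum_brace`. -/
theorem halfSchouten_zvar_mul (i : I) (x y : PolyExt I) :
    halfSchouten I (zvar I i * x) y = x * dθleft I i y + zvar I i * halfSchouten I x y := by
  simp only [halfSchouten, dz_mul, add_mul, Finset.sum_add_distrib, Finset.mul_sum, mul_assoc]
  congr 1
  rw [Finset.sum_eq_single i]
  · rw [dz_zvar, if_pos rfl, one_mul]
  · intro j _ hj
    rw [dz_zvar, if_neg hj, zero_mul]
  · simp

theorem zmon_one_comm (m : I →₀ ℕ) (x : PolyExt I) : zmon I m 1 * x = x * zmon I m 1 := by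
  refine polyExt_induction I (P := fun x => zmon I m 1 * x = x * zmon I m 1) (fun m' a => ?_)
    (fun x y hx hy => ?_) x
  · rw [zmon_mul, zmon_mul, add_comm, one_mul, mul_one]
  · rw [mul_add, add_mul, hx, hy]

theorem halfSchouten_zmon (m : I →₀ ℕ) (a : Ext I) (y : PolyExt I) :
    halfSchouten I (zmon I m a) y = zmon I 0 a * halfSchouten I (zmon I m 1) y := by
  rw [halfSchouten, halfSchouten, Finset.mul_sum]
  refine Finset.sum_congr rfl fun i _ => ?_
  rw [dz_zmon, dz_zmon, ← mul_assoc, Algebra.TensorProduct.tmul_mul_tmul, mul_one,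
    show MvPolynomial.monomial (0 : I →₀ ℕ) (1 : ℤ) = 1 from rfl, one_mul]

theorem polySum_dleft (i : I) (s : ℕ) (F : List (Ext I) → Ext I) :
    polySum I s (fun l => dleft I i (F l)) = dθleft I i (polySum I s F) := by
  induction s generalizing F with
  | zero => rfl
  | succ s ih =>
    rw [polySum, polySum, map_sum]
    refine Finset.sum_congr rfl fun j _ => ?_
    rw [ih]
    generalize polySum I s (fun l => F (θ I j :: l)) = x
    refine polyExt_induction I (P := fun x => zvar I j * dθleft I i x = dθleft I i (zvar I j * x))
      (fun m a => ?_) (fun x y h h' => ?_) x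
    · rw [zvar_eq, zmon_mul, dθleft_zmon, dθleft_zmon, zmon_mul, one_mul, one_mul]
    · rw [map_add, mul_add, mul_add, map_add, h, h']

/-- Induction on the derivations: b is inserted into the first of them, giving ∂/∂θᵢ of its
substitution, or into a later one, giving a factor zᵢ. These are the two terms of
`halfSchouten_zvar_mul`. The condition s + 1 = ⋯ avoids a truncated subtraction; with no slots both
sides are zero. -/
theorem polySum_brace {g : Ext I → Ext I} (hg : ∀ i, g (θ I i) = θ I i) {b : List (Ext I) → Ext I}
    {t : ℕ} (hb : ∀ n, n ≠ t → polySum I n b = 0) (l : List I) (s : ℕ) :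
    polySum I s (brace g (derProdL I l) b) = if s + 1 = l.length + t then
      halfSchouten I (zmon I (listMon I l) 1) (polySum I t b) else 0 := by
  induction l generalizing s with
  | nil =>
    have h1 : brace g (derProdL I []) b = fun _ => 0 := by
      funext cs
      refine (splitSum_congr fun u w _ => ?_).trans (splitSum_zero cs)
      refine (splitSum_congr fun v r _ => ?_).trans (splitSum_zero w)
      cases u <;> rfl
    have h2 : halfSchouten I (zmon I (listMon I []) 1) (polySum I t b) = 0 := by
      refine Finset.sum_eq_zero fun i _ => ?_
      rw [dz_zmon, show listMon I [] = 0 from rfl,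
        show MvPolynomial.monomial (0 : I →₀ ℕ) (1 : ℤ) = 1 from rfl, Derivation.map_one_eq_zero,
        TensorProduct.zero_tmul, zero_mul]
    rw [h1, h2, polySum_zero, ite_self]
  | cons i l ih =>
    have h1 : brace g (derProdL I (i :: l)) b = fun cs =>
        cupL id (fun v => dleft I i (b v)) (derProdL I l) cs
          + (match cs with
            | [] => 0
            | c :: cs => dleft I i (g c) * brace g (derProdL I l) b cs) := by
      funext cs
      cases cs with
      | nil =>
        rw [brace_nil, add_zero]
        rfl
      | cons c cs =>
        rw [brace_cons]
        congr 1
        · rw [cupL]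
          simp only [List.map_id]
          rfl
        · simp only [brace, derProdL]
          exact ((map_splitSum (AddMonoidHom.mulLeft (dleft I i (g c))) _ cs).trans
            (splitSum_congr fun u w _ =>
              map_splitSum (AddMonoidHom.mulLeft (dleft I i (g c))) _ w)).symm
    have h2 : polySum I s (cupL id (fun v => dleft I i (b v)) (derProdL I l))
        = if s + 1 = l.length + 1 + t then
          zmon I (listMon I l) 1 * dθleft I i (polySum I t b) else 0 := by
      rw [polySum_cupL I fun _ => rfl]
      simp only [polySum_derProdL, polySum_dleft]
      split_ifs with hs
      · rw [Finset.sum_eq_single (t, l.length)]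
        · rw [if_pos rfl, zmon_one_comm]
        · rintro ⟨p, q⟩ _ hpq
          rw [ne_eq, Prod.mk.injEq, not_and_or] at hpq
          rcases hpq with h | h
          · dsimp only
            rw [hb p h, map_zero, zero_mul]
          · dsimp only
            rw [if_neg h, mul_zero]
        · intro hn
          exact absurd (Finset.HasAntidiagonal.mem_antidiagonal.2 (by dsimp only; omega)) hn
      · refine Finset.sum_eq_zero ?_
        rintro ⟨p, q⟩ hpq
        rw [Finset.HasAntidiagonal.mem_antidiagonal] at hpq
        dsimp only at hpq ⊢
        by_cases hp : p = t
        · rw [if_neg (by omega), mul_zero]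
        · rw [hb p hp, map_zero, zero_mul]
    have h3 : polySum I s (fun cs => match cs with
          | [] => 0
          | c :: cs => dleft I i (g c) * brace g (derProdL I l) b cs)
        = if s + 1 = l.length + 1 + t then
          zvar I i * halfSchouten I (zmon I (listMon I l) 1) (polySum I t b) else 0 := by
      cases s with
      | zero =>
        rw [polySum, TensorProduct.tmul_zero]
        split_ifs with hs
        · have hl : l = [] := List.length_eq_zero_iff.1 (by omega)
          have ht : t = 0 := by omega
          rw [hl, show listMon I [] = 0 from rfl, halfSchouten]
          simp only [dz_zmon]
          rw [show MvPolynomial.monomial (0 : I →₀ ℕ) (1 : ℤ) = 1 from rfl]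
          simp
        · rfl
      | succ s =>
        rw [polySum, Finset.sum_eq_single i]
        · simp only [hg, dleft_θ, if_true, one_mul]
          rw [show (fun cs => brace g (derProdL I l) b cs) = brace g (derProdL I l) b from rfl, ih]
          by_cases hs : s + 1 = l.length + t
          · rw [if_pos hs, if_pos (by omega)]
          · rw [if_neg hs, if_neg (by omega), mul_zero]
        · intro j _ hj
          simp only [hg, dleft_θ, if_neg hj.symm, zero_mul, polySum_zero, mul_zero]
        · simp
    rw [h1, polySum_add, h2, h3, List.length_cons, listMon_cons]
    split_ifs
    · rw [← halfSchouten_zvar_mul, zvar_eq, zmon_mul, one_mul]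
    · exact add_zero 0

theorem brace_mul_left {A : Type*} [Ring A] (g : A → A) (a : A) (F b : List A → A) (l : List A) :
    brace g (fun t => a * F t) b l = a * brace g F b l := by
  simp only [brace]
  exact ((map_splitSum (AddMonoidHom.mulLeft a) _ l).trans (splitSum_congr fun u w _ =>
    map_splitSum (AddMonoidHom.mulLeft a) _ w)).symm

theorem evalz_brace_std (p : ZMod 2) (a : Ext I) (l : List I) (a' : Ext I) (l' : List I) (s : ℕ) :
    evalz I (braceHom (extParity I) p (std I a l) (std I a' l')) s
      = if s + 1 = l.length + l'.length then
        halfSchouten I (zmon I (listMon I l) a) (zmon I (listMon I l') a') else 0 := by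
  have hb : ∀ n, polySum I n (ev (std I a' l'))
      = if n = l'.length then zmon I (listMon I l') a' else 0 := fun n => by
    rw [← evalz_eq, evalz_std]
  have h : ev (braceHom (extParity I) p (std I a l) (std I a' l'))
      = fun cs => a * brace (koszul (extParity I) (p - 1)) (derProdL I l) (ev (std I a' l')) cs := by
    funext cs
    rw [ev_braceHom, ev_std I a l, brace_mul_left]
  rw [evalz_eq, h, polySum_mul_left, polySum_brace I (koszul_θ I _) (t := l'.length)
    (fun n hn => by rw [hb, if_neg hn]), hb, if_pos rfl]
  split_ifs
  · rw [← halfSchouten_zmon]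
  · exact mul_zero _

theorem tmul_comm (p q : MvPolynomial I ℤ) {e e' : GG I} {a a' : Ext I} (ha : a ∈ extGr I e)
    (ha' : a' ∈ extGr I e') : (p ⊗ₜ[ℤ] a) * (q ⊗ₜ[ℤ] a')
      = sgn (GG.parity I e * GG.parity I e') • ((q ⊗ₜ[ℤ] a') * (p ⊗ₜ[ℤ] a)) := by
  rw [Algebra.TensorProduct.tmul_mul_tmul, Algebra.TensorProduct.tmul_mul_tmul, mul_comm p,
    extGr_mul_comm I ha ha', TensorProduct.tmul_smul]

theorem schouten_apply (x y : PolyExt I) : schouten I x y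
    = ∑ i, (dz I i x * dθleft I i y - dθright I i x * dz I i y) := by
  rw [schouten, LinearMap.sum_apply, LinearMap.sum_apply]
  rfl

/-- The second half of the bracket is the first with the factors exchanged: turning the right
derivative into a left one and commuting the factors gives exactly the sign in the Gerstenhaber
bracket. -/
theorem schouten_zmon (m m' : I →₀ ℕ) {e e' : GG I} {a a' : Ext I} (ha : a ∈ extGr I e)
    (ha' : a' ∈ extGr I e') : schouten I (zmon I m a) (zmon I m' a')
      = halfSchouten I (zmon I m a) (zmon I m' a')
        - sgn ((GG.parity I e - 1) * (GG.parity I e' - 1)) •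
          halfSchouten I (zmon I m' a') (zmon I m a) := by
  rw [schouten_apply, halfSchouten, halfSchouten, Finset.smul_sum, ← Finset.sum_sub_distrib]
  refine Finset.sum_congr rfl fun i _ => ?_
  congr 1
  rw [dθright_zmon, dright_of_mem I i ha, zmon, TensorProduct.tmul_smul, smul_mul_assoc, dz_zmon,
    tmul_comm I _ _ (dleft_mem I i ha) ha', smul_smul, ← sgn_add, map_sub, parity_θdeg,
    dθleft_zmon]
  congr 2
  generalize GG.parity I e = p
  generalize GG.parity I e' = q
  revert p q
  decide

theorem Xi_bracket_std (l : List I) {e : GG I} {a : Ext I} (l' : List I) {e' : GG I} {a' : Ext I}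
    (ha : a ∈ extGr I e) (ha' : a' ∈ extGr I e') :
    Xi I (gerstenhaberBracket (extParity I) (std I a l) (std I a' l'))
      = schouten I (zmon I (listMon I l) a) (zmon I (listMon I l') a') := by
  have hp : ∀ (l : List I) (e : GG I), GG.parity I ((monoDeg I (listMon I l)).1 + e)
      = GG.parity I e := fun l e => by rw [map_add, parity_monoDeg, zero_add]
  have h : ∀ s, evalz I (gerstenhaberBracket (extParity I) (std I a l) (std I a' l')) s
      = if s + 1 = l.length + l'.length then
        schouten I (zmon I (listMon I l) a) (zmon I (listMon I l') a') else 0 := by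
    intro s
    rw [bracket_of_mem I (std_mem_CCdeg I ha l) (std_mem_CCdeg I ha' l'), sub_eq_add_neg, ← neg_smul,
      evalz_add, evalz_smul, evalz_brace_std, evalz_brace_std, hp, hp, schouten_zmon I _ _ ha ha',
      add_comm l'.length]
    split_ifs
    · rw [neg_smul, ← sub_eq_add_neg]
    · rw [smul_zero, add_zero]
  -- For two constants the bracket would have length -1; here both sides vanish.
  by_cases hN : l.length + l'.length = 0
  · have h1 : l = [] := List.length_eq_zero_iff.1 (by omega)
    have h2 : l' = [] := List.length_eq_zero_iff.1 (by omega)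
    have hz : ∀ i (a : Ext I), dz I i (zmon I 0 a) = 0 := fun i a => by
      rw [dz_zmon, show MvPolynomial.monomial (0 : I →₀ ℕ) (1 : ℤ) = 1 from rfl,
        Derivation.map_one_eq_zero, TensorProduct.zero_tmul]
    rw [schouten_apply, h1, h2, show listMon I [] = 0 from rfl, Xi]
    simp only [hz, zero_mul, mul_zero, sub_zero, Finset.sum_const_zero]
    refine (finsum_congr fun s => ?_).trans finsum_zero
    have := h s
    rwa [if_neg (by omega), h1, h2] at this
  · obtain ⟨n, hn⟩ := Nat.exists_eq_succ_of_ne_zero hN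
    rw [Xi, finsum_eq_single _ n fun s hs => by rw [h, if_neg (by omega)], h, if_pos hn.symm]

theorem Xi_bracket {α β : Cochain ℤ (Ext I)} (hα : α ∈ cocycles I) (hβ : β ∈ cocycles I) :
    gerstenhaberBracket (extParity I) α β ∈ cocycles I ∧
      Xi I (gerstenhaberBracket (extParity I) α β) = schouten I (Xi I α) (Xi I β) := by
  refine Xi_op I (schouten I) (bracket_add_left _) (bracket_add_right _)
    (fun y y' α β hα hβ h h' => ?_) (fun y y' γ β hγ hβ h => ?_) (fun y y' α γ hα hγ h => ?_)
    (fun l e a l' e' a' ha ha' => Xi_bracket_std I l l' ha ha') hα hβ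
  · refine mem_cocycles_of I (bracket_mem I hα hβ) ?_
    rw [hochschildDiff_bracket I hα hβ, h, h', bracket_zero_left, bracket_zero_right, smul_zero,
      sub_zero]
  · have := hochschildDiff_bracket I hγ hβ
    rw [h, bracket_zero_right, smul_zero, sub_zero] at this
    rw [← this]
    exact mem_coboundaries_of I (bracket_mem I hγ hβ)
  · have := hochschildDiff_bracket I hα hγ
    rw [h, bracket_zero_left, zero_sub, ← neg_smul] at this
    have h2 := congrArg (-sgn (GG.parity I y) • ·) this
    simp only [smul_smul, neg_mul_neg, sgn_mul_self, one_smul] at h2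
    rw [← h2]
    exact Submodule.smul_mem _ _ (mem_coboundaries_of I (bracket_mem I hα hγ))

end Products

/-! ### Polyvector fields form a graded Gerstenhaber algebra -/

section Polyvector

variable (I : Type*) [Fintype I] [DecidableEq I]

theorem polyExtGr_add_induction {P : PolyExt I → Prop} (h : ∀ d, ∀ x ∈ polyExtGr I d, P x)
    (hadd : ∀ x y, P x → P y → P (x + y)) (x : PolyExt I) : P x :=
  Submodule.iSup_induction (polyExtGr I) (motive := P)
    (by rw [iSup_polyExtGr]; trivial : x ∈ ⨆ d, polyExtGr I d) h (h 0 0 (zero_mem _)) hadd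

theorem bigParity_monoDeg (m : I →₀ ℕ) (e : GG I) :
    bigParity I (monoDeg I m + (e, 0)) = GG.parity I e := by
  change GG.parity I ((monoDeg I m).1 + e) = _
  rw [map_add, parity_monoDeg, zero_add]

theorem polyExtGr_mul_comm {c d : GG I × ℤ} {x y : PolyExt I} (hx : x ∈ polyExtGr I c)
    (hy : y ∈ polyExtGr I d) : x * y = sgn (bigParity I c * bigParity I d) • (y * x) := by
  refine polyExtGr_induction I (P := fun x => x * y = sgn (bigParity I c * bigParity I d) • (y * x))
    (fun m e a ha hc => ?_) (by rw [zero_mul, mul_zero, smul_zero])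
    (fun x x' h h' => by rw [add_mul, mul_add, smul_add, h, h']) hx
  refine polyExtGr_induction I (P := fun y => zmon I m a * y
    = sgn (bigParity I c * bigParity I d) • (y * zmon I m a))
    (fun m' e' a' ha' hd => ?_) (by rw [zero_mul, mul_zero, smul_zero])
    (fun x x' h h' => by rw [add_mul, mul_add, smul_add, h, h']) hy
  rw [← hc, ← hd, bigParity_monoDeg, bigParity_monoDeg]
  exact tmul_comm I _ _ ha ha'

theorem dz_mem (i : I) {d : GG I × ℤ} {x : PolyExt I} (hx : x ∈ polyExtGr I d) :
    dz I i x ∈ polyExtGr I (d - (zdeg I i, 1)) := by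
  refine polyExtGr_induction I (P := fun x => dz I i x ∈ polyExtGr I (d - (zdeg I i, 1)))
    (fun m e a ha hd => ?_) (by rw [map_zero]; exact zero_mem _)
    (fun x y h h' => by rw [map_add]; exact add_mem h h') hx
  rw [dz_zmon, MvPolynomial.pderiv_monomial, one_mul]
  by_cases hm : m i = 0
  · rw [hm, Nat.cast_zero, map_zero, TensorProduct.zero_tmul]
    exact zero_mem _
  · have h1 : monoDeg I m = monoDeg I (m - Finsupp.single i 1) + (zdeg I i, 1) := by
      rw [← monoDeg_single, ← map_add, tsub_add_cancel_of_le]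
      exact Finsupp.single_le_iff.2 (Nat.one_le_iff_ne_zero.2 hm)
    have h2 : d - (zdeg I i, 1) = monoDeg I (m - Finsupp.single i 1) + (e, 0) := by
      rw [← hd, h1]
      abel
    rw [h2, show MvPolynomial.monomial (m - Finsupp.single i 1) ((m i : ℕ) : ℤ)
      = ((m i : ℕ) : ℤ) • MvPolynomial.monomial (m - Finsupp.single i 1) (1 : ℤ) by
        rw [MvPolynomial.smul_monomial, smul_eq_mul, mul_one], ← TensorProduct.smul_tmul']
    exact Submodule.smul_mem _ _ (zmon_mem I ha _)

theorem dθleft_mem (i : I) {d : GG I × ℤ} {x : PolyExt I} (hx : x ∈ polyExtGr I d) :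
    dθleft I i x ∈ polyExtGr I (d - (θdeg I i, 0)) := by
  refine polyExtGr_induction I (P := fun x => dθleft I i x ∈ polyExtGr I (d - (θdeg I i, 0)))
    (fun m e a ha hd => ?_) (by rw [map_zero]; exact zero_mem _)
    (fun x y h h' => by rw [map_add]; exact add_mem h h') hx
  have h2 : d - (θdeg I i, 0) = monoDeg I m + (e - θdeg I i, 0) := by
    rw [← hd, add_sub_assoc, Prod.mk_sub_mk, sub_zero]
  rw [h2, dθleft_zmon]
  exact zmon_mem I (dleft_mem I i ha) m

theorem dθright_of_mem (i : I) {d : GG I × ℤ} {x : PolyExt I} (hx : x ∈ polyExtGr I d) :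
    dθright I i x = sgn (bigParity I d - 1) • dθleft I i x := by
  refine polyExtGr_induction I (P := fun x => dθright I i x = sgn (bigParity I d - 1) • dθleft I i x)
    (fun m e a ha hd => ?_) (by rw [map_zero, map_zero, smul_zero])
    (fun x y h h' => by rw [map_add, map_add, smul_add, h, h']) hx
  rw [← hd, bigParity_monoDeg, dθright_zmon, dright_of_mem I i ha, dθleft_zmon, zmon, zmon,
    TensorProduct.tmul_smul]

theorem dθleft_mul (i : I) {d : GG I × ℤ} {x : PolyExt I} (hx : x ∈ polyExtGr I d)
    (y : PolyExt I) : dθleft I i (x * y)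
      = dθleft I i x * y + sgn (bigParity I d) • (x * dθleft I i y) := by
  refine polyExtGr_induction I (P := fun x => dθleft I i (x * y)
      = dθleft I i x * y + sgn (bigParity I d) • (x * dθleft I i y))
    (fun m e a ha hd => ?_) (by simp) (fun x x' h h' => ?_) hx
  · refine polyExt_induction I (P := fun y => dθleft I i (zmon I m a * y)
      = dθleft I i (zmon I m a) * y + sgn (bigParity I d) • (zmon I m a * dθleft I i y))
      (fun m' a' => ?_) (fun y y' h h' => ?_) y
    · rw [← hd, bigParity_monoDeg, zmon_mul, dθleft_zmon, dθleft_zmon, dθleft_zmon, zmon_mul,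
        zmon_mul, dleft_mul, inv_of_mem I ha, smul_mul_assoc, zmon_add, zmon, zmon, zmon,
        TensorProduct.tmul_smul]
    · rw [mul_add, map_add, map_add, mul_add, mul_add, h, h', smul_add]
      abel
  · rw [add_mul, map_add, map_add, add_mul, add_mul, h, h', smul_add]
    abel

theorem bigParity_sub_z (i : I) (d : GG I × ℤ) :
    bigParity I (d - (zdeg I i, 1)) = bigParity I d := by
  rw [map_sub, show bigParity I (zdeg I i, 1) = 0 from parity_zdeg I i, sub_zero]

theorem bigParity_sub_θ (i : I) (d : GG I × ℤ) :
    bigParity I (d - (θdeg I i, 0)) = bigParity I d - 1 := by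
  rw [map_sub, show bigParity I (θdeg I i, 0) = 1 from parity_θdeg I i]

theorem schouten_of_mem {c : GG I × ℤ} {x : PolyExt I} (hx : x ∈ polyExtGr I c) (y : PolyExt I) :
    schouten I x y = ∑ i, (dz I i x * dθleft I i y
      - sgn (bigParity I c - 1) • (dθleft I i x * dz I i y)) := by
  rw [schouten_apply]
  refine Finset.sum_congr rfl fun i _ => ?_
  rw [dθright_of_mem I i hx, smul_mul_assoc]

theorem schouten_mem {c d : GG I × ℤ} {x y : PolyExt I} (hx : x ∈ polyExtGr I c)
    (hy : y ∈ polyExtGr I d) : schouten I x y ∈ polyExtGr I (c + d + bracketDeg I) := by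
  rw [schouten_of_mem I hx]
  have hb : ∀ i, bracketDeg I = -((zdeg I i, 1) + (θdeg I i, 0)) := fun i => by
    have h := θdeg_eq I i
    rw [sub_eq_iff_eq_add] at h
    rw [h, Prod.mk_add_mk, add_neg_cancel_left, bracketDeg, add_zero, Prod.neg_mk]
    rfl
  refine sum_mem fun i _ => sub_mem ?_ (Submodule.smul_mem _ _ ?_)
  · rw [show c + d + bracketDeg I = (c - (zdeg I i, 1)) + (d - (θdeg I i, 0)) by
      rw [hb i]; abel]
    exact polyExtGr_mul I (dz_mem I i hx) (dθleft_mem I i hy)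
  · rw [show c + d + bracketDeg I = (c - (θdeg I i, 0)) + (d - (zdeg I i, 1)) by
      rw [hb i]; abel]
    exact polyExtGr_mul I (dθleft_mem I i hx) (dz_mem I i hy)

theorem schouten_antisymm {c d : GG I × ℤ} {x y : PolyExt I} (hx : x ∈ polyExtGr I c)
    (hy : y ∈ polyExtGr I d) : schouten I x y
      = -(sgn ((bigParity I c - 1) * (bigParity I d - 1)) • schouten I y x) := by
  rw [schouten_of_mem I hx, schouten_of_mem I hy, Finset.smul_sum, ← Finset.sum_neg_distrib]
  refine Finset.sum_congr rfl fun i _ => ?_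
  rw [polyExtGr_mul_comm I (dz_mem I i hx) (dθleft_mem I i hy),
    polyExtGr_mul_comm I (dθleft_mem I i hx) (dz_mem I i hy), bigParity_sub_z, bigParity_sub_θ,
    bigParity_sub_z, bigParity_sub_θ, smul_sub, neg_sub, smul_smul, smul_smul, ← sgn_add, ← sgn_add]
  generalize bigParity I c = p
  generalize bigParity I d = q
  congr 3 <;> revert p q <;> decide

theorem schouten_mul {c d : GG I × ℤ} {x y : PolyExt I} (z : PolyExt I) (hx : x ∈ polyExtGr I c)
    (hy : y ∈ polyExtGr I d) : schouten I x (y * z) = schouten I x y * z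
      + sgn ((bigParity I c - 1) * bigParity I d) • (y * schouten I x z) := by
  simp only [schouten_of_mem I hx]
  rw [Finset.sum_mul, Finset.mul_sum, Finset.smul_sum, ← Finset.sum_add_distrib]
  refine Finset.sum_congr rfl fun i _ => ?_
  have h1 : dz I i x * y = sgn (bigParity I c * bigParity I d) • (y * dz I i x) := by
    rw [polyExtGr_mul_comm I (dz_mem I i hx) hy, bigParity_sub_z]
  have h2 : dθleft I i x * y = sgn ((bigParity I c - 1) * bigParity I d) • (y * dθleft I i x) := by
    rw [polyExtGr_mul_comm I (dθleft_mem I i hx) hy, bigParity_sub_θ]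
  have h3 : sgn (bigParity I d) * sgn (bigParity I c * bigParity I d)
      = sgn ((bigParity I c - 1) * bigParity I d) := by
    rw [← sgn_add]
    generalize bigParity I c = p
    generalize bigParity I d = q
    revert p q
    decide
  rw [dθleft_mul I i hy, dz_mul, mul_add, mul_add, mul_smul_comm, ← mul_assoc, ← mul_assoc,
    ← mul_assoc, ← mul_assoc, h1, h2, smul_mul_assoc, smul_smul, h3, smul_mul_assoc,
    sub_mul (dz I i x * dθleft I i y), mul_sub y, smul_mul_assoc, mul_smul_comm, smul_add, smul_sub, mul_assoc y, mul_assoc y,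
    smul_comm (sgn (bigParity I c - 1)) (sgn ((bigParity I c - 1) * bigParity I d))]
  abel

theorem Xi_smul (k : ℤ) {α : Cochain ℤ (Ext I)} (hα : α ∈ CC I) : Xi I (k • α) = k • Xi I α :=
  (XiHom I).map_smul k ⟨α, hα⟩

theorem stdHom_mem_CCdeg {d : GG I × ℤ} {x : PolyExt I} (hx : x ∈ polyExtGr I d) :
    stdHom I x ∈ CCdeg I d.1 := ((mem_CCbideg_iff I).1 (stdHom_mem I hx)).1

/-- Lift the three polyvectors to standard cocycles, apply the Jacobi identity for cochains, and
take the image under Ξ, which respects brackets of cocycles. -/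
theorem schouten_jacobi {c d : GG I × ℤ} {x y : PolyExt I} (z : PolyExt I)
    (hx : x ∈ polyExtGr I c) (hy : y ∈ polyExtGr I d) :
    schouten I x (schouten I y z) = schouten I (schouten I x y) z
      + sgn ((bigParity I c - 1) * (bigParity I d - 1)) • schouten I y (schouten I x z) := by
  refine polyExtGr_add_induction I (P := fun z => schouten I x (schouten I y z)
    = schouten I (schouten I x y) z
      + sgn ((bigParity I c - 1) * (bigParity I d - 1)) • schouten I y (schouten I x z))
    (fun e z hz => ?_) (fun z z' h h' => ?_) z
  · have hX := stdHom_mem_cocycles I x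
    have hY := stdHom_mem_cocycles I y
    have hZ := stdHom_mem_cocycles I z
    have hXY := Xi_bracket I hX hY
    have hYZ := Xi_bracket I hY hZ
    have hXZ := Xi_bracket I hX hZ
    have h1 := Xi_bracket I hX hYZ.1
    have h2 := Xi_bracket I hXY.1 hZ
    have h3 := Xi_bracket I hY hXZ.1
    have h := congrArg (Xi I) (bracket_jacobi I (stdHom_mem_CCdeg I hx) (stdHom_mem_CCdeg I hy)
      (stdHom_mem_CCdeg I hz))
    rw [Xi_add I h2.1.1 (Submodule.smul_mem _ _ h3.1.1), Xi_smul I _ h3.1.1, h1.2, h2.2, h3.2,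
      hXY.2, hYZ.2, hXZ.2, Xi_stdHom, Xi_stdHom, Xi_stdHom] at h
    exact h
  · simp only [map_add, smul_add, h, h']
    abel

theorem isGradedGerstenhaber_polyExtGr : IsGradedGerstenhaber (bigParity I) (bracketDeg I)
    (polyExtGr I) (LinearMap.mul ℤ (PolyExt I)) (schouten I) 1 where
  par_bracket := (parity_ofInt I (-1)).trans (by decide)
  isInternal := by
    convert isInternal_polyExtGr I
    rfl
  one_mem := one_mem_polyExtGr I
  mul_mem _ _ _ _ hx hy := polyExtGr_mul I hx hy
  br_mem _ _ _ _ hx hy := schouten_mem I hx hy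
  one_mul := one_mul
  mul_one := mul_one
  mul_assoc := mul_assoc
  mul_comm _ _ _ _ hx hy := polyExtGr_mul_comm I hx hy
  br_antisymm _ _ _ _ hx hy := schouten_antisymm I hx hy
  jacobi _ _ _ _ z hx hy := schouten_jacobi I z hx hy
  leibniz _ _ _ _ z hx hy := schouten_mul I z hx hy

end Polyvector

/-! ### The isomorphism -/

theorem IsGradedGerstenhaber.of_equiv {D H H' : Type*} [AddCommGroup D] [AddCommGroup H]
    [AddCommGroup H'] {par : D →+ ZMod 2} {b : D} {gr : D → Submodule ℤ H}
    {gr' : D → Submodule ℤ H'} {mul br : H →ₗ[ℤ] H →ₗ[ℤ] H} {mul' br' : H' →ₗ[ℤ] H' →ₗ[ℤ] H'}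
    {one : H} {one' : H'} (h : IsGradedGerstenhaber par b gr' mul' br' one') (Φ : H ≃ₗ[ℤ] H')
    (hgr : ∀ d, (gr d).map (Φ : H →ₗ[ℤ] H') = gr' d) (hone : Φ one = one')
    (hmul : ∀ x y, Φ (mul x y) = mul' (Φ x) (Φ y)) (hbr : ∀ x y, Φ (br x y) = br' (Φ x) (Φ y)) :
    IsGradedGerstenhaber par b gr mul br one := by
  classical
  have hm : ∀ {d x}, x ∈ gr d ↔ Φ x ∈ gr' d := fun {d x} => by
    rw [← hgr d]
    exact ⟨fun hx => ⟨x, hx, rfl⟩, fun ⟨_, hy, e⟩ => Φ.injective e ▸ hy⟩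
  have e : gr' = Submodule.orderIsoMapComap Φ ∘ gr := funext fun d => (hgr d).symm
  refine
    { par_bracket := h.par_bracket
      isInternal := ?_
      one_mem := hm.2 (hone ▸ h.one_mem)
      mul_mem := fun c d x y hx hy => hm.2 (hmul x y ▸ h.mul_mem c d _ _ (hm.1 hx) (hm.1 hy))
      br_mem := fun c d x y hx hy => hm.2 (hbr x y ▸ h.br_mem c d _ _ (hm.1 hx) (hm.1 hy))
      one_mul := fun x => Φ.injective (by rw [hmul, hone, h.one_mul])
      mul_one := fun x => Φ.injective (by rw [hmul, hone, h.mul_one])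
      mul_assoc := fun x y z => Φ.injective (by simp only [hmul, h.mul_assoc])
      mul_comm := fun c d x y hx hy => Φ.injective (by
        rw [map_smul, hmul, hmul, h.mul_comm c d _ _ (hm.1 hx) (hm.1 hy)])
      br_antisymm := fun c d x y hx hy => Φ.injective (by
        rw [map_neg, map_smul, hbr, hbr, h.br_antisymm c d _ _ (hm.1 hx) (hm.1 hy)])
      jacobi := fun c d x y z hx hy => Φ.injective (by
        rw [map_add, map_smul]
        simp only [hbr]
        exact h.jacobi c d _ _ _ (hm.1 hx) (hm.1 hy))
      leibniz := fun c d x y z hx hy => Φ.injective (by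
        rw [map_add, map_smul]
        simp only [hbr, hmul]
        exact h.leibniz c d _ _ _ (hm.1 hx) (hm.1 hy)) }
  have hi := (DirectSum.isInternal_submodule_iff_iSupIndep_and_iSup_eq_top _).1 h.isInternal
  rw [e] at hi
  refine (DirectSum.isInternal_submodule_iff_iSupIndep_and_iSup_eq_top _).2
    ⟨(iSupIndep_map_orderIso_iff _).1 hi.1, (Submodule.orderIsoMapComap Φ).injective ?_⟩
  rw [OrderIso.map_iSup, OrderIso.map_top]
  exact hi.2

section Isomorphism

variable (I : Type*) [Fintype I] [DecidableEq I]

theorem hochschildDiff_mem_CC {α : Cochain ℤ (Ext I)} (hα : α ∈ CC I) :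
    hochschildDiff (extParity I) α ∈ CC I ∧
      hochschildDiff (extParity I) (hochschildDiff (extParity I) α) = 0 := by
  refine Submodule.iSup_induction (CCdeg I) hα (motive := fun α =>
    hochschildDiff (extParity I) α ∈ CC I ∧
      hochschildDiff (extParity I) (hochschildDiff (extParity I) α) = 0)
    (fun y α hα => ⟨CCdeg_le_CC I _ (hochschildDiff_mem I hα), hochschildDiff_hochschildDiff I hα⟩)
    ?_ fun α β h h' => ?_
  · rw [hochschildDiff_zero, hochschildDiff_zero]
    exact ⟨zero_mem _, rfl⟩
  · rw [hochschildDiff_add, hochschildDiff_add, h.2, h'.2, add_zero]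
    exact ⟨add_mem h.1 h'.1, rfl⟩

/-- The HKR map on cocycles. -/
def XiCocycles : cocycles I →ₗ[ℤ] PolyExt I :=
  (XiHom I).comp (Submodule.inclusion inf_le_left)

theorem XiCocycles_apply (α : cocycles I) : XiCocycles I α = Xi I α.1 := rfl

/-- Ξ kills coboundaries, and a cocycle differs by a coboundary from the standard one built from its
image; so if the image is zero, it is a coboundary. -/
theorem ker_XiCocycles :
    LinearMap.ker (XiCocycles I) = (coboundaries I).comap (cocycles I).subtype := by
  ext α
  rw [LinearMap.mem_ker, XiCocycles_apply, Submodule.mem_comap, Submodule.subtype_apply]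
  refine ⟨fun h => ?_, Xi_of_mem_coboundaries I⟩
  have := sub_stdHom_mem I α.2
  rwa [h, map_zero, sub_zero] at this

theorem XiCocycles_surjective : Function.Surjective (XiCocycles I) := fun x =>
  ⟨⟨stdHom I x, stdHom_mem_cocycles I x⟩, Xi_stdHom I x⟩

/-- The isomorphism induced by the HKR map. -/
def hkrEquiv : HH I ≃ₗ[ℤ] PolyExt I :=
  (Submodule.quotEquivOfEq _ _ (ker_XiCocycles I).symm).trans
    ((XiCocycles I).quotKerEquivOfSurjective (XiCocycles_surjective I))

theorem hkrEquiv_mk (α : cocycles I) : hkrEquiv I (HH.mk I α) = Xi I α.1 := rfl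

theorem hkrEquiv_symm_eq {α : Cochain ℤ (Ext I)} (hα : α ∈ cocycles I) {x : PolyExt I}
    (h : Xi I α = x) : (hkrEquiv I).symm x = HH.mk I ⟨α, hα⟩ := by
  rw [LinearEquiv.symm_apply_eq, hkrEquiv_mk, h]

theorem map_HHgr (d : GG I × ℤ) :
    (HHgr I d).map (hkrEquiv I : HH I →ₗ[ℤ] PolyExt I) = polyExtGr I d := by
  refine le_antisymm ?_ fun x hx => ?_
  · rintro _ ⟨_, ⟨α, hα, rfl⟩, rfl⟩
    exact Xi_mem I hα
  · exact ⟨_, ⟨⟨stdHom I x, stdHom_mem_cocycles I x⟩, stdHom_mem I hx, rfl⟩, Xi_stdHom I x⟩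

/-- The operation on Hochschild cohomology that corresponds to an operation on polyvectors. -/
def pullOp (op : PolyExt I →ₗ[ℤ] PolyExt I →ₗ[ℤ] PolyExt I) : HH I →ₗ[ℤ] HH I →ₗ[ℤ] HH I :=
  (op.compl₁₂ (hkrEquiv I : HH I →ₗ[ℤ] PolyExt I) (hkrEquiv I : HH I →ₗ[ℤ] PolyExt I)).compr₂
    ((hkrEquiv I).symm : PolyExt I →ₗ[ℤ] HH I)

theorem hkrEquiv_pullOp (op : PolyExt I →ₗ[ℤ] PolyExt I →ₗ[ℤ] PolyExt I) (x y : HH I) :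
    hkrEquiv I (pullOp I op x y) = op (hkrEquiv I x) (hkrEquiv I y) :=
  (hkrEquiv I).apply_symm_apply _

theorem unitCochain_mem_cocycles : unitCochain ℤ (Ext I) ∈ cocycles I :=
  mem_cocycles_of I (constCochain_mem I (extGr_zero_one I))
    (hochschildDiff_constCochain I (extGr_zero_one I))

theorem Xi_unitCochain : Xi I (unitCochain ℤ (Ext I)) = 1 := by
  have h : ∀ s, evalz I (constCochain I 1) s = if s = 0 then 1 else 0 := fun s => by
    cases s with
    | zero =>
      rw [evalz_eq, if_pos rfl]
      rfl
    | succ s =>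
      rw [evalz_eq, if_neg (Nat.succ_ne_zero s), polySum]
      refine Finset.sum_eq_zero fun i _ => ?_
      simp only [ev_constCochain_cons]
      rw [polySum_zero, mul_zero]
  rw [show unitCochain ℤ (Ext I) = constCochain I 1 from rfl, Xi,
    finsum_eq_single _ 0 fun s hs => by rw [h, if_neg hs], h, if_pos rfl]

end Isomorphism

end HKR

end

theorem mainTheorem6 (I : Type*) [Fintype I] [DecidableEq I] :
    -- the Hochschild complex is a complex
    (∀ α ∈ HKR.CC I, HKR.hochschildDiff (HKR.extParity I) α ∈ HKR.CC I ∧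
      HKR.hochschildDiff (HKR.extParity I) (HKR.hochschildDiff (HKR.extParity I) α) = 0) ∧
    -- the sum that defines the HKR map is finite
    (∀ α ∈ HKR.CC I, {s : ℕ | HKR.evalz I α s ≠ 0}.Finite) ∧
    ∃ (mul br : HKR.HH I →ₗ[ℤ] HKR.HH I →ₗ[ℤ] HKR.HH I) (one : HKR.HH I)
      (Φ : HKR.HH I ≃ₗ[ℤ] HKR.PolyExt I),
      -- the operations on cohomology are induced by those on cochains
      (∀ α β : HKR.cocycles I, ∃ h : HKR.cup (HKR.extParity I) α.1 β.1 ∈ HKR.cocycles I,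
        mul (HKR.HH.mk I α) (HKR.HH.mk I β) = HKR.HH.mk I ⟨_, h⟩) ∧
      (∀ α β : HKR.cocycles I,
        ∃ h : HKR.gerstenhaberBracket (HKR.extParity I) α.1 β.1 ∈ HKR.cocycles I,
        br (HKR.HH.mk I α) (HKR.HH.mk I β) = HKR.HH.mk I ⟨_, h⟩) ∧
      (∃ h : HKR.unitCochain ℤ (HKR.Ext I) ∈ HKR.cocycles I, one = HKR.HH.mk I ⟨_, h⟩) ∧
      -- both sides are graded Gerstenhaber algebras
      HKR.IsGradedGerstenhaber (HKR.bigParity I) (HKR.bracketDeg I) (HKR.HHgr I) mul br one ∧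
      HKR.IsGradedGerstenhaber (HKR.bigParity I) (HKR.bracketDeg I) (HKR.polyExtGr I)
        (LinearMap.mul ℤ (HKR.PolyExt I)) (HKR.schouten I) 1 ∧
      -- the HKR map induces the isomorphism of graded Gerstenhaber algebras
      (∀ α : HKR.cocycles I, Φ (HKR.HH.mk I α) = HKR.Xi I α.1) ∧
      (∀ d, (HKR.HHgr I d).map (Φ : HKR.HH I →ₗ[ℤ] HKR.PolyExt I) = HKR.polyExtGr I d) ∧
      Φ one = 1 ∧
      (∀ x y, Φ (mul x y) = Φ x * Φ y) ∧
      (∀ x y, Φ (br x y) = HKR.schouten I (Φ x) (Φ y)) := by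
  -- The operations on cohomology are taken to be those of polyvectors, transported along the
  -- isomorphism. That cochain operations induce them is then the compatibility of Ξ with products
  -- and brackets of cocycles, and the Gerstenhaber axioms are inherited.
  refine ⟨fun α hα => HKR.hochschildDiff_mem_CC I hα, fun α hα => HKR.evalz_finite I hα,
    HKR.pullOp I (LinearMap.mul ℤ (HKR.PolyExt I)), HKR.pullOp I (HKR.schouten I),
    HKR.HH.mk I ⟨_, HKR.unitCochain_mem_cocycles I⟩, HKR.hkrEquiv I, fun α β => ?_, fun α β => ?_,
    ⟨_, rfl⟩, ?_, HKR.isGradedGerstenhaber_polyExtGr I, HKR.hkrEquiv_mk I, HKR.map_HHgr I,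
    HKR.Xi_unitCochain I, HKR.hkrEquiv_pullOp I _, HKR.hkrEquiv_pullOp I _⟩
  · have h := HKR.Xi_cup I α.2 β.2
    exact ⟨h.1, HKR.hkrEquiv_symm_eq I h.1 h.2⟩
  · have h := HKR.Xi_bracket I α.2 β.2
    exact ⟨h.1, HKR.hkrEquiv_symm_eq I h.1 h.2⟩
  · exact (HKR.isGradedGerstenhaber_polyExtGr I).of_equiv (HKR.hkrEquiv I) (HKR.map_HHgr I)
      (HKR.Xi_unitCochain I) (HKR.hkrEquiv_pullOp I _) (HKR.hkrEquiv_pullOp I _)
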